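/- Theorem. Fix a rational number $\alpha>1$ and a positive integer $t$. Then the Max-Buying-PL-Limited-$(\alpha,t)$ Problem can be solved in polynomial time: there is a deterministic algorithm that, for every instance, outputs an optimal solution in time (on a random access machine with logarithmic cost) bounded by a polynomial in the length of the binary representation of the instance, where the algorithm and the polynomial may depend on $\alpha$ and $t$. Here an instance consists of items $I=\{1,\dots,n\}$, bidders $B=\{1,\dots,m\}$, a non-negative integer valuation matrix $v=(v_{ib})_{i\in I,b\in B}$ and a number of copies $C_i\in\mathbb{Z}_{\ge 0}$ of each item $i$. Put $d_k=\max\{v_{ib} : i\in I,\ b\in B\}/\alpha^k$ for every integer $k\ge 0$ (the maximum of an empty matrix is $0$). A feasible solution is a pair $(p,x)$ of a rational pricing $p\in\mathbb{Q}_{\ge 0}^{I}$ and an allocation $x=(x_b)_{b\in B}$ of a set $x_b\subseteq I$ of items to each bidder $b$, such that 1. $p_1\ge p_2\ge\dots\ge p_n$, and $p_i\in\{d_0,d_1,\dots\}$ for every item $i$; 2. $p_i\le v_{ib}$ whenever $i\in x_b$; 3. every item $i$ is allocated to at most $C_i$ bidders; 4. for every bidder $b$ and every integer $r\ge 0$,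 at most one item $i\in x_b$ has its price $p_i$ in $\{d_{rt},d_{rt+1},\dots,d_{(r+1)t-1}\}$. An optimal solution is a feasible solution of maximum profit $\sum_{b\in B}\sum_{i\in x_b}p_i$. -/

import Mathlib

/-!
Polynomial time is measured on random access machines with the logarithmic cost criterion.
A machine has unbounded arrays of natural numbers, named by numerals (a program mentions
only finitely many of them; a register is an array that is used at index `0` only), and the
arithmetic operations `+`, truncated `-`, `*` and integer division. Its control flow is structured.
-/

namespace RAM

/-- Memory contents: `σ a i` is the number in cell `i` of array `a`. -/
abbrev Memory := ℕ → ℕ → ℕ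

/-- Arithmetic terms. `get a e` reads the cell of array `a` whose index is the value of `e`. -/
inductive Term where
  | const (c : ℕ)
  | get (a : ℕ) (e : Term)
  | add (e₁ e₂ : Term)
  | sub (e₁ e₂ : Term)
  | mul (e₁ e₂ : Term)
  | div (e₁ e₂ : Term)

/-- The value of a term. -/
def Term.value (σ : Memory) : Term → ℕ
  | .const c => c
  | .get a e => σ a (e.value σ)
  | .add e₁ e₂ => e₁.value σ + e₂.value σ
  | .sub e₁ e₂ => e₁.value σ - e₂.value σ
  | .mul e₁ e₂ => e₁.value σ * e₂.value σ
  | .div e₁ e₂ => e₁.value σ / e₂.value σ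

/-- The logarithmic cost of evaluating a term: every operation costs one unit, plus the number of
binary digits of its result, and the costs of its operands (indices included) are added. -/
def Term.cost (σ : Memory) : Term → ℕ
  | .const c => 1 + Nat.size c
  | .get a e => e.cost σ + (1 + Nat.size (σ a (e.value σ)))
  | .add e₁ e₂ => e₁.cost σ + e₂.cost σ + (1 + Nat.size (e₁.value σ + e₂.value σ))
  | .sub e₁ e₂ => e₁.cost σ + e₂.cost σ + (1 + Nat.size (e₁.value σ - e₂.value σ))
  | .mul e₁ e₂ => e₁.cost σ + e₂.cost σ + (1 + Nat.size (e₁.value σ * e₂.value σ))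
  | .div e₁ e₂ => e₁.cost σ + e₂.cost σ + (1 + Nat.size (e₁.value σ / e₂.value σ))

/-- Programs. `put a e₁ e₂` stores the value of `e₂` in the cell of array `a` whose index is the
value of `e₁`; `cond` and `loop` test whether a term is nonzero. -/
inductive Program where
  | skip
  | put (a : ℕ) (e₁ e₂ : Term)
  | seq (P Q : Program)
  | cond (e : Term) (P Q : Program)
  | loop (e : Term) (P : Program)

/-- Memory `σ` after storing `x` in cell `i` of array `a`. -/
def Memory.store (σ : Memory) (a i x : ℕ) : Memory :=
  Function.update σ a (Function.update (σ a) i x)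

/-- `Exec P σ σ' T`: started on memory `σ`, program `P` halts with memory `σ'`, at total
logarithmic cost exactly `T`. -/
inductive Exec : Program → Memory → Memory → ℕ → Prop where
  | skip (σ : Memory) : Exec .skip σ σ 1
  | put (σ : Memory) (a : ℕ) (e₁ e₂ : Term) :
      Exec (.put a e₁ e₂) σ (σ.store a (e₁.value σ) (e₂.value σ)) (e₁.cost σ + e₂.cost σ + 1)
  | seq {P Q : Program} {σ₁ σ₂ σ₃ : Memory} {S T : ℕ}
      (hP : Exec P σ₁ σ₂ S) (hQ : Exec Q σ₂ σ₃ T) : Exec (.seq P Q) σ₁ σ₃ (S + T)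
  | cond_true {e : Term} {P Q : Program} {σ σ' : Memory} {T : ℕ}
      (he : e.value σ ≠ 0) (hP : Exec P σ σ' T) : Exec (.cond e P Q) σ σ' (e.cost σ + T + 1)
  | cond_false {e : Term} {P Q : Program} {σ σ' : Memory} {T : ℕ}
      (he : e.value σ = 0) (hQ : Exec Q σ σ' T) : Exec (.cond e P Q) σ σ' (e.cost σ + T + 1)
  | loop_stop {e : Term} {P : Program} {σ : Memory}
      (he : e.value σ = 0) : Exec (.loop e P) σ σ (e.cost σ + 1)
  | loop_step {e : Term} {P : Program} {σ₁ σ₂ σ₃ : Memory} {S T : ℕ}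
      (he : e.value σ₁ ≠ 0) (hP : Exec P σ₁ σ₂ S) (hL : Exec (.loop e P) σ₂ σ₃ T) :
      Exec (.loop e P) σ₁ σ₃ (e.cost σ₁ + S + T + 1)

/-- The initial memory: array `0` holds the input word, every other cell holds `0`. -/
def initial (w : List ℕ) : Memory := fun a i => if a = 0 then w.getD i 0 else 0

/-- The length of the binary representation of a word of natural numbers (one unit per number
serves as a separator). -/
def bitLength (w : List ℕ) : ℕ := (w.map fun x => Nat.size x + 1).sum

/-- A search problem is given by an encoding of its instances `x` as words, by the relation
`IsSolution x y`, and by the relation `Represents x out y`, which says that the contents `out` of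
the output array are a representation of `y`. It is solvable in polynomial time if one program,
started on the encoding of any instance `x`, halts with a representation of a solution of `x` in
its output array (array `1`), at cost polynomial in the binary length of the encoding. -/
def PolyTimeSolvable {X : Type} {Y : X → Type} (encode : X → List ℕ)
    (Represents : (x : X) → (ℕ → ℕ) → Y x → Prop) (IsSolution : (x : X) → Y x → Prop) : Prop :=
  ∃ (P : Program) (q : Polynomial ℕ), ∀ x : X, ∃ (σ : Memory) (T : ℕ),
    Exec P (initial (encode x)) σ T ∧ T ≤ q.eval (bitLength (encode x)) ∧
      ∃ y : Y x, Represents x (σ 1) y ∧ IsSolution x y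

end RAM

namespace MaxBuying

/-- An instance: `n` items, `m` bidders, `C i` copies of item `i`, and the value `v i b` of item
`i` to bidder `b`. -/
structure Instance where
  n : ℕ
  m : ℕ
  C : Fin n → ℕ
  v : Fin n → Fin m → ℕ

/-- The largest entry of the valuation matrix (`0` if the matrix is empty). -/
def Instance.maxValue (X : Instance) : ℕ :=
  (Finset.univ : Finset (Fin X.n × Fin X.m)).sup fun q => X.v q.1 q.2

/-- The grid price `d_k = max v / α ^ k`. -/
def Instance.gridPrice (X : Instance) (α : ℚ) (k : ℕ) : ℚ := (X.maxValue : ℚ) / α ^ k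

/-- The `r`-th block `{d_{rt}, d_{rt+1}, …, d_{(r+1)t-1}}` of grid prices. -/
def Instance.block (X : Instance) (α : ℚ) (t r : ℕ) : Set ℚ :=
  {z | ∃ k : ℕ, r * t ≤ k ∧ k < (r + 1) * t ∧ z = X.gridPrice α k}

/-- A pricing of the items and an allocation of a set of items to each bidder. -/
structure Outcome (X : Instance) where
  price : Fin X.n → ℚ
  alloc : Fin X.m → Finset (Fin X.n)

/-- The auctioneer's profit. -/
def Outcome.profit {X : Instance} (s : Outcome X) : ℚ := ∑ b, ∑ i ∈ s.alloc b, s.price i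

/-- Feasible solutions of the Max-Buying-PL-Limited-`(α,t)` Problem. -/
structure Outcome.IsFeasible {X : Instance} (α : ℚ) (t : ℕ) (s : Outcome X) : Prop where
  price_nonneg : ∀ i, 0 ≤ s.price i
  price_ladder : ∀ i j, i ≤ j → s.price j ≤ s.price i
  price_grid : ∀ i, ∃ k : ℕ, s.price i = X.gridPrice α k
  affordable : ∀ b, ∀ i ∈ s.alloc b, s.price i ≤ X.v i b
  supply : ∀ i, (Finset.univ.filter fun b => i ∈ s.alloc b).card ≤ X.C i
  one_per_block : ∀ b r, ∀ i ∈ s.alloc b, ∀ j ∈ s.alloc b,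
    s.price i ∈ X.block α t r → s.price j ∈ X.block α t r → i = j

/-- Optimal solutions: feasible solutions of maximum profit. -/
def Outcome.IsOptimal {X : Instance} (α : ℚ) (t : ℕ) (s : Outcome X) : Prop :=
  s.IsFeasible α t ∧ ∀ s' : Outcome X, s'.IsFeasible α t → s'.profit ≤ s.profit

/-- The word `n, m, C_0, …, C_{n-1}, v_{0,0}, …, v_{0,m-1}, v_{1,0}, …, v_{n-1,m-1}`. -/
def Instance.encode (X : Instance) : List ℕ :=
  X.n :: X.m ::
    (List.ofFn X.C ++ List.ofFn fun k : Fin (X.n * X.m) => X.v k.divNat k.modNat)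

/-- `out` represents `s`: first come the prices, each as a numerator followed by a positive
denominator (not necessarily in lowest terms), then the rows of the 0/1 item-by-bidder incidence
matrix of the allocation. -/
def Represents (X : Instance) (out : ℕ → ℕ) (s : Outcome X) : Prop :=
  (∀ i : Fin X.n, out (2 * i + 1) ≠ 0 ∧
    s.price i = (out (2 * i) : ℚ) / (out (2 * i + 1) : ℚ)) ∧
  ∀ (i : Fin X.n) (b : Fin X.m),
    out (2 * X.n + (i * X.m + b)) = if i ∈ s.alloc b then 1 else 0

end MaxBuying

/-! Prices are nonincreasing along the items, so the items priced in one block of `t` consecutive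
grid levels form an interval, and their levels are determined by `t + 1` cut points. There are at
most `(n + 1) ^ (t + 1)` cut vectors for a block, which is polynomial because `t` is fixed. A bidder
takes at most one item per block, and a supply bound concerns a single item, which lies in a single
block. Once the cuts are fixed, the allocations in different blocks are therefore independent, and a
dynamic program over the blocks finds the optimum; its state is the first item not yet priced
(`Market.value`, `IsPlan.profit_le`, `IsPartial.step`).

Finitely many blocks suffice. Choose `κ` with `α ^ κ ≥ 2` and let `r₀` be `κ` times the bit length
of the largest value. From level `r₀` on, prices are at most `1`, so every bidder with a positive
value can afford them. If item `i` lies in a block beyond `r₀ + i`, it can be moved to the first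
level of block `r₀ + i`: its price rises but stays at most `1`, and the order of prices and the
separation of blocks survive. Hence `r₀ + n` blocks are enough (`profit_le_value`).

Inside one block with given cuts, the task is a maximum weight bipartite matching in which item `i`
has `C i` copies and the weight of an edge depends on the item only. The matchable sets of copies
form a transversal matroid, so the greedy algorithm in order of decreasing prices is optimal.
Concretely, if a further copy of `i` is rejected, some set of items up to `i` has its neighbourhood
used up. It follows that the greedy solution sells at least as many copies from every prefix of the
items as any other solution (`Matches.dominates`), and for decreasing prices this gives the larger
weight (`weight_le_of_dominates`). Matchability is tested by an auction: an item goes to a willing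
bidder of smallest label, the label rises by one, and the displaced item continues. The label sum
bounds the number of rounds, and a label above `m` reveals a violation of Hall's condition
(`Auction.violator`).

For the machine, write `α = p / q` and multiply all prices and values by `p ^ K`, where `K` is the
number of levels; they become integers of polynomial length. In the main program all loops run up to
limits stored in array `2`, and every product has such a limit as a factor. Numbers then grow by a
bounded number of bits per operation, and time and lengths are polynomial (`Stmt.exec_toProgram`).
The limits are computed beforehand from the input and the bit length of the largest value. -/

namespace RAM

/-! ### Structured programs with bounded loops -/

/-- Terms that read a cell of the array `2` at a fixed index. -/
def Term.isLimit : Term → Bool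
  | .get 2 (.const _) => true
  | _ => false

theorem Term.isLimit_iff {e : Term} : e.isLimit = true ↔ ∃ c, e = .get 2 (.const c) := by
  constructor
  · intro h
    unfold Term.isLimit at h
    split at h
    · exact ⟨_, rfl⟩
    · simp at h
  · rintro ⟨c, rfl⟩
    rfl

/-- Terms in which the first factor of every product is a cell of the array `2`. -/
def Term.tame : Term → Bool
  | .const _ => true
  | .get _ e => e.tame
  | .add e₁ e₂ => e₁.tame && e₂.tame
  | .sub e₁ e₂ => e₁.tame && e₂.tame
  -- A factor that is at most `N` adds at most `N` bits. Products of arbitrary cells would permit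
  -- repeated squaring in a loop, with numbers of exponential length.
  | .mul e₁ e₂ => e₁.isLimit && e₂.tame
  | .div e₁ e₂ => e₁.tame && e₂.tame

/-- A measure of the size of a term that controls its cost. -/
def Term.weight : Term → ℕ
  -- Constants count by value and not by length; this is harmless because the program is fixed while
  -- the input varies.
  | .const c => c + 1
  | .get _ e => e.weight + 1
  | .add e₁ e₂ => e₁.weight + e₂.weight + 1
  | .sub e₁ e₂ => e₁.weight + e₂.weight + 1
  | .mul e₁ e₂ => e₁.weight + e₂.weight + 1
  | .div e₁ e₂ => e₁.weight + e₂.weight + 1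

/-- Structured programs whose loops run `x` from `0` up to the number in cell `c` of array `2`. -/
inductive Stmt where
  | skip
  | put (a : ℕ) (e₁ e₂ : Term)
  | seq (P Q : Stmt)
  | branch (e : Term) (P Q : Stmt)
  | rep (x c : ℕ) (P : Stmt)

namespace Stmt

/-- The machine program of a statement. -/
def toProgram : Stmt → Program
  | .skip => .skip
  | .put a e₁ e₂ => .put a e₁ e₂
  | .seq P Q => .seq P.toProgram Q.toProgram
  | .branch e P Q => .cond e P.toProgram Q.toProgram
  | .rep x c P =>
    .seq (.put x (.const 0) (.const 0))
      (.loop (.sub (.get 2 (.const c)) (.get x (.const 0)))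
        (.seq P.toProgram (.put x (.const 0) (.add (.get x (.const 0)) (.const 1)))))

/-- The effect of a statement on the memory. -/
def run : Stmt → Memory → Memory
  | .skip => fun σ => σ
  | .put a e₁ e₂ => fun σ => σ.store a (e₁.value σ) (e₂.value σ)
  | .seq P Q => fun σ => Q.run (P.run σ)
  | .branch e P Q => fun σ => if e.value σ ≠ 0 then P.run σ else Q.run σ
  | .rep x c P => fun σ =>
    Nat.rec (σ.store x 0 0) (fun k τ => (P.run τ).store x 0 (k + 1)) (σ 2 c)

/-- Whether a statement contains an assignment to the array `a`. -/
def writes : Stmt → ℕ → Bool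
  | .skip, _ => false
  | .put b _ _, a => a == b
  | .seq P Q, a => P.writes a || Q.writes a
  | .branch _ P Q, a => P.writes a || Q.writes a
  | .rep x _ P, a => a == x || P.writes a

/-- All terms are tame, the array `2` is not written, and loop bodies do not write their counter. -/
def tame : Stmt → Bool
  | .skip => true
  | .put a e₁ e₂ => a != 2 && e₁.tame && e₂.tame
  | .seq P Q => P.tame && Q.tame
  | .branch e P Q => e.tame && P.tame && Q.tame
  | .rep x _ P => x != 2 && !P.writes x && P.tame

/-- The total weight of the terms evaluated by a statement, if all limits are at most `N`. -/
def load : Stmt → ℕ → ℕ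
  | .skip, _ => 1
  | .put _ e₁ e₂, _ => e₁.weight + e₂.weight + 1
  | .seq P Q, N => P.load N + Q.load N
  | .branch e P Q, N => e.weight + P.load N + Q.load N + 1
  -- The loop test has weight `c + 5` and the incremented counter has weight `5`; the rest of `20`
  -- covers unit costs. The additional factor in `N + 1` pays for the initialisation and the last,
  -- failing test.
  | .rep _ c P, N => (N + 1) * (P.load N + c + 20)

end Stmt

theorem Memory.store_apply (σ : Memory) (a i x b : ℕ) :
    σ.store a i x b = if b = a then Function.update (σ a) i x else σ b := by
  unfold Memory.store
  by_cases h : b = a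
  · subst h; simp
  · simp [h]

theorem Memory.store_of_ne (σ : Memory) {a b : ℕ} (i x : ℕ) (h : b ≠ a) :
    σ.store a i x b = σ b := by
  simp [Memory.store, h]

theorem Memory.store_lt {σ : Memory} {B a i x : ℕ} (hσ : ∀ a i, σ a i < B) (hx : x < B)
    (b j : ℕ) : σ.store a i x b j < B := by
  rw [Memory.store_apply]
  split
  · by_cases hj : j = i
    · subst hj; simpa
    · simpa [hj] using hσ a j
  · exact hσ b j

theorem Stmt.run_of_not_writes {P : Stmt} {a : ℕ} (h : P.writes a = false) (σ : Memory) :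
    P.run σ a = σ a := by
  induction P generalizing σ with
  | skip => rfl
  | put b e₁ e₂ =>
    simp only [Stmt.writes, beq_eq_false_iff_ne] at h
    exact Memory.store_of_ne _ _ _ h
  | seq P Q hP hQ =>
    simp only [Stmt.writes, Bool.or_eq_false_iff] at h
    simp only [Stmt.run, hQ h.2, hP h.1]
  | branch e P Q hP hQ =>
    simp only [Stmt.writes, Bool.or_eq_false_iff] at h
    simp only [Stmt.run]
    split
    · exact hP h.1 σ
    · exact hQ h.2 σ
  | rep x c P hP =>
    simp only [Stmt.writes, Bool.or_eq_false_iff, beq_eq_false_iff_ne] at h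
    simp only [Stmt.run]
    generalize σ 2 c = k
    induction k with
    | zero => exact Memory.store_of_ne _ _ _ h.1
    | succ k ih => simp only [Memory.store_of_ne _ _ _ h.1, hP h.2, ih]

theorem Stmt.not_writes_two {P : Stmt} (h : P.tame = true) : P.writes 2 = false := by
  induction P with
  | skip => rfl
  | put b e₁ e₂ =>
    simp only [Stmt.tame, Bool.and_eq_true, bne_iff_ne] at h
    simpa [Stmt.writes] using fun h' => h.1.1 h'.symm
  | seq P Q hP hQ =>
    simp only [Stmt.tame, Bool.and_eq_true] at h
    simp [Stmt.writes, hP h.1, hQ h.2]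
  | branch e P Q hP hQ =>
    simp only [Stmt.tame, Bool.and_eq_true] at h
    simp [Stmt.writes, hP h.1.2, hQ h.2]
  | rep x c P hP =>
    simp only [Stmt.tame, Bool.and_eq_true, bne_iff_ne] at h
    simpa [Stmt.writes, hP h.2] using fun h' => h.1.1 h'.symm

/-- Loop rule: an invariant of the iterations holds at the end. The step may use that arrays not
written by the loop are unchanged. -/
theorem Stmt.run_rep {x c : ℕ} {P : Stmt} {σ : Memory} (I : ℕ → Memory → Prop)
    (h0 : I 0 (σ.store x 0 0))
    (hs : ∀ k τ, k < σ 2 c → τ x 0 = k →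
      (∀ a, (Stmt.rep x c P).writes a = false → τ a = σ a) → I k τ →
      I (k + 1) ((P.run τ).store x 0 (k + 1))) :
    I (σ 2 c) ((Stmt.rep x c P).run σ) := by
  simp only [Stmt.run]
  suffices h : ∀ k ≤ σ 2 c, ∃ τ : Memory,
      τ = Nat.rec (σ.store x 0 0) (fun k τ => (P.run τ).store x 0 (k + 1)) k ∧
      I k τ ∧ τ x 0 = k ∧ ∀ a, (Stmt.rep x c P).writes a = false → τ a = σ a by
    obtain ⟨τ, rfl, h1, -⟩ := h _ le_rfl
    exact h1
  intro k
  induction k with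
  | zero =>
    intro _
    refine ⟨_, rfl, h0, by simp [Memory.store], fun a ha => ?_⟩
    simp only [Stmt.writes, Bool.or_eq_false_iff, beq_eq_false_iff_ne] at ha
    exact Memory.store_of_ne _ _ _ ha.1
  | succ k ih =>
    intro hk
    obtain ⟨τ, hτ, h1, h2, h3⟩ := ih (by omega)
    refine ⟨_, rfl, ?_, by simp [Memory.store], fun a ha => ?_⟩
    · simp only
      rw [← hτ]
      exact hs k τ (by omega) h2 h3 h1
    · simp only
      rw [← hτ]
      have ha' := ha
      simp only [Stmt.writes, Bool.or_eq_false_iff, beq_eq_false_iff_ne] at ha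
      rw [Memory.store_of_ne _ _ _ ha.1, Stmt.run_of_not_writes ha.2, h3 a ha']

/-! ### Lengths of numbers and costs of tame programs -/

theorem Term.weight_pos (e : Term) : 0 < e.weight := by
  cases e <;> simp [Term.weight]

theorem Term.value_lt_of_tame {σ : Memory} {B N : ℕ} (hB : ∀ a i, σ a i < 2 ^ B)
    (hN : ∀ c, σ 2 c ≤ N) {e : Term} (he : e.tame = true) :
    e.value σ < 2 ^ (B + e.weight * (N + 1)) := by
  have mono : ∀ {x u v : ℕ}, x < 2 ^ u → u ≤ v → x < 2 ^ v := fun h1 h2 =>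
    h1.trans_le (Nat.pow_le_pow_right (by norm_num) h2)
  induction e with
  | const c =>
    refine mono Nat.lt_two_pow_self ?_
    simp only [Term.weight, Term.value]
    nlinarith
  | get a e ih => exact mono (hB _ _) (by omega)
  | add e₁ e₂ h₁ h₂ =>
    simp only [Term.tame, Bool.and_eq_true] at he
    have h : ∀ {x u : ℕ}, x < 2 ^ (B + u * (N + 1)) → u + 1 ≤ e₁.weight + e₂.weight + 1 →
        2 * x < 2 ^ (B + (e₁.weight + e₂.weight + 1) * (N + 1)) := by
      intro x u hx hu
      have h2 : 2 * x < 2 ^ (B + u * (N + 1) + 1) := by rw [pow_succ]; omega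
      exact mono h2 (by nlinarith [Nat.mul_le_mul_right (N + 1) hu])
    have a1 := h (h₁ he.1) (by omega)
    have a2 := h (h₂ he.2) (by omega)
    simp only [Term.value, Term.weight]
    omega
  | sub e₁ e₂ h₁ h₂ =>
    simp only [Term.tame, Bool.and_eq_true] at he
    exact (Nat.sub_le _ _).trans_lt (mono (h₁ he.1) (by simp only [Term.weight]; nlinarith))
  | div e₁ e₂ h₁ h₂ =>
    simp only [Term.tame, Bool.and_eq_true] at he
    exact (Nat.div_le_self _ _).trans_lt (mono (h₁ he.1) (by simp only [Term.weight]; nlinarith))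
  | mul e₁ e₂ h₁ h₂ =>
    simp only [Term.tame, Bool.and_eq_true] at he
    obtain ⟨c, rfl⟩ := Term.isLimit_iff.1 he.1
    have a1 : σ 2 c < 2 ^ N := (hN c).trans_lt Nat.lt_two_pow_self
    have a2 := Nat.mul_lt_mul'' a1 (h₂ he.2)
    rw [← pow_add] at a2
    refine mono a2 ?_
    simp only [Term.weight]
    nlinarith

theorem Term.cost_le_of_tame {σ : Memory} {B N : ℕ} (hB : ∀ a i, σ a i < 2 ^ B)
    (hN : ∀ c, σ 2 c ≤ N) {e : Term} (he : e.tame = true) :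
    e.cost σ ≤ e.weight * (2 + B + e.weight * (N + 1)) := by
  have key : ∀ {e : Term}, e.tame = true →
      Nat.size (e.value σ) ≤ B + e.weight * (N + 1) := fun h =>
    Nat.size_le.2 (Term.value_lt_of_tame hB hN h)
  have comb : ∀ {u v w s x y : ℕ}, x ≤ u * (2 + B + u * (N + 1)) → y ≤ v * (2 + B + v * (N + 1)) →
      w = u + v + 1 → s ≤ B + w * (N + 1) → x + y + (1 + s) ≤ w * (2 + B + w * (N + 1)) := by
    intro u v w s x y hx hy hw hs
    have h1 : u * (2 + B + u * (N + 1)) ≤ u * (2 + B + w * (N + 1)) := by gcongr; omega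
    have h2 : v * (2 + B + v * (N + 1)) ≤ v * (2 + B + w * (N + 1)) := by gcongr; omega
    calc _ ≤ u * (2 + B + w * (N + 1)) + v * (2 + B + w * (N + 1)) + (2 + B + w * (N + 1)) := by
            omega
      _ = (u + v + 1) * (2 + B + w * (N + 1)) := by ring
      _ = w * (2 + B + w * (N + 1)) := by rw [← hw]
  induction e with
  | const c =>
    have h := key he
    have := comb (u := c) (v := 0) (x := 0) (y := 0) (by simp) (by simp) rfl h
    simpa [Term.cost, Term.value, Term.weight] using this
  | get a e ih =>
    have h := key he
    have := comb (v := 0) (y := 0) (ih he) (by simp) (by simp [Term.weight]) h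
    simpa [Term.cost, Term.value] using this
  | add e₁ e₂ h₁ h₂ =>
    have h := key he
    simp only [Term.tame, Bool.and_eq_true] at he
    exact comb (h₁ he.1) (h₂ he.2) rfl h
  | sub e₁ e₂ h₁ h₂ =>
    have h := key he
    simp only [Term.tame, Bool.and_eq_true] at he
    exact comb (h₁ he.1) (h₂ he.2) rfl h
  | div e₁ e₂ h₁ h₂ =>
    have h := key he
    simp only [Term.tame, Bool.and_eq_true] at he
    exact comb (h₁ he.1) (h₂ he.2) rfl h
  | mul e₁ e₂ h₁ h₂ =>
    have h := key he
    simp only [Term.tame, Bool.and_eq_true] at he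
    have h1 : e₁.tame = true := by
      obtain ⟨c, rfl⟩ := Term.isLimit_iff.1 he.1
      rfl
    exact comb (h₁ h1) (h₂ he.2) rfl h

/-- This is why cost bounds have the shape `u * (2 + B + u * (N + 1))`. A phase of load `u` that
starts with numbers of `B` bits ends with numbers of at most `B + u * (N + 1)` bits, and with this
shape the loads of successive phases simply add. -/
theorem load_comb {B N u v x y : ℕ} (hx : x ≤ u * (2 + B + u * (N + 1)))
    (hy : y ≤ v * (2 + (B + u * (N + 1)) + v * (N + 1))) :
    x + y ≤ (u + v) * (2 + B + (u + v) * (N + 1)) := by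
  have h1 : u * (2 + B + u * (N + 1)) ≤ u * (2 + B + (u + v) * (N + 1)) := by gcongr; omega
  have h2 : v * (2 + (B + u * (N + 1)) + v * (N + 1)) = v * (2 + B + (u + v) * (N + 1)) := by ring
  calc _ ≤ u * (2 + B + (u + v) * (N + 1)) + v * (2 + B + (u + v) * (N + 1)) := by omega
    _ = _ := by ring

theorem load_mono {B N u v : ℕ} (h : u ≤ v) :
    u * (2 + B + u * (N + 1)) ≤ v * (2 + B + v * (N + 1)) := by
  gcongr

theorem load_self {B N u v : ℕ} (h : u ≤ v) : u ≤ v * (2 + B + v * (N + 1)) :=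
  h.trans (Nat.le_mul_of_pos_right _ (by omega))

theorem Exec.cast {P : Program} {σ σ' τ : Memory} {S T : ℕ} (h : Exec P σ σ' S) (h1 : σ' = τ)
    (h2 : S = T) : Exec P σ τ T := by
  subst h1; subst h2; exact h

/-- Tame statements run at polynomial cost and with polynomially long numbers. -/
theorem Stmt.exec_toProgram {N : ℕ} (P : Stmt) (hP : P.tame = true) (σ : Memory) (B : ℕ)
    (hB : ∀ a i, σ a i < 2 ^ B) (hN : ∀ c, σ 2 c ≤ N) :
    (∃ T ≤ P.load N * (2 + B + P.load N * (N + 1)), Exec P.toProgram σ (P.run σ) T) ∧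
      ∀ a i, P.run σ a i < 2 ^ (B + P.load N * (N + 1)) := by
  have mono : ∀ {x u v : ℕ}, x < 2 ^ u → u ≤ v → x < 2 ^ v := fun h1 h2 =>
    h1.trans_le (Nat.pow_le_pow_right (by norm_num) h2)
  induction P generalizing σ B with
  | skip =>
    refine ⟨⟨1, by simp only [Stmt.load]; omega, Exec.skip σ⟩, fun a i => mono (hB a i) (by omega)⟩
  | put b e₁ e₂ =>
    simp only [Stmt.tame, Bool.and_eq_true] at hP
    have h1 := Term.cost_le_of_tame hB hN hP.1.2
    have h2 := Term.cost_le_of_tame hB hN hP.2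
    have h3 := Term.value_lt_of_tame hB hN hP.2
    refine ⟨⟨_, ?_, Exec.put σ b e₁ e₂⟩, ?_⟩
    · simp only [Stmt.load]
      have a1 := load_comb h1 (h2.trans (by gcongr; omega))
      have a2 := load_comb (y := 1) (v := 1) a1 (by omega)
      exact a2
    · intro a i
      refine Memory.store_lt (fun a i => mono (hB a i) (by omega)) (mono h3 ?_) a i
      simp only [Stmt.load]
      gcongr
      omega
  | seq P Q ihP ihQ =>
    simp only [Stmt.tame, Bool.and_eq_true] at hP
    obtain ⟨⟨T, hT, hE⟩, hb⟩ := ihP hP.1 σ B hB hN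
    have hN' : ∀ c, P.run σ 2 c ≤ N := by
      intro c; rw [Stmt.run_of_not_writes (Stmt.not_writes_two hP.1)]; exact hN c
    obtain ⟨⟨T', hT', hE'⟩, hb'⟩ := ihQ hP.2 _ _ hb hN'
    refine ⟨⟨T + T', load_comb hT hT', Exec.seq hE hE'⟩, fun a i => mono (hb' a i) ?_⟩
    simp only [Stmt.load]
    apply le_of_eq; ring
  | branch e P Q ihP ihQ =>
    simp only [Stmt.tame, Bool.and_eq_true] at hP
    have h1 := Term.cost_le_of_tame hB hN hP.1.1
    simp only [Stmt.run, Stmt.load]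
    split
    · rename_i he
      obtain ⟨⟨T, hT, hE⟩, hb⟩ := ihP hP.1.2 σ B hB hN
      refine ⟨⟨_, ?_, Exec.cond_true he hE⟩, fun a i => mono (hb a i) ?_⟩
      · have a1 := load_comb h1 (hT.trans (by gcongr; omega))
        have a2 := load_comb (y := 1) (v := Q.load N + 1) a1 (load_self (by omega))
        exact a2.trans (le_of_eq (by ring))
      · gcongr; omega
    · rename_i he
      obtain ⟨⟨T, hT, hE⟩, hb⟩ := ihQ hP.2 σ B hB hN
      refine ⟨⟨_, ?_, Exec.cond_false (by simpa using he) hE⟩, fun a i => mono (hb a i) ?_⟩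
      · have a1 := load_comb h1 (hT.trans (by gcongr; omega))
        have a2 := load_comb (y := 1) (v := P.load N + 1) a1 (load_self (by omega))
        exact a2.trans (le_of_eq (by ring))
      · gcongr; omega
  | rep x c P ih =>
    simp only [Stmt.tame, Bool.and_eq_true, bne_iff_ne, Bool.not_eq_true'] at hP
    obtain ⟨⟨hx2, hxP⟩, hP'⟩ := hP
    set W := P.load N + c + 20 with hW
    have hw2 : ∀ k (τ : Memory), (P.run τ).store x 0 k 2 = τ 2 := by
      intro k τ
      rw [Memory.store_of_ne _ _ _ (Ne.symm hx2), Stmt.run_of_not_writes (Stmt.not_writes_two hP')]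
    -- the loop started after `k` iterations
    have loop : ∀ j k (τ : Memory) (B : ℕ), (∀ a i, τ a i < 2 ^ B) → τ 2 = σ 2 → τ x 0 = k →
        k + j = σ 2 c →
        (∃ T ≤ (j * W + c + 7) * (2 + B + (j * W + c + 7) * (N + 1)),
          Exec (.loop (.sub (.get 2 (.const c)) (.get x (.const 0)))
            (.seq P.toProgram (.put x (.const 0) (.add (.get x (.const 0)) (.const 1))))) τ
            (Nat.rec τ (fun i τ => (P.run τ).store x 0 (k + i + 1)) j : Memory) T) ∧
        ∀ a i, (Nat.rec τ (fun i τ => (P.run τ).store x 0 (k + i + 1)) j : Memory) a i <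
          2 ^ (B + (j * W) * (N + 1)) := by
      intro j
      induction j with
      | zero =>
        intro k τ B hB h2 hx hk
        have hN' : ∀ c, τ 2 c ≤ N := by rw [h2]; exact hN
        have ht := Term.cost_le_of_tame hB hN'
          (e := .sub (.get 2 (.const c)) (.get x (.const 0))) (by rfl)
        refine ⟨⟨_, ?_, Exec.loop_stop ?_⟩, ?_⟩
        · simp only [Term.weight] at ht
          have a2 := load_comb (y := 1) (v := 1) ht (by omega)
          exact a2.trans (load_mono (by omega))
        · simp [Term.value, h2, hx]; omega
        · intro a i; simpa using hB a i
      | succ j ihj =>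
        intro k τ B hB h2 hx hk
        have hN' : ∀ c, τ 2 c ≤ N := by rw [h2]; exact hN
        have ht := Term.cost_le_of_tame hB hN'
          (e := .sub (.get 2 (.const c)) (.get x (.const 0))) (by rfl)
        obtain ⟨⟨T, hT, hE⟩, hb⟩ := ih hP' τ B hB hN'
        have hN'' : ∀ c, P.run τ 2 c ≤ N := by
          intro c; rw [Stmt.run_of_not_writes (Stmt.not_writes_two hP')]; exact hN' c
        have hi := Term.cost_le_of_tame hb hN''
          (e := .add (.get x (.const 0)) (.const 1)) (by rfl)
        set τ' := (P.run τ).store x 0 (k + 1) with hτ'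
        have hB' : ∀ a i, τ' a i < 2 ^ (B + W * (N + 1)) := by
          intro a i
          refine Memory.store_lt (fun a i => mono (hb a i) (by gcongr; omega)) ?_ a i
          -- The counter never exceeds its limit, which is itself a cell of the memory, so
          -- incrementing it creates no longer number.
          have : k + 1 ≤ τ 2 c := by rw [h2]; omega
          exact mono (this.trans_lt (hB 2 c)) (by omega)
        obtain ⟨⟨T', hT', hE'⟩, hb'⟩ := ihj (k + 1) τ' (B + W * (N + 1)) hB'
          (by rw [hτ', hw2, h2]) (by simp [hτ', Memory.store]) (by omega)
        have hrec : ∀ j, (Nat.rec τ (fun i τ => (P.run τ).store x 0 (k + i + 1)) (j + 1) : Memory) =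
            Nat.rec τ' (fun i τ => (P.run τ).store x 0 (k + 1 + i + 1)) j := by
          intro j
          induction j with
          | zero => rfl
          | succ j ih =>
            simp only at ih ⊢
            rw [ih]
            congr 1; omega
        rw [hrec j]
        constructor
        · have hxr : P.run τ x 0 = k := by rw [Stmt.run_of_not_writes hxP, hx]
          have hE1 := Exec.put (P.run τ) x (.const 0) (.add (.get x (.const 0)) (.const 1))
          have hE2 := (Exec.seq hE hE1).cast (τ := τ') (by simp [hτ', Term.value, hxr]) rfl
          refine ⟨_, ?_, Exec.loop_step ?_ hE2 hE'⟩
          · simp only [Term.weight] at ht hi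
            have hc : Term.cost (P.run τ) (.const 0) = 1 := by simp [Term.cost]
            rw [hc]
            have b1 := load_comb (B := B) (u := 5 + c) (ht.trans (load_mono (by omega)))
              (hT.trans (by gcongr; omega))
            have b2 := load_comb b1 (hi.trans (by
              have : B + P.load N * (N + 1) ≤ B + (5 + c + P.load N) * (N + 1) := by
                gcongr; omega
              gcongr))
            -- The three units are the index term of the increment, its assignment, and the loop
            -- step.
            have b3 := load_comb (y := 3) (v := 3) b2 (by nlinarith)
            have b4 := load_comb (B := B) (u := W) (b3.trans (load_mono (by omega))) hT'
            have e1 : W + (j * W + c + 7) = (j + 1) * W + c + 7 := by ring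
            rw [e1] at b4
            refine le_trans (le_of_eq ?_) b4
            ring
          · simp [Term.value, h2, hx]; omega
        · intro a i
          refine mono (hb' a i) (le_of_eq ?_)
          ring
    have hs2 : (σ.store x 0 0) 2 = σ 2 := Memory.store_of_ne _ _ _ (Ne.symm hx2)
    obtain ⟨⟨T, hT, hE⟩, hb⟩ := loop (σ 2 c) 0 (σ.store x 0 0) B
      (Memory.store_lt hB (by positivity)) hs2 (by simp [Memory.store]) (by omega)
    have hk := hN c
    simp only [Nat.zero_add] at hE hb
    have hload : σ 2 c * W + c + 7 + 3 ≤ (N + 1) * W := by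
      have : σ 2 c * W ≤ N * W := by gcongr
      rw [Nat.add_mul]; omega
    have hload' : σ 2 c * W ≤ (N + 1) * W := by gcongr; omega
    refine ⟨⟨_, ?_, Exec.seq (Exec.put σ x (.const 0) (.const 0)) hE⟩, ?_⟩
    · have b := load_comb (x := 3) (u := 3) (B := B) (N := N) (by nlinarith)
        (hT.trans (by gcongr; omega))
      simp only [Term.cost, Nat.size_zero, Stmt.load]
      refine le_trans (le_trans (le_of_eq ?_) b) ?_
      · rfl
      · rw [← hW]
        have : 3 + (σ 2 c * W + c + 7) ≤ (N + 1) * W := by omega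
        gcongr
    · intro a i
      refine mono (hb a i) ?_
      simp only [Stmt.load]
      rw [← hW]
      gcongr

theorem Stmt.load_polynomial (P : Stmt) : ∃ q : Polynomial ℕ, ∀ N, P.load N = q.eval N := by
  induction P with
  | skip => exact ⟨1, by simp [Stmt.load]⟩
  | put b e₁ e₂ => exact ⟨Polynomial.C (e₁.weight + e₂.weight + 1), by simp [Stmt.load]⟩
  | seq P Q hP hQ =>
    obtain ⟨p, hp⟩ := hP
    obtain ⟨q, hq⟩ := hQ
    exact ⟨p + q, by simp [Stmt.load, hp, hq]⟩
  | branch e P Q hP hQ =>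
    obtain ⟨p, hp⟩ := hP
    obtain ⟨q, hq⟩ := hQ
    exact ⟨Polynomial.C e.weight + p + q + 1, by simp [Stmt.load, hp, hq]⟩
  | rep x c P hP =>
    obtain ⟨p, hp⟩ := hP
    exact ⟨(Polynomial.X + 1) * (p + Polynomial.C (c + 20)), by
      intro N; simp [Stmt.load, hp]; ring⟩

end RAM

/-! ### Assignments of copies to bidders and Hall's condition -/

namespace MaxBuying

open Finset

/-- An assignment `f` gives item `i` to bidder `b` if `f b = i + 1`, and nothing to `b` if
`f b = 0`. This is the number of the first `m` bidders who get item `i`. -/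
def count (m : ℕ) (f : ℕ → ℕ) (i : ℕ) : ℕ := #{b ∈ range m | f b = i + 1}

theorem count_eq_sum (m : ℕ) (f : ℕ → ℕ) (i : ℕ) :
    count m f i = ∑ b ∈ range m, if f b = i + 1 then 1 else 0 := by
  simp [count]

theorem count_le (m : ℕ) (f : ℕ → ℕ) (i : ℕ) : count m f i ≤ m := by
  simpa [count] using card_filter_le (range m) fun b => f b = i + 1

theorem count_update {m : ℕ} {f : ℕ → ℕ} {b : ℕ} (hb : b < m) (x i : ℕ) :
    count m (Function.update f b x) i + (if f b = i + 1 then 1 else 0) =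
      count m f i + (if x = i + 1 then 1 else 0) := by
  have hb' : b ∈ range m := mem_range.2 hb
  rw [count_eq_sum, count_eq_sum, ← add_sum_erase _ _ hb', ← add_sum_erase (range m) _ hb']
  have : ∑ c ∈ (range m).erase b, (if Function.update f b x c = i + 1 then 1 else 0) =
      ∑ c ∈ (range m).erase b, (if f c = i + 1 then 1 else 0) := by
    refine sum_congr rfl fun c hc => ?_
    rw [Function.update_of_ne (ne_of_mem_erase hc)]
  rw [this]
  simp
  ring

/-- The number of bidders holding an item of a set is the sum of the counts over the set. -/
theorem card_holders (m : ℕ) (f : ℕ → ℕ) (S : Finset ℕ) :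
    #{b ∈ range m | f b ≠ 0 ∧ f b - 1 ∈ S} = ∑ i ∈ S, count m f i := by
  rw [card_eq_sum_card_fiberwise (f := fun b => f b - 1) (t := S)]
  · refine sum_congr rfl fun i hi => ?_
    rw [count, filter_filter]
    congr 1
    refine filter_congr fun b _ => ?_
    constructor
    · rintro ⟨⟨h1, h2⟩, h3⟩
      omega
    · intro h
      exact ⟨⟨by omega, by simpa [h] using hi⟩, by omega⟩
  · intro b hb
    exact (mem_filter.1 hb).2.2

open Classical in
/-- The bidders adjacent to an item of `R`. -/
noncomputable def nbhd (m : ℕ) (adj : ℕ → ℕ → Prop) (R : Finset ℕ) : Finset ℕ :=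
  {b ∈ range m | ∃ i ∈ R, adj i b}

theorem mem_nbhd {m : ℕ} {adj : ℕ → ℕ → Prop} {R : Finset ℕ} {b : ℕ} :
    b ∈ nbhd m adj R ↔ b < m ∧ ∃ i ∈ R, adj i b := by
  simp [nbhd]

/-- The assignment uses adjacent pairs only, and gives away `κ i` copies of item `i`. -/
structure Matches (m : ℕ) (adj : ℕ → ℕ → Prop) (κ f : ℕ → ℕ) : Prop where
  valid : ∀ b < m, f b ≠ 0 → adj (f b - 1) b
  counts : ∀ i, count m f i = κ i

/-- The easy half of Hall's theorem: the holders of items of `R` are distinct neighbours of `R`. -/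
theorem Matches.sum_le_card_nbhd {m : ℕ} {adj : ℕ → ℕ → Prop} {κ f : ℕ → ℕ}
    (h : Matches m adj κ f) (R : Finset ℕ) : ∑ i ∈ R, κ i ≤ #(nbhd m adj R) := by
  rw [← sum_congr rfl fun i _ => h.counts i, ← card_holders]
  refine card_le_card fun b hb => ?_
  simp only [mem_filter, mem_range] at hb
  exact mem_nbhd.2 ⟨hb.1, _, hb.2.2, h.valid b hb.1 hb.2.1⟩

/-! ### The auction -/

/-- The state of an auction with labels `y`, in which `L i` copies of item `i` have been brought
to the market and item `tok - 1` (if `tok ≠ 0`) looks for a bidder. -/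
structure Auction (m : ℕ) (adj : ℕ → ℕ → Prop) (L f y : ℕ → ℕ) (tok : ℕ) : Prop where
  valid : ∀ b < m, f b ≠ 0 → adj (f b - 1) b
  matched : ∀ b < m, y b ≠ 0 → f b ≠ 0
  label_le : ∀ b < m, y b ≤ m + 1
  -- An item moves only to a neighbour of minimal label, whose label then rises by one. The other
  -- labels never decrease, so the slack of one persists.
  near_min : ∀ b < m, f b ≠ 0 → ∀ b' < m, adj (f b - 1) b' → y b ≤ y b' + 1
  counts : ∀ i, count m f i + (if tok = i + 1 then 1 else 0) = L i

theorem Auction.start {m : ℕ} {adj : ℕ → ℕ → Prop} {f y : ℕ → ℕ} (hf : ∀ b < m, f b = 0)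
    (hy : ∀ b < m, y b = 0) : Auction m adj (fun _ => 0) f y 0 where
  valid b hb h := absurd (hf b hb) h
  matched b hb h := absurd (hy b hb) h
  label_le b hb := by simp [hy b hb]
  near_min b hb h := absurd (hf b hb) h
  counts i := by
    simp only [MaxBuying.count, card_eq_zero, filter_eq_empty_iff, mem_range,
      Nat.add_eq_zero_iff]
    simp +contextual [hf]

theorem Auction.launch {m : ℕ} {adj : ℕ → ℕ → Prop} {L f y : ℕ → ℕ}
    (h : Auction m adj L f y 0) (i : ℕ) :
    Auction m adj (Function.update L i (L i + 1)) f y (i + 1) where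
  valid := h.valid
  matched := h.matched
  label_le := h.label_le
  near_min := h.near_min
  counts j := by
    have := h.counts j
    by_cases hj : j = i
    · subst hj; simp at this ⊢; omega
    · have : i ≠ j := Ne.symm hj
      simp_all

/-- The displaced item `f b` becomes the new token, which preserves `counts`; if `b` was free, the
token becomes `0` and the search is over. -/
theorem Auction.push {m : ℕ} {adj : ℕ → ℕ → Prop} {L f y : ℕ → ℕ} {tok b : ℕ}
    (h : Auction m adj L f y tok) (ht : tok ≠ 0) (hb : b < m) (hadj : adj (tok - 1) b)
    (hy : y b ≤ m) (hmin : ∀ b' < m, adj (tok - 1) b' → y b ≤ y b') :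
    Auction m adj L (Function.update f b tok) (Function.update y b (y b + 1)) (f b) where
  valid c hc := by
    by_cases hcb : c = b
    · subst hcb; simp [hadj]
    · simpa [hcb] using h.valid c hc
  matched c hc := by
    by_cases hcb : c = b
    · subst hcb; simp [ht]
    · simpa [hcb] using h.matched c hc
  label_le c hc := by
    by_cases hcb : c = b
    · subst hcb; simpa
    · simpa [hcb] using h.label_le c hc
  near_min c hc h0 c' hc' ha := by
    have mono : y c' ≤ Function.update y b (y b + 1) c' := by
      by_cases hcb : c' = b
      · subst hcb; simp
      · simp [hcb]
    by_cases hcb : c = b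
    · subst hcb
      simp only [Function.update_self] at ha ⊢
      have := hmin c' hc' ha
      omega
    · simp only [Function.update_of_ne hcb] at h0 ha ⊢
      have := h.near_min c hc h0 c' hc' ha
      omega
  counts i := by
    rw [count_update hb]
    exact h.counts i

/-- The potential function of the auction: by `Auction.sum_le` there are at most `m * (m + 1)` moves
in total. -/
theorem Auction.sum_push {m : ℕ} {y : ℕ → ℕ} {b : ℕ} (hb : b < m) :
    ∑ c ∈ range m, Function.update y b (y b + 1) c = (∑ c ∈ range m, y c) + 1 := by
  rw [sum_update_of_mem (mem_range.2 hb), ← add_sum_erase _ _ (mem_range.2 hb),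
    sdiff_singleton_eq_erase]
  ring

theorem Auction.sum_le {m : ℕ} {adj : ℕ → ℕ → Prop} {L f y : ℕ → ℕ} {tok : ℕ}
    (h : Auction m adj L f y tok) : ∑ b ∈ range m, y b ≤ m * (m + 1) := by
  simpa using sum_le_card_nsmul (range m) y (m + 1) fun b hb => h.label_le b (mem_range.1 hb)

/-- If all bidders adjacent to the current item have the highest label, Hall's condition fails. -/
theorem Auction.violator {m : ℕ} {adj : ℕ → ℕ → Prop} {L f y : ℕ → ℕ} {tok : ℕ}
    (h : Auction m adj L f y tok) (ht : tok ≠ 0)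
    (htop : ∀ b < m, adj (tok - 1) b → m < y b) :
    ∃ R : Finset ℕ, (∀ i ∈ R, L i ≠ 0) ∧ #(nbhd m adj R) < ∑ i ∈ R, L i := by
  -- The labels of `m` bidders miss one of the `m + 1` values up to `m`. Let `V` be the bidders
  -- above the gap `g`. By `near_min` a neighbour of an item held in `V` has label at least `g`,
  -- hence above `g`; by `htop` the neighbours of the token item are above `g` as well. Thus all
  -- neighbours of these items lie in `V`. All of `V` is occupied by them, and the token is one copy
  -- too many.
  obtain ⟨g, hg, hgap⟩ : ∃ g ∈ range (m + 1), g ∉ (range m).image y := by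
    by_contra! hcon
    have h1 := card_le_card (s := range (m + 1)) hcon
    have h2 := card_image_le (s := range m) (f := y)
    simp only [card_range] at h1 h2
    omega
  have hgap' : ∀ b < m, y b ≠ g := by
    intro b hb hbg
    exact hgap (mem_image.2 ⟨b, mem_range.2 hb, hbg⟩)
  have hgm : g ≤ m := by simpa [Nat.lt_succ_iff] using hg
  set V := {b ∈ range m | g < y b} with hV
  set R := insert (tok - 1) (V.image fun b => f b - 1) with hR
  have hfV : ∀ b ∈ V, b < m ∧ f b ≠ 0 ∧ g < y b := by
    intro b hb
    simp only [hV, mem_filter, mem_range] at hb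
    exact ⟨hb.1, h.matched b hb.1 (by omega), hb.2⟩
  have hL : ∀ i, count m f i ≤ L i := fun i => by have := h.counts i; omega
  have htokL : count m f (tok - 1) + 1 = L (tok - 1) := by
    have := h.counts (tok - 1)
    rwa [if_pos (by omega)] at this
  refine ⟨R, ?_, ?_⟩
  · intro i hi
    rw [hR, mem_insert, mem_image] at hi
    rcases hi with rfl | ⟨b, hb, rfl⟩
    · omega
    · obtain ⟨h1, h2, -⟩ := hfV b hb
      have : 0 < count m f (f b - 1) :=
        card_pos.2 ⟨b, mem_filter.2 ⟨mem_range.2 h1, by omega⟩⟩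
      have := hL (f b - 1)
      omega
  · calc #(nbhd m adj R) ≤ #V := by
          refine card_le_card fun b hb => ?_
          obtain ⟨hbm, i, hi, hib⟩ := mem_nbhd.1 hb
          rw [hR, mem_insert, mem_image] at hi
          refine mem_filter.2 ⟨mem_range.2 hbm, ?_⟩
          rcases hi with rfl | ⟨b', hb', rfl⟩
          · have := htop b hbm hib
            omega
          · obtain ⟨h1, h2, h3⟩ := hfV b' hb'
            have h4 := h.near_min b' h1 h2 b hbm hib
            have h5 := hgap' b hbm
            omega
      _ ≤ #{b ∈ range m | f b ≠ 0 ∧ f b - 1 ∈ R} := by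
          refine card_le_card fun b hb => ?_
          obtain ⟨h1, h2, -⟩ := hfV b hb
          exact mem_filter.2 ⟨mem_range.2 h1, h2, mem_insert_of_mem (mem_image_of_mem _ hb)⟩
      _ = ∑ i ∈ R, count m f i := card_holders _ _ _
      _ < ∑ i ∈ R, L i := by
          refine sum_lt_sum (fun i _ => hL i) ⟨tok - 1, mem_insert_self _ _, by omega⟩

theorem Auction.matches {m : ℕ} {adj : ℕ → ℕ → Prop} {L f y : ℕ → ℕ}
    (h : Auction m adj L f y 0) : Matches m adj L f :=
  ⟨h.valid, fun i => by simpa using h.counts i⟩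

/-! ### The greedy algorithm -/

/-- A set of items, none of them after `i`, whose neighbourhood is used up by `κ`. -/
def Tight (m : ℕ) (adj : ℕ → ℕ → Prop) (κ : ℕ → ℕ) (i : ℕ) : Prop :=
  ∃ R : Finset ℕ, i ∈ R ∧ (∀ j ∈ R, j ≤ i) ∧ #(nbhd m adj R) ≤ ∑ j ∈ R, κ j

theorem Tight.mono {m : ℕ} {adj : ℕ → ℕ → Prop} {κ κ' : ℕ → ℕ} {i : ℕ} (h : Tight m adj κ i)
    (hκ : ∀ j, κ j ≤ κ' j) : Tight m adj κ' i := by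
  obtain ⟨R, h1, h2, h3⟩ := h
  exact ⟨R, h1, h2, h3.trans (sum_le_sum fun j _ => hκ j)⟩

/-- The violator contains `i`, since `κ` itself can be matched, and without the extra copy it still
uses up its neighbourhood. Its members have positive supply whereas items after `i` have none yet,
so it stays among the items up to `i`. -/
theorem Matches.tight {m : ℕ} {adj : ℕ → ℕ → Prop} {κ f : ℕ → ℕ} {i : ℕ} (h : Matches m adj κ f)
    (hκ : ∀ j, i < j → κ j = 0) {R : Finset ℕ}
    (hR : ∀ j ∈ R, Function.update κ i (κ i + 1) j ≠ 0)
    (hlt : #(nbhd m adj R) < ∑ j ∈ R, Function.update κ i (κ i + 1) j) : Tight m adj κ i := by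
  have h1 := h.sum_le_card_nbhd R
  have hi : i ∈ R := by
    by_contra hi
    rw [sum_congr rfl fun j hj => Function.update_of_ne (ne_of_mem_of_not_mem hj hi) _ _] at hlt
    omega
  refine ⟨R, hi, fun j hj => ?_, ?_⟩
  · by_contra! hij
    exact hR j hj (by rw [Function.update_of_ne (by omega)]; exact hκ j hij)
  · rw [sum_update_of_mem hi, sdiff_singleton_eq_erase] at hlt
    rw [← add_sum_erase _ _ hi]
    omega

/-- Let `R` be the union of the tight sets of the active items below `j`. In a tight set every
neighbour is served by an item of the same set, so `f` serves all neighbours of `R` from `R`, and no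
competitor serves more bidders from `R`. Active items below `j` outside `R` are sold `min m (C i)`
times, which no competitor exceeds. -/
theorem Matches.dominates {m : ℕ} {adj : ℕ → ℕ → Prop} {κ f C : ℕ → ℕ} {lo hi : ℕ}
    (h : Matches m adj κ f)
    (hκ : ∀ i, lo ≤ i → i < hi → κ i = min m (C i) ∨ Tight m adj κ i)
    {f' : ℕ → ℕ} (hadj : ∀ b < m, f' b ≠ 0 → adj (f' b - 1) b)
    (hact : ∀ b < m, f' b ≠ 0 → lo ≤ f' b - 1 ∧ f' b - 1 < hi)
    (hC : ∀ i, count m f' i ≤ C i) (j : ℕ) :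
    #{b ∈ range m | f' b ≠ 0 ∧ f' b ≤ j} ≤ #{b ∈ range m | f b ≠ 0 ∧ f b ≤ j} := by
  classical
  choose! Q hQ using fun i (hi : Tight m adj κ i) => hi
  set S := {i ∈ range j | Tight m adj κ i ∧ lo ≤ i ∧ i < hi} with hS
  set R := S.biUnion Q with hR
  set A := {i ∈ range j | lo ≤ i ∧ i < hi ∧ i ∉ R} with hA
  have hRj : ∀ i ∈ R, i < j := by
    intro i hi
    obtain ⟨k, hk, hik⟩ := mem_biUnion.1 hi
    simp only [hS, mem_filter, mem_range] at hk
    exact ((hQ k hk.2.1).2.1 i hik).trans_lt hk.1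
  have hN : ∀ b ∈ nbhd m adj R, f b ≠ 0 ∧ f b - 1 ∈ R := by
    intro b hb
    obtain ⟨hbm, i, hi, hib⟩ := mem_nbhd.1 hb
    obtain ⟨k, hk, hik⟩ := mem_biUnion.1 hi
    have hk' := hk
    simp only [hS, mem_filter, mem_range] at hk
    obtain ⟨h1, h2, h3⟩ := hQ k hk.2.1
    rw [← sum_congr rfl fun i _ => h.counts i, ← card_holders] at h3
    have hsub : {b ∈ range m | f b ≠ 0 ∧ f b - 1 ∈ Q k} ⊆ nbhd m adj (Q k) := by
      intro c hc
      simp only [mem_filter, mem_range] at hc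
      exact mem_nbhd.2 ⟨hc.1, _, hc.2.2, h.valid c hc.1 hc.2.1⟩
    have heq := eq_of_subset_of_card_le hsub h3
    have : b ∈ nbhd m adj (Q k) := mem_nbhd.2 ⟨hbm, i, hik, hib⟩
    rw [← heq] at this
    exact ⟨(mem_filter.1 this).2.1, mem_biUnion.2 ⟨k, hk', (mem_filter.1 this).2.2⟩⟩
  have hdisj : Disjoint R A := by
    rw [disjoint_right]
    intro i hi
    exact (mem_filter.1 hi).2.2.2
  calc #{b ∈ range m | f' b ≠ 0 ∧ f' b ≤ j}
      ≤ #(nbhd m adj R ∪ {b ∈ range m | f' b ≠ 0 ∧ f' b - 1 ∈ A}) := by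
        refine card_le_card fun b hb => ?_
        simp only [mem_filter, mem_range] at hb
        rw [mem_union]
        by_cases hbR : f' b - 1 ∈ R
        · exact Or.inl (mem_nbhd.2 ⟨hb.1, _, hbR, hadj b hb.1 hb.2.1⟩)
        · refine Or.inr (mem_filter.2 ⟨mem_range.2 hb.1, hb.2.1, ?_⟩)
          obtain ⟨h1, h2⟩ := hact b hb.1 hb.2.1
          exact mem_filter.2 ⟨mem_range.2 (by omega), h1, h2, hbR⟩
    _ ≤ #(nbhd m adj R) + ∑ i ∈ A, count m f' i := by
        rw [← card_holders]; exact card_union_le _ _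
    _ ≤ #{b ∈ range m | f b ≠ 0 ∧ f b - 1 ∈ R} + ∑ i ∈ A, count m f i := by
        refine add_le_add (card_le_card fun b hb => ?_) (sum_le_sum fun i hi => ?_)
        · exact mem_filter.2 ⟨mem_range.2 (mem_nbhd.1 hb).1, hN b hb⟩
        · simp only [hA, mem_filter, mem_range] at hi
          rw [h.counts i]
          rcases hκ i hi.2.1 hi.2.2.1 with h1 | h1
          · rw [h1]
            exact le_min (count_le _ _ _) (hC i)
          · exact absurd (mem_biUnion.2 ⟨i, mem_filter.2 ⟨mem_range.2 hi.1, h1, hi.2.1, hi.2.2.1⟩,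
              (hQ i h1).1⟩) hi.2.2.2
    _ = #{b ∈ range m | f b ≠ 0 ∧ f b - 1 ∈ R ∪ A} := by
        rw [card_holders, card_holders, sum_union hdisj]
    _ ≤ #{b ∈ range m | f b ≠ 0 ∧ f b ≤ j} := by
        refine card_le_card fun b hb => ?_
        simp only [mem_filter, mem_range, mem_union] at hb ⊢
        refine ⟨hb.1, hb.2.1, ?_⟩
        rcases hb.2.2 with h1 | h1
        · have := hRj _ h1
          omega
        · have := mem_range.1 (mem_filter.1 h1).1
          omega

/-- The value of an assignment, where `pr i` is the price of item `i`. -/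
def weight (m : ℕ) (pr f : ℕ → ℕ) : ℕ := ∑ b ∈ range m, if f b = 0 then 0 else pr (f b - 1)

/-- Layer-cake argument: the weight is the sum over thresholds `θ` of the number of bidders who pay
more than `θ`. As prices decrease on the interval, the items above a threshold form a prefix of it,
and `hdom` compares the two assignments layer by layer. -/
theorem weight_le_of_dominates {m lo hi : ℕ} {pr f f' : ℕ → ℕ}
    (hpr : ∀ i j, lo ≤ i → i ≤ j → j < hi → pr j ≤ pr i)
    (hf : ∀ b < m, f b ≠ 0 → lo ≤ f b - 1 ∧ f b - 1 < hi)
    (hf' : ∀ b < m, f' b ≠ 0 → lo ≤ f' b - 1 ∧ f' b - 1 < hi)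
    (hdom : ∀ j, #{b ∈ range m | f' b ≠ 0 ∧ f' b ≤ j} ≤ #{b ∈ range m | f b ≠ 0 ∧ f b ≤ j}) :
    weight m pr f' ≤ weight m pr f := by
  obtain ⟨Z, hZ⟩ : ∃ Z, ∀ i < hi, pr i ≤ Z :=
    ⟨∑ i ∈ range hi, pr i, fun i hi' => single_le_sum (f := pr) (fun _ _ => Nat.zero_le _)
      (mem_range.2 hi')⟩
  have layer : ∀ g : ℕ → ℕ, (∀ b < m, g b ≠ 0 → lo ≤ g b - 1 ∧ g b - 1 < hi) →
      weight m pr g = ∑ θ ∈ range Z, #{b ∈ range m | g b ≠ 0 ∧ θ < pr (g b - 1)} := by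
    intro g hg
    simp only [weight, card_filter]
    rw [sum_comm]
    refine sum_congr rfl fun b hb => ?_
    split_ifs with h0
    · simp [h0]
    · rw [← card_filter]
      have : {θ ∈ range Z | g b ≠ 0 ∧ θ < pr (g b - 1)} = range (pr (g b - 1)) := by
        ext θ
        have := hZ _ (hg b (mem_range.1 hb) h0).2
        simp only [mem_filter, mem_range]
        constructor
        · tauto
        · intro h
          exact ⟨by omega, h0, h⟩
      rw [this, card_range]
  rw [layer f hf, layer f' hf']
  refine sum_le_sum fun θ _ => ?_
  obtain ⟨j, hj⟩ : ∃ j, ∀ i, lo ≤ i → i < hi → (θ < pr i ↔ i + 1 ≤ j) := by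
    classical
    have hex : ∃ j, lo ≤ j ∧ ¬ (j < hi ∧ θ < pr j) := ⟨max lo hi, by omega, by omega⟩
    obtain ⟨j, ⟨hj1, hj2⟩, hj3⟩ :
        ∃ j, (lo ≤ j ∧ ¬ (j < hi ∧ θ < pr j)) ∧ ∀ i < j, ¬ (lo ≤ i ∧ ¬ (i < hi ∧ θ < pr i)) :=
      ⟨Nat.find hex, Nat.find_spec hex, fun i hi => Nat.find_min hex hi⟩
    refine ⟨j, fun i h1 h2 => ⟨fun h => ?_, fun h => ?_⟩⟩
    · by_contra! hlt
      have h4 := hpr j i hj1 (by omega) h2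
      exact hj2 ⟨by omega, by omega⟩
    · have := hj3 i (by omega)
      tauto
  have conv : ∀ g : ℕ → ℕ, (∀ b < m, g b ≠ 0 → lo ≤ g b - 1 ∧ g b - 1 < hi) →
      #{b ∈ range m | g b ≠ 0 ∧ θ < pr (g b - 1)} = #{b ∈ range m | g b ≠ 0 ∧ g b ≤ j} := by
    intro g hg
    congr 1
    refine filter_congr fun b hb => ?_
    constructor
    · rintro ⟨h1, h2⟩
      obtain ⟨h3, h4⟩ := hg b (mem_range.1 hb) h1
      have := (hj _ h3 h4).1 h2
      exact ⟨h1, by omega⟩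
    · rintro ⟨h1, h2⟩
      obtain ⟨h3, h4⟩ := hg b (mem_range.1 hb) h1
      exact ⟨h1, (hj _ h3 h4).2 (by omega)⟩
  rw [conv f hf, conv f' hf']
  exact hdom j

end MaxBuying

/-! ### Cut vectors, integer markets and the dynamic program -/

namespace MaxBuying

open Finset

/-- The running maxima of the digits of `c` in base `n + 1`. -/
def code (n c : ℕ) : ℕ → ℕ
  | 0 => c % (n + 1)
  -- The running maximum makes every number decode to a monotone vector, so the enumeration needs no
  -- test of monotonicity.
  | s + 1 => max (code n c s) (c / (n + 1) ^ (s + 1) % (n + 1))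

theorem code_le (n c s : ℕ) : code n c s ≤ n := by
  induction s with
  | zero => exact Nat.lt_succ_iff.1 (Nat.mod_lt _ (by omega))
  | succ s ih => exact max_le ih (Nat.lt_succ_iff.1 (Nat.mod_lt _ (by omega)))

theorem code_mono (n c : ℕ) : Monotone (code n c) :=
  monotone_nat_of_le_succ fun _ => le_max_left _ _

theorem exists_digits (n t : ℕ) (a : ℕ → ℕ) (ha : ∀ s, a s ≤ n) :
    ∃ c < (n + 1) ^ t, ∀ s < t, c / (n + 1) ^ s % (n + 1) = a s := by
  induction t generalizing a with
  | zero => exact ⟨0, by simp, by simp⟩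
  | succ t ih =>
    obtain ⟨c, hc, hd⟩ := ih (fun s => a (s + 1)) fun s => ha _
    refine ⟨(n + 1) * c + a 0, ?_, ?_⟩
    · have h1 : (n + 1) * (c + 1) ≤ (n + 1) * (n + 1) ^ t := Nat.mul_le_mul_left _ hc
      have := ha 0
      rw [pow_succ]
      nlinarith
    · have h0 : a 0 < n + 1 := Nat.lt_succ_iff.2 (ha 0)
      intro s hs
      cases s with
      | zero => simp [Nat.mod_eq_of_lt h0]
      | succ s =>
        rw [pow_succ', ← Nat.div_div_eq_div_mul, Nat.mul_add_div (by omega),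
          Nat.div_eq_of_lt h0, add_zero]
        exact hd s (by omega)

theorem exists_code (n t : ℕ) (a : ℕ → ℕ) (ha : ∀ s, a s ≤ n) (hmono : Monotone a) :
    ∃ c < (n + 1) ^ (t + 1), ∀ s ≤ t, code n c s = a s := by
  obtain ⟨c, hc, hd⟩ := exists_digits n (t + 1) a ha
  refine ⟨c, hc, fun s => ?_⟩
  induction s with
  | zero => intro _; simpa [code] using hd 0 (by omega)
  | succ s ih =>
    intro hs
    rw [code, ih (by omega), hd (s + 1) (by omega)]
    exact max_eq_right (hmono (by omega))

/-- A market with integer prices: `R` blocks of `t` price levels, of which level `k` has price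
`D k`, and values `W i b`. -/
structure Market where
  n : ℕ
  m : ℕ
  t : ℕ
  R : ℕ
  C : ℕ → ℕ
  D : ℕ → ℕ
  W : ℕ → ℕ → ℕ

namespace Market

variable (G : Market)

/-- The price level of item `i` if `a s` is the first item whose level is at least `s` in block
`r`. -/
def level (r : ℕ) (a : ℕ → ℕ) (i : ℕ) : ℕ := r * G.t + #{s ∈ range G.t | a (s + 1) ≤ i}

theorem level_mono (r : ℕ) (a : ℕ → ℕ) : Monotone (G.level r a) := by
  intro i j hij
  refine Nat.add_le_add_left (card_le_card fun s hs => ?_) _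
  simp only [mem_filter] at hs ⊢
  exact ⟨hs.1, hs.2.trans hij⟩

theorem le_level (r : ℕ) (a : ℕ → ℕ) (i : ℕ) : r * G.t ≤ G.level r a i := Nat.le_add_right _ _

theorem level_le (r : ℕ) (a : ℕ → ℕ) (i : ℕ) : G.level r a i ≤ (r + 1) * G.t := by
  have := card_filter_le (range G.t) fun s => a (s + 1) ≤ i
  simp only [card_range] at this
  rw [Nat.add_mul, one_mul]
  exact Nat.add_le_add_left this _

theorem level_lt {r : ℕ} {a : ℕ → ℕ} {i : ℕ} (ht : 0 < G.t) (hi : i < a G.t) :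
    G.level r a i < (r + 1) * G.t := by
  have : {s ∈ range G.t | a (s + 1) ≤ i} ⊆ range (G.t - 1) := by
    intro s hs
    simp only [mem_filter, mem_range] at hs ⊢
    by_contra hcon
    have : s + 1 = G.t := by omega
    rw [this] at hs
    omega
  have := card_le_card this
  rw [card_range] at this
  rw [level, Nat.add_mul, one_mul]
  omega

/-- A feasible assignment of the items `a 0, …, a t - 1` in block `r`. -/
structure Valid (r : ℕ) (a f : ℕ → ℕ) : Prop where
  first : ∀ b < G.m, f b ≠ 0 → a 0 ≤ f b - 1
  last : ∀ b < G.m, f b ≠ 0 → f b - 1 < a G.t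
  affordable : ∀ b < G.m, f b ≠ 0 → G.D (G.level r a (f b - 1)) ≤ G.W (f b - 1) b
  supply : ∀ i, count G.m f i ≤ G.C i

/-- The value of an assignment in block `r`. -/
def blockWeight (r : ℕ) (a f : ℕ → ℕ) : ℕ := weight G.m (fun i => G.D (G.level r a i)) f

/-- The largest value of a feasible assignment in block `r`. -/
noncomputable def best (r : ℕ) (a : ℕ → ℕ) : ℕ :=
  sSup {w | ∃ f, G.Valid r a f ∧ w = G.blockWeight r a f}

theorem best_eq {r : ℕ} {a f : ℕ → ℕ} (hf : G.Valid r a f)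
    (h : ∀ f', G.Valid r a f' → G.blockWeight r a f' ≤ G.blockWeight r a f) :
    G.best r a = G.blockWeight r a f :=
  IsGreatest.csSup_eq ⟨⟨f, hf, rfl⟩, by rintro w ⟨f', hf', rfl⟩; exact h f' hf'⟩

theorem le_best (hD : Antitone G.D) {r : ℕ} {a f : ℕ → ℕ} (hf : G.Valid r a f) :
    G.blockWeight r a f ≤ G.best r a := by
  -- The supremum of an unbounded set of naturals is `0` by convention, so a bound is needed: no
  -- bidder pays more than `D 0`.
  refine le_csSup ⟨G.m * G.D 0, ?_⟩ ⟨f, hf, rfl⟩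
  rintro w ⟨f', -, rfl⟩
  have := sum_le_card_nsmul (range G.m)
    (fun b => if f' b = 0 then 0 else G.D (G.level r a (f' b - 1))) (G.D 0) (by
      intro b _
      split
      · exact Nat.zero_le _
      · exact hD (Nat.zero_le _))
  simpa [blockWeight, weight] using this

theorem level_congr {r : ℕ} {a a' : ℕ → ℕ} (h : ∀ s ≤ G.t, a s = a' s) :
    G.level r a = G.level r a' := by
  funext i
  unfold level
  congr 2
  refine filter_congr fun s hs => ?_
  rw [h (s + 1) (mem_range.1 hs)]

/-- Allows the cut vector of an arbitrary plan to be replaced by that of a code, which agrees with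
it only up to index `t`. -/
theorem best_congr {r : ℕ} {a a' : ℕ → ℕ} (h : ∀ s ≤ G.t, a s = a' s) :
    G.best r a = G.best r a' := by
  have hl := G.level_congr (r := r) h
  have hv : ∀ f, G.Valid r a f ↔ G.Valid r a' f := by
    intro f
    constructor
    · rintro ⟨h1, h2, h3, h4⟩
      exact ⟨by rwa [← h 0 (Nat.zero_le _)], by rwa [← h _ le_rfl], by rwa [← hl], h4⟩
    · rintro ⟨h1, h2, h3, h4⟩
      exact ⟨by rwa [h 0 (Nat.zero_le _)], by rwa [h _ le_rfl], by rwa [hl], h4⟩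
  simp only [best, blockWeight, hl, hv]

/-- The best profit with the items from `j` on in the last `ρ` blocks. -/
noncomputable def value : ℕ → ℕ → ℕ
  | 0, _ => 0
  -- With `ρ + 1` blocks still to be filled, the next one is block `R - 1 - ρ`; its last cut is the
  -- first item left for the following block.
  | ρ + 1, j => {c ∈ range ((G.n + 1) ^ (G.t + 1)) | code G.n c 0 = j}.sup fun c =>
      G.best (G.R - 1 - ρ) (code G.n c) + value ρ (code G.n c G.t)

/-- The code `c` attains the maximum in the recursion for `value (ρ + 1) j`. -/
def IsChoice (ρ j c : ℕ) : Prop :=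
  c < (G.n + 1) ^ (G.t + 1) ∧ code G.n c 0 = j ∧
    G.best (G.R - 1 - ρ) (code G.n c) + G.value ρ (code G.n c G.t) = G.value (ρ + 1) j

/-- Item `i` has price level `k i`, and it is sold to bidder `b` if `A i b = 1`. -/
structure IsPlan (k : ℕ → ℕ) (A : ℕ → ℕ → ℕ) : Prop where
  mono : ∀ i j, i ≤ j → j < G.n → k i ≤ k j
  affordable : ∀ i < G.n, ∀ b < G.m, A i b = 1 → G.D (k i) ≤ G.W i b
  supply : ∀ i < G.n, #{b ∈ range G.m | A i b = 1} ≤ G.C i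
  separate : ∀ b < G.m, ∀ i < G.n, ∀ j < G.n, A i b = 1 → A j b = 1 →
    k i / G.t = k j / G.t → i = j

/-- The profit of a plan. -/
def profit (k : ℕ → ℕ) (A : ℕ → ℕ → ℕ) : ℕ :=
  ∑ b ∈ range G.m, ∑ i ∈ range G.n, if A i b = 1 then G.D (k i) else 0

/-- Since `k` is monotone, the items below a given level form a prefix. The lengths of these
prefixes are the cuts, and `level` recovers `k` from them inside the block. By `separate` a bidder
has at most one item of the block, so the sales form an assignment. -/
theorem IsPlan.block_le {G : Market} (hD : Antitone G.D) (ht : 0 < G.t) {k : ℕ → ℕ}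
    {A : ℕ → ℕ → ℕ} (h : G.IsPlan k A) (r : ℕ) :
    ∑ b ∈ range G.m, ∑ i ∈ range G.n, (if A i b = 1 ∧ k i / G.t = r then G.D (k i) else 0) ≤
      G.best r fun s => #{i ∈ range G.n | k i < r * G.t + s} := by
  classical
  set a : ℕ → ℕ := fun s => #{i ∈ range G.n | k i < r * G.t + s} with ha
  have hpre : ∀ s, ∀ i < G.n, (a s ≤ i ↔ r * G.t + s ≤ k i) := by
    intro s i hi
    constructor
    · intro hai
      by_contra! hlt
      have : range (i + 1) ⊆ {i ∈ range G.n | k i < r * G.t + s} := by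
        intro j hj
        have hj' := mem_range.1 hj
        have := h.mono j i (by omega) hi
        exact mem_filter.2 ⟨mem_range.2 (by omega), by omega⟩
      have := card_le_card this
      rw [card_range] at this
      simp only [ha] at hai
      omega
    · intro hle
      have : {i ∈ range G.n | k i < r * G.t + s} ⊆ range i := by
        intro j hj
        simp only [mem_filter, mem_range] at hj ⊢
        by_contra! hij
        have := h.mono i j hij hj.1
        omega
      simpa using card_le_card this
  have hlev : ∀ i < G.n, k i / G.t = r → G.level r a i = k i := by
    intro i hi hk
    have h1 : r * G.t ≤ k i := by rw [← hk]; exact Nat.div_mul_le_self _ _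
    have h2 : k i < r * G.t + G.t := by
      have := Nat.lt_div_mul_add (a := k i) ht
      rwa [hk] at this
    have : {s ∈ range G.t | a (s + 1) ≤ i} = range (k i - r * G.t) := by
      ext s
      simp only [mem_filter, mem_range, hpre _ i hi]
      omega
    rw [level, this, card_range]
    omega
  set f : ℕ → ℕ := fun b =>
    if hb : ∃ i, i < G.n ∧ A i b = 1 ∧ k i / G.t = r then hb.choose + 1 else 0 with hf
  have hf1 : ∀ b, f b ≠ 0 → f b - 1 < G.n ∧ A (f b - 1) b = 1 ∧ k (f b - 1) / G.t = r := by
    intro b hb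
    simp only [hf] at hb ⊢
    split at hb
    · rename_i hex
      rw [dif_pos hex]
      simpa using hex.choose_spec
    · exact absurd rfl hb
  have hf0 : ∀ b, f b = 0 → ∀ i < G.n, ¬ (A i b = 1 ∧ k i / G.t = r) := by
    intro b hb i hi hcon
    have hex : ∃ i, i < G.n ∧ A i b = 1 ∧ k i / G.t = r := ⟨i, hi, hcon⟩
    simp only [hf, dif_pos hex] at hb
    omega
  have hv : G.Valid r a f := by
    refine ⟨fun b _ hb => ?_, fun b _ hb => ?_, fun b hbm hb => ?_, fun i => ?_⟩
    · obtain ⟨h1, h2, h3⟩ := hf1 b hb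
      rw [hpre 0 _ h1, ← h3]
      exact Nat.div_mul_le_self _ _
    · obtain ⟨h1, h2, h3⟩ := hf1 b hb
      by_contra! hcon
      rw [hpre _ _ h1] at hcon
      have := Nat.lt_div_mul_add (a := k (f b - 1)) ht
      rw [h3] at this
      omega
    · obtain ⟨h1, h2, h3⟩ := hf1 b hb
      rw [hlev _ h1 h3]
      exact h.affordable _ h1 b hbm h2
    · by_cases hi : i < G.n
      · refine (card_le_card fun b hb => ?_).trans (h.supply i hi)
        simp only [mem_filter, mem_range] at hb ⊢
        have := (hf1 b (by omega)).2.1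
        rw [hb.2] at this
        exact ⟨hb.1, by simpa using this⟩
      · have : count G.m f i = 0 := by
          simp only [count, card_eq_zero, filter_eq_empty_iff]
          intro b _ hb
          have := (hf1 b (by omega)).1
          omega
        omega
  refine le_trans (le_of_eq ?_) (G.le_best hD hv)
  refine sum_congr rfl fun b hb => ?_
  have hbm := mem_range.1 hb
  split_ifs with hfb
  · refine sum_eq_zero fun i hi => ?_
    rw [if_neg (hf0 b hfb i (mem_range.1 hi))]
  · obtain ⟨h1, h2, h3⟩ := hf1 b hfb
    rw [sum_eq_single (f b - 1)]
    · simp only [if_pos (And.intro h2 h3), hlev _ h1 h3]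
    · intro i hi hne
      refine if_neg fun hcon => hne ?_
      exact h.separate b hbm i (mem_range.1 hi) _ h1 hcon.1 h2 (by rw [hcon.2, h3])
    · intro hcon
      exact absurd (mem_range.2 h1) hcon

/-- The profit splits into contributions of blocks. By induction on `ρ`, the last `ρ` blocks earn at
most the table entry at the number of items priced before them, because the cuts of the plan are
among those in the maximum. -/
theorem IsPlan.profit_le {G : Market} (hD : Antitone G.D) (ht : 0 < G.t) {k : ℕ → ℕ}
    {A : ℕ → ℕ → ℕ} (h : G.IsPlan k A) (hk : ∀ i < G.n, k i < G.R * G.t) :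
    G.profit k A ≤ G.value G.R 0 := by
  set part : ℕ → ℕ := fun r =>
    ∑ b ∈ range G.m, ∑ i ∈ range G.n, (if A i b = 1 ∧ k i / G.t = r then G.D (k i) else 0)
    with hpart
  have htot : G.profit k A = ∑ r ∈ range G.R, part r := by
    simp only [hpart, profit]
    rw [sum_comm (s := range G.R)]
    refine sum_congr rfl fun b _ => ?_
    rw [sum_comm]
    refine sum_congr rfl fun i hi => ?_
    have hr : k i / G.t ∈ range G.R :=
      mem_range.2 (Nat.div_lt_of_lt_mul (by rw [mul_comm]; exact hk i (mem_range.1 hi)))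
    rw [sum_eq_single_of_mem _ hr]
    · simp
    · intro r _ hne
      exact if_neg fun hcon => hne hcon.2.symm
  have key : ∀ ρ ≤ G.R, ∑ r ∈ Ico (G.R - ρ) G.R, part r ≤
      G.value ρ #{i ∈ range G.n | k i < (G.R - ρ) * G.t} := by
    intro ρ
    induction ρ with
    | zero => simp
    | succ ρ ih =>
      intro hρ
      have hr : G.R - ρ = (G.R - (ρ + 1)) + 1 := by omega
      have hr' : G.R - 1 - ρ = G.R - (ρ + 1) := by omega
      have ih' := ih (by omega)
      rw [hr] at ih'
      set r := G.R - (ρ + 1) with hrdef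
      rw [sum_eq_sum_Ico_succ_bot (by omega)]
      set a : ℕ → ℕ := fun s => #{i ∈ range G.n | k i < r * G.t + s} with ha
      have han : ∀ s, a s ≤ G.n := by
        intro s
        simpa using card_filter_le (range G.n) fun i => k i < r * G.t + s
      have hamono : Monotone a := by
        intro s s' hs
        refine card_le_card fun i hi => ?_
        simp only [mem_filter] at hi ⊢
        exact ⟨hi.1, by omega⟩
      obtain ⟨c, hc, hcode⟩ := exists_code G.n G.t a han hamono
      have h1 := h.block_le hD ht r
      rw [← G.best_congr hcode] at h1
      have h2 : #{i ∈ range G.n | k i < (r + 1) * G.t} = code G.n c G.t := by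
        rw [hcode _ le_rfl]
        simp only [ha, Nat.add_mul, one_mul]
      rw [h2] at ih'
      have h3 : #{i ∈ range G.n | k i < r * G.t} = code G.n c 0 := by
        rw [hcode _ (Nat.zero_le _)]
        simp only [ha, add_zero]
      rw [h3]
      refine le_trans (Nat.add_le_add h1 ih') ?_
      have := le_sup (s := {c' ∈ range ((G.n + 1) ^ (G.t + 1)) | code G.n c' 0 = code G.n c 0})
        (f := fun c => G.best (G.R - 1 - ρ) (code G.n c) + G.value ρ (code G.n c G.t))
        (mem_filter.2 ⟨mem_range.2 hc, rfl⟩)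
      rw [value]
      simpa only [hr'] using this
  have := key G.R le_rfl
  rw [htot]
  simpa using this

/-- A plan for the items below `j`, which uses the first `r` blocks and is the beginning of an
optimal plan. -/
structure IsPartial (r j : ℕ) (k : ℕ → ℕ) (A : ℕ → ℕ → ℕ) : Prop where
  le : j ≤ G.n
  lt : ∀ i < j, k i < r * G.t
  rest : ∀ i, j ≤ i → i < G.n → k i = G.R * G.t
  mono : ∀ i i', i ≤ i' → i' < j → k i ≤ k i'
  unsold : ∀ i, j ≤ i → i < G.n → ∀ b < G.m, A i b ≠ 1
  affordable : ∀ i < j, ∀ b < G.m, A i b = 1 → G.D (k i) ≤ G.W i b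
  supply : ∀ i < j, #{b ∈ range G.m | A i b = 1} ≤ G.C i
  separate : ∀ b < G.m, ∀ i < j, ∀ i' < j, A i b = 1 → A i' b = 1 →
    k i / G.t = k i' / G.t → i = i'
  optimal : G.profit k A + G.value (G.R - r) j = G.value G.R 0

/-- The items left over are unsold and have level `R * t`, beyond all used levels, so they disturb
neither the ladder nor the block condition. -/
theorem IsPartial.isPlan {G : Market} {j : ℕ} {k : ℕ → ℕ} {A : ℕ → ℕ → ℕ}
    (h : G.IsPartial G.R j k A) : G.IsPlan k A ∧ G.profit k A = G.value G.R 0 := by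
  have hs : ∀ i < G.n, ∀ b < G.m, A i b = 1 → i < j := by
    intro i hi b hb hA
    by_contra! hij
    exact h.unsold i hij hi b hb hA
  refine ⟨⟨fun i i' hi hi' => ?_, fun i hi b hb hA => ?_, fun i hi => ?_,
    fun b hb i hi i' hi' hA hA' => ?_⟩, ?_⟩
  · by_cases h1 : i' < j
    · exact h.mono i i' hi h1
    · rw [h.rest i' (by omega) hi']
      by_cases h2 : i < j
      · exact (h.lt i h2).le
      · rw [h.rest i (by omega) (by omega)]
  · exact h.affordable i (hs i hi b hb hA) b hb hA
  · by_cases h1 : i < j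
    · exact h.supply i h1
    · have : #{b ∈ range G.m | A i b = 1} = 0 := by
        simp only [card_eq_zero, filter_eq_empty_iff, mem_range]
        exact fun b hb => h.unsold i (by omega) hi b hb
      omega
  · exact h.separate b hb i (hs i hi b hb hA) i' (hs i' hi' b hb hA') hA hA'
  · simpa [value] using h.optimal

theorem IsPartial.start {G : Market} {k : ℕ → ℕ} {A : ℕ → ℕ → ℕ}
    (hk : ∀ i < G.n, k i = G.R * G.t) (hA : ∀ i < G.n, ∀ b < G.m, A i b = 0) :
    G.IsPartial 0 0 k A := by
  refine ⟨by omega, by omega, fun i _ => hk i, by omega, fun i _ hi b hb => ?_, by omega, by omega,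
    by omega, ?_⟩
  · simp [hA i hi b hb]
  · have : G.profit k A = 0 := by
      refine sum_eq_zero fun b hb => sum_eq_zero fun i hi => ?_
      simp [hA i (mem_range.1 hi) b (mem_range.1 hb)]
    simp [this]

/-- The new items come after the old ones and their levels lie in block `r`, after all blocks used
so far; no constraint connects the two parts. By the choice of `c`, the profit gained equals the
decrease of the remaining value. -/
theorem IsPartial.step {G : Market} (ht : 0 < G.t) {r j c : ℕ} {k f : ℕ → ℕ} {A : ℕ → ℕ → ℕ}
    (h : G.IsPartial r j k A) (hr : r < G.R) (hc : G.IsChoice (G.R - 1 - r) j c)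
    (hf : G.Valid r (code G.n c) f) (hbest : G.best r (code G.n c) = G.blockWeight r (code G.n c) f)
    {k' : ℕ → ℕ} {A' : ℕ → ℕ → ℕ}
    (hk' : ∀ i < G.n, k' i =
      if j ≤ i ∧ i < code G.n c G.t then G.level r (code G.n c) i else k i)
    (hA' : ∀ i < G.n, ∀ b < G.m, A' i b = if f b = i + 1 then 1 else A i b) :
    G.IsPartial (r + 1) (code G.n c G.t) k' A' := by
  obtain ⟨hc1, hc2, hc3⟩ := hc
  set a := code G.n c with ha
  have hjt : j ≤ a G.t := by rw [← hc2]; exact code_mono _ _ (Nat.zero_le _)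
  have htn : a G.t ≤ G.n := code_le _ _ _
  have hold : ∀ i < j, k' i = k i := fun i hi => by
    rw [hk' i (by omega), if_neg (by omega)]
  have hnew : ∀ i, j ≤ i → i < a G.t → k' i = G.level r a i := fun i h1 h2 => by
    rw [hk' i (by omega), if_pos ⟨h1, h2⟩]
  have hf1 : ∀ b < G.m, ∀ i, f b = i + 1 → j ≤ i ∧ i < a G.t := by
    intro b hb i hi
    have h1 := hf.first b hb (by omega)
    have h2 := hf.last b hb (by omega)
    rw [hi] at h1 h2
    simp only [Nat.add_sub_cancel] at h1 h2
    rw [hc2] at h1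
    exact ⟨h1, h2⟩
  have hAold : ∀ i < j, ∀ b < G.m, A' i b = A i b := fun i hi b hb => by
    rw [hA' i (by have := h.le; omega) b hb, if_neg fun hcon => by have := hf1 b hb i hcon; omega]
  have hAnew : ∀ i, j ≤ i → i < G.n → ∀ b < G.m, (A' i b = 1 ↔ f b = i + 1) := by
    intro i hi hin b hb
    rw [hA' i hin b hb]
    have := h.unsold i hi hin b hb
    split_ifs <;> tauto
  have hblk : ∀ i, j ≤ i → i < a G.t → k' i / G.t = r := by
    intro i h1 h2
    rw [hnew i h1 h2]
    exact Nat.div_eq_of_lt_le (G.le_level _ _ _) (G.level_lt ht h2)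
  have hblk' : ∀ i < j, k' i / G.t < r := by
    intro i hi
    rw [hold i hi]
    exact Nat.div_lt_of_lt_mul (by rw [mul_comm]; exact h.lt i hi)
  refine ⟨htn, fun i hi => ?_, fun i h1 h2 => ?_, fun i i' hii hi' => ?_, fun i h1 h2 b hb hA => ?_,
    fun i hi b hb hA => ?_, fun i hi => ?_, fun b hb i hi i' hi' hA hA1 hkk => ?_, ?_⟩
  · by_cases hij : i < j
    · rw [hold i hij]
      exact (h.lt i hij).trans_le (Nat.mul_le_mul_right _ (by omega))
    · rw [hnew i (by omega) hi]
      exact G.level_lt ht hi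
  · rw [hk' i h2, if_neg (by omega)]
    exact h.rest i (by omega) h2
  · by_cases h1 : i' < j
    · rw [hold i' h1, hold i (by omega)]
      exact h.mono i i' hii h1
    · rw [hnew i' (by omega) hi']
      by_cases h2 : i < j
      · rw [hold i h2]
        exact (h.lt i h2).le.trans (G.le_level _ _ _)
      · rw [hnew i (by omega) (by omega)]
        exact G.level_mono _ _ hii
  · rw [hAnew i (by omega) h2 b hb] at hA
    have := hf1 b hb i hA
    omega
  · by_cases hij : i < j
    · rw [hAold i hij b hb] at hA
      rw [hold i hij]
      exact h.affordable i hij b hb hA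
    · rw [hAnew i (by omega) (by omega) b hb] at hA
      rw [hnew i (by omega) hi]
      have := hf.affordable b hb (by omega)
      rwa [hA] at this
  · by_cases hij : i < j
    · refine le_trans (le_of_eq ?_) (h.supply i hij)
      congr 1
      exact filter_congr fun b hb => by rw [hAold i hij b (mem_range.1 hb)]
    · refine le_trans (le_of_eq ?_) (hf.supply i)
      unfold count
      congr 1
      exact filter_congr fun b hb => hAnew i (by omega) (by omega) b (mem_range.1 hb)
  · by_cases h1 : i < j <;> by_cases h2 : i' < j
    · rw [hAold i h1 b hb] at hA
      rw [hAold i' h2 b hb] at hA1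
      rw [hold i h1, hold i' h2] at hkk
      exact h.separate b hb i h1 i' h2 hA hA1 hkk
    · have := hblk' i h1
      have := hblk i' (by omega) hi'
      omega
    · have := hblk' i' h2
      have := hblk i (by omega) hi
      omega
    · rw [hAnew i (by omega) (by omega) b hb] at hA
      rw [hAnew i' (by omega) (by omega) b hb] at hA1
      omega
  · have hprofit : G.profit k' A' = G.profit k A + G.blockWeight r a f := by
      simp only [profit, blockWeight, weight, ← sum_add_distrib]
      refine sum_congr rfl fun b hb => ?_
      have hbm := mem_range.1 hb
      have hsplit : ∀ i ∈ range G.n, (if A' i b = 1 then G.D (k' i) else 0) =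
          (if A i b = 1 then G.D (k i) else 0) +
            if f b = i + 1 then G.D (G.level r a i) else 0 := by
        intro i hi
        have hin := mem_range.1 hi
        by_cases hij : i < j
        · rw [hAold i hij b hbm, hold i hij, if_neg (c := f b = i + 1), add_zero]
          intro hcon
          have := hf1 b hbm i hcon
          omega
        · rw [if_neg (h.unsold i (by omega) hin b hbm), zero_add]
          by_cases hfb : f b = i + 1
          · rw [if_pos hfb, if_pos ((hAnew i (by omega) hin b hbm).2 hfb),
              hnew i (by omega) (hf1 b hbm i hfb).2]
          · rw [if_neg hfb, if_neg fun hcon => hfb ((hAnew i (by omega) hin b hbm).1 hcon)]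
      rw [sum_congr rfl hsplit, sum_add_distrib]
      congr 1
      split_ifs with hfb
      · exact sum_eq_zero fun i _ => if_neg (by omega)
      · have h1 := (hf1 b hbm (f b - 1) (by omega)).2
        rw [sum_eq_single_of_mem (f b - 1) (mem_range.2 (by omega))]
        · rw [if_pos (by omega)]
        · intro i _ hne
          exact if_neg (by omega)
    have e1 : G.R - 1 - (G.R - 1 - r) = r := by omega
    have e2 : G.R - 1 - r + 1 = G.R - r := by omega
    have e3 : G.R - (r + 1) = G.R - 1 - r := by omega
    rw [e1, e2] at hc3
    rw [hprofit, e3, ← h.optimal, ← hc3, hbest]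
    ring

end Market

end MaxBuying

/-! ### Reduction of an instance to an integer market -/

namespace MaxBuying

open Finset

namespace Instance

variable (X : Instance)

/-- The market of an instance with all prices and values multiplied by `p ^ K`, where `K = R * t`
is the number of price levels, and where the ratio of consecutive prices is `p / q`. -/
def market (p q t R : ℕ) : Market where
  n := X.n
  m := X.m
  t := t
  R := R
  C i := if h : i < X.n then X.C ⟨i, h⟩ else 0
  -- Truncating `l` at `R * t` makes the sequence constant beyond the last level, so that for `q ≤
  -- p` it is antitone on all of `ℕ`.
  D l := X.maxValue * q ^ min l (R * t) * p ^ (R * t - min l (R * t))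
  W i b := (if h : i < X.n ∧ b < X.m then X.v ⟨i, h.1⟩ ⟨b, h.2⟩ else 0) * p ^ (R * t)

theorem market_D_antitone {p q t R : ℕ} (h : q ≤ p) : Antitone (X.market p q t R).D := by
  refine antitone_nat_of_succ_le fun l => ?_
  simp only [market]
  by_cases hl : l < R * t
  · rw [min_eq_left (by omega), min_eq_left (by omega)]
    obtain ⟨d, hd⟩ : ∃ d, R * t = l + 1 + d := ⟨R * t - (l + 1), by omega⟩
    rw [hd, show l + 1 + d - (l + 1) = d by omega, show l + 1 + d - l = d + 1 by omega]
    calc X.maxValue * q ^ (l + 1) * p ^ d = X.maxValue * q ^ l * p ^ d * q := by ring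
      _ ≤ X.maxValue * q ^ l * p ^ d * p := Nat.mul_le_mul_left _ h
      _ = _ := by ring
  · rw [min_eq_right (by omega), min_eq_right (by omega)]

theorem market_D_eq {p q t R l : ℕ} (hp : p ≠ 0) (hq : q ≠ 0) (hl : l ≤ R * t) :
    ((X.market p q t R).D l : ℚ) = X.gridPrice ((p : ℚ) / q) l * (p : ℚ) ^ (R * t) := by
  obtain ⟨d, hd⟩ : ∃ d, R * t = l + d := ⟨R * t - l, by omega⟩
  simp only [market, gridPrice, min_eq_left hl]
  rw [hd, Nat.add_sub_cancel_left]
  have : (p : ℚ) ≠ 0 := by exact_mod_cast hp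
  have : (q : ℚ) ≠ 0 := by exact_mod_cast hq
  push_cast
  rw [div_pow, pow_add]
  field_simp

theorem le_maxValue (i : Fin X.n) (b : Fin X.m) : X.v i b ≤ X.maxValue :=
  le_sup (f := fun q : Fin X.n × Fin X.m => X.v q.1 q.2) (mem_univ (i, b))

theorem gridPrice_pos {α : ℚ} (hα : 1 < α) (hM : X.maxValue ≠ 0) (l : ℕ) :
    0 < X.gridPrice α l := by
  have : (0 : ℚ) < X.maxValue := by exact_mod_cast Nat.pos_of_ne_zero hM
  unfold gridPrice
  positivity

theorem gridPrice_strictAnti {α : ℚ} (hα : 1 < α) (hM : X.maxValue ≠ 0) :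
    StrictAnti (X.gridPrice α) := by
  intro k l hkl
  have : (0 : ℚ) < X.maxValue := by exact_mod_cast Nat.pos_of_ne_zero hM
  exact div_lt_div_of_pos_left this (by positivity) (pow_lt_pow_right₀ hα hkl)

/-- Distinct levels have distinct prices, so a price determines its block. If the maximum is `0`,
all grid prices coincide; that case is treated separately. -/
theorem mem_block_iff {α : ℚ} (hα : 1 < α) (hM : X.maxValue ≠ 0) {t r k : ℕ} (ht : 0 < t) :
    X.gridPrice α k ∈ X.block α t r ↔ k / t = r := by
  constructor
  · rintro ⟨l, h1, h2, h3⟩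
    rw [(X.gridPrice_strictAnti hα hM).injective h3]
    exact Nat.div_eq_of_lt_le h1 h2
  · rintro rfl
    refine ⟨k, Nat.div_mul_le_self _ _, ?_, rfl⟩
    rw [Nat.add_mul, one_mul]
    exact Nat.lt_div_mul_add ht

theorem profit_eq {p q t R : ℕ} (s : Outcome X) {k : ℕ → ℕ} {A : ℕ → ℕ → ℕ}
    (hA : ∀ (i : Fin X.n) (b : Fin X.m), A i b = 1 ↔ i ∈ s.alloc b) :
    ((X.market p q t R).profit k A : ℚ) =
      ∑ b, ∑ i ∈ s.alloc b, ((X.market p q t R).D (k i) : ℚ) := by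
  have h1 : (X.market p q t R).n = X.n := rfl
  have h2 : (X.market p q t R).m = X.m := rfl
  unfold Market.profit
  rw [h1, h2, sum_range]
  push_cast
  refine sum_congr rfl fun b _ => ?_
  rw [sum_range, ← sum_filter]
  refine sum_congr ?_ fun _ _ => rfl
  ext i
  simp [hA]

theorem card_holders_eq (s : Outcome X) {A : ℕ → ℕ → ℕ}
    (hA : ∀ (i : Fin X.n) (b : Fin X.m), A i b = 1 ↔ i ∈ s.alloc b) (i : Fin X.n) :
    #{b ∈ range X.m | A i b = 1} = #{b | i ∈ s.alloc b} := by
  rw [card_filter, sum_range, card_filter]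
  exact sum_congr rfl fun b _ => by simp [hA]

theorem isFeasible_of_isPlan {p q t R : ℕ} (hq : q ≠ 0) (hqp : q < p) (ht : 0 < t)
    (hM : X.maxValue ≠ 0) (s : Outcome X) {k : ℕ → ℕ} {A : ℕ → ℕ → ℕ}
    (hA : ∀ (i : Fin X.n) (b : Fin X.m), A i b = 1 ↔ i ∈ s.alloc b)
    (hk : ∀ i < X.n, k i ≤ R * t) (h : (X.market p q t R).IsPlan k A)
    (hprice : ∀ i, s.price i = ((X.market p q t R).D (k i) : ℚ) / (p : ℚ) ^ (R * t)) :
    s.IsFeasible ((p : ℚ) / q) t ∧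
      s.profit * (p : ℚ) ^ (R * t) = (X.market p q t R).profit k A := by
  have hq' : (0 : ℚ) < q := by exact_mod_cast Nat.pos_of_ne_zero hq
  have hp' : (0 : ℚ) < p := hq'.trans (by exact_mod_cast hqp)
  have hα : 1 < (p : ℚ) / q := (one_lt_div hq').2 (by exact_mod_cast hqp)
  have hprice' : ∀ i, s.price i = X.gridPrice ((p : ℚ) / q) (k i) := by
    intro i
    rw [hprice, X.market_D_eq (by omega) hq (hk i i.2)]
    field_simp
  have hanti := X.gridPrice_strictAnti hα hM
  refine ⟨⟨fun i => ?_, fun i j hij => ?_, fun i => ⟨k i, hprice' i⟩, fun b i hi => ?_,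
    fun i => ?_, fun b r i hi j hj h1 h2 => ?_⟩, ?_⟩
  · rw [hprice']
    exact (X.gridPrice_pos hα hM _).le
  · rw [hprice', hprice', hanti.le_iff_ge]
    exact h.mono i j hij j.2
  · have h1 := h.affordable i i.2 b b.2 ((hA i b).2 hi)
    have h2 : (X.market p q t R).W i b = X.v i b * p ^ (R * t) := by
      simp [market]
    rw [h2] at h1
    rw [hprice, div_le_iff₀ (by positivity)]
    exact_mod_cast h1
  · have h1 := h.supply i i.2
    have h2 : (X.market p q t R).C i = X.C i := by simp [market]
    rw [h2] at h1
    refine le_trans (le_of_eq ?_) h1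
    exact (X.card_holders_eq s hA i).symm
  · rw [hprice', X.mem_block_iff hα hM ht] at h1 h2
    exact Fin.ext (h.separate b b.2 i i.2 j j.2 ((hA i b).2 hi) ((hA j b).2 hj)
      (h1.trans h2.symm))
  · rw [X.profit_eq s hA, Outcome.profit, sum_mul]
    refine sum_congr rfl fun b _ => ?_
    rw [sum_mul]
    refine sum_congr rfl fun i _ => ?_
    rw [hprice]
    field_simp

/-- Every `κ` levels at least halve the price, and as many halvings as there are binary digits bring
the maximum down to at most `1`. -/
theorem gridPrice_le_one {α : ℚ} (hα : 1 < α) {κ l : ℕ} (hκ : 2 ≤ α ^ κ)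
    (hl : κ * Nat.size X.maxValue ≤ l) : X.gridPrice α l ≤ 1 := by
  unfold gridPrice
  rw [div_le_one (by positivity)]
  calc (X.maxValue : ℚ) ≤ 2 ^ Nat.size X.maxValue := by
        exact_mod_cast (Nat.lt_size_self X.maxValue).le
    _ ≤ (α ^ κ) ^ Nat.size X.maxValue := by gcongr
    _ = α ^ (κ * Nat.size X.maxValue) := by rw [pow_mul]
    _ ≤ α ^ l := pow_le_pow_right₀ hα.le hl

/-- An item beyond block `r₀ + i` is moved to the first level of that block. Its price does not
decrease and is at most `1`, so its buyers still afford it, as their values are positive integers.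
The caps `r₀ + i` increase strictly with `i`, so items in different blocks stay in different blocks
and the order is kept; only `r₀ + n` blocks are used. -/
theorem profit_le_value {p q t κ : ℕ} (hq : q ≠ 0) (hqp : q < p) (ht : 0 < t)
    (hκ : 2 ≤ ((p : ℚ) / q) ^ κ) (hM : X.maxValue ≠ 0) (s : Outcome X)
    (hs : s.IsFeasible ((p : ℚ) / q) t) {R : ℕ} (hR : R = κ * Nat.size X.maxValue + X.n) :
    s.profit * (p : ℚ) ^ (R * t) ≤ (X.market p q t R).value R 0 := by
  classical
  have hq' : (0 : ℚ) < q := by exact_mod_cast Nat.pos_of_ne_zero hq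
  have hp' : (0 : ℚ) < p := hq'.trans (by exact_mod_cast hqp)
  have hα : 1 < (p : ℚ) / q := (one_lt_div hq').2 (by exact_mod_cast hqp)
  have hanti := X.gridPrice_strictAnti hα hM
  set α := (p : ℚ) / q with hαdef
  set r₀ := κ * Nat.size X.maxValue with hr₀
  choose lv' hlv' using hs.price_grid
  set lv : ℕ → ℕ := fun i => if h : i < X.n then lv' ⟨i, h⟩ else 0 with hlv
  have hlvp : ∀ i : Fin X.n, s.price i = X.gridPrice α (lv i) := by
    intro i
    simp [hlv, hlv' i]
  have hlvmono : ∀ i j, i ≤ j → j < X.n → lv i ≤ lv j := by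
    intro i j hij hj
    have h1 := hs.price_ladder ⟨i, by omega⟩ ⟨j, hj⟩ hij
    rw [hlvp, hlvp, hanti.le_iff_ge] at h1
    exact h1
  set k : ℕ → ℕ := fun i => if lv i / t ≤ r₀ + i then lv i else (r₀ + i) * t with hk
  have hdiv : ∀ i, lv i / t ≤ r₀ + i ↔ lv i < (r₀ + i + 1) * t := by
    intro i
    rw [← Nat.lt_succ_iff, Nat.div_lt_iff_lt_mul ht]
  have hkle : ∀ i, k i ≤ lv i := by
    intro i
    simp only [hk]
    split_ifs with h
    · exact le_rfl
    · rw [not_le, Nat.lt_iff_add_one_le, Nat.le_div_iff_mul_le ht] at h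
      nlinarith
  have hklt : ∀ i < X.n, k i < R * t := by
    intro i hi
    have h2 : (r₀ + i + 1) * t ≤ R * t := Nat.mul_le_mul_right _ (by omega)
    simp only [hk]
    split_ifs with h
    · rw [hdiv] at h
      omega
    · nlinarith
  have hkt : ∀ i, k i / t = min (lv i / t) (r₀ + i) := by
    intro i
    simp only [hk]
    split_ifs with h
    · rw [min_eq_left h]
    · rw [min_eq_right (by omega), Nat.mul_div_cancel _ ht]
  set A : ℕ → ℕ → ℕ := fun i b =>
    if ∃ (hi : i < X.n) (hb : b < X.m), (⟨i, hi⟩ : Fin X.n) ∈ s.alloc ⟨b, hb⟩ then 1 else 0 with hA'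
  have hA : ∀ (i : Fin X.n) (b : Fin X.m), A i b = 1 ↔ i ∈ s.alloc b := by
    intro i b
    simp [hA']
  have hA1 : ∀ i < X.n, ∀ b < X.m, A i b = 1 → ∃ (hi : i < X.n) (hb : b < X.m),
      (⟨i, hi⟩ : Fin X.n) ∈ s.alloc ⟨b, hb⟩ := by
    intro i hi b hb h
    exact ⟨hi, hb, (hA ⟨i, hi⟩ ⟨b, hb⟩).1 h⟩
  have hplan : (X.market p q t R).IsPlan k A := by
    refine ⟨fun i j hij hj => ?_, fun i hi b hb hAi => ?_, fun i hi => ?_,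
      fun b hb i hi j hj hAi hAj hij => ?_⟩
    · have h1 := hlvmono i j hij hj
      have h2 := hkle i
      rcases hij.eq_or_lt with rfl | hlt
      · exact le_rfl
      by_cases h : lv j / t ≤ r₀ + j
      · have : k j = lv j := if_pos h
        omega
      · have hj' : k j = (r₀ + j) * t := if_neg h
        rw [hj']
        have h3 : (r₀ + i + 1) * t ≤ (r₀ + j) * t := Nat.mul_le_mul_right _ (by omega)
        by_cases h' : lv i / t ≤ r₀ + i
        · rw [hdiv] at h'
          omega
        · have hi' : k i = (r₀ + i) * t := if_neg h'
          rw [hi']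
          exact Nat.mul_le_mul_right _ (by omega)
    · obtain ⟨hi', hb', hmem⟩ := hA1 i hi b hb hAi
      have haff := hs.affordable _ _ hmem
      rw [hlvp] at haff
      have hpos := X.gridPrice_pos hα hM (lv i)
      have hle : X.gridPrice α (k i) ≤ X.v ⟨i, hi'⟩ ⟨b, hb'⟩ := by
        by_cases h : lv i / t ≤ r₀ + i
        · have : k i = lv i := if_pos h
          rw [this]
          exact haff
        · have hki : k i = (r₀ + i) * t := if_neg h
          refine (X.gridPrice_le_one hα hκ (l := k i) ?_).trans ?_
          · rw [← hr₀, hki]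
            nlinarith
          · have : (0 : ℚ) < X.v ⟨i, hi'⟩ ⟨b, hb'⟩ := hpos.trans_le haff
            have : 0 < X.v ⟨i, hi'⟩ ⟨b, hb'⟩ := by exact_mod_cast this
            exact_mod_cast this
      have h2 : (X.market p q t R).W i b = X.v ⟨i, hi'⟩ ⟨b, hb'⟩ * p ^ (R * t) := by
        simp [market, hi', hb']
      rw [h2]
      have h3 := X.market_D_eq (p := p) (t := t) (by omega) hq (hklt i hi').le
      have : (((X.market p q t R).D (k i) : ℕ) : ℚ) ≤
          ((X.v ⟨i, hi'⟩ ⟨b, hb'⟩ * p ^ (R * t) : ℕ) : ℚ) := by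
        rw [h3]
        push_cast
        gcongr
      exact_mod_cast this
    · have hi' : i < X.n := hi
      have h2 : (X.market p q t R).C i = X.C ⟨i, hi⟩ := by
        simp [market, hi']
      rw [h2]
      exact (X.card_holders_eq s hA ⟨i, hi⟩).le.trans (hs.supply _)
    · obtain ⟨hi', hb', hmem⟩ := hA1 i hi b hb hAi
      obtain ⟨hj', _, hmem'⟩ := hA1 j hj b hb hAj
      have hij' : k i / t = k j / t := hij
      rw [hkt, hkt] at hij'
      have hsame : lv i / t = lv j / t → i = j := by
        intro he
        have := hs.one_per_block ⟨b, hb'⟩ (lv i / t) _ hmem _ hmem'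
          (by rw [hlvp, X.mem_block_iff hα hM ht]) (by rw [hlvp, X.mem_block_iff hα hM ht, he])
        simpa using this
      rcases lt_trichotomy i j with hlt | heq | hlt
      · have := Nat.div_le_div_right (c := t) (hlvmono i j hlt.le hj')
        by_cases he : lv i / t = lv j / t
        · exact hsame he
        · omega
      · exact heq
      · have := Nat.div_le_div_right (c := t) (hlvmono j i hlt.le hi')
        by_cases he : lv i / t = lv j / t
        · exact hsame he
        · omega
  have hfinal := hplan.profit_le (X.market_D_antitone (by omega)) ht hklt
  calc s.profit * (p : ℚ) ^ (R * t) ≤ ((X.market p q t R).profit k A : ℚ) := by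
        rw [X.profit_eq s hA, Outcome.profit, sum_mul]
        refine sum_le_sum fun b _ => ?_
        rw [sum_mul]
        refine sum_le_sum fun i _ => ?_
        rw [X.market_D_eq (by omega) hq (hklt i i.2).le, hlvp]
        have := hanti.antitone (hkle i)
        gcongr
    _ ≤ _ := by exact_mod_cast hfinal

end Instance

end MaxBuying

/-! ### The algorithm as a structured program -/

namespace RAM

namespace Term

instance (c : ℕ) : OfNat Term c := ⟨.const c⟩
instance : Add Term := ⟨.add⟩
instance : Sub Term := ⟨.sub⟩
instance : Mul Term := ⟨.mul⟩
instance : Div Term := ⟨.div⟩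

/-- The content of register `x`. -/
def reg (x : ℕ) : Term := .get x 0

/-- The limit number `c`. -/
def lim (c : ℕ) : Term := .get 2 (.const c)

variable (σ : Memory) (e e' : Term)

@[simp] theorem value_ofNat (c : ℕ) : (no_index (OfNat.ofNat c : Term)).value σ = c := rfl
@[simp] theorem value_add : (e + e').value σ = e.value σ + e'.value σ := rfl
@[simp] theorem value_sub : (e - e').value σ = e.value σ - e'.value σ := rfl
@[simp] theorem value_mul : (e * e').value σ = e.value σ * e'.value σ := rfl
@[simp] theorem value_div : (e / e').value σ = e.value σ / e'.value σ := rfl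
@[simp] theorem value_get (a : ℕ) : (Term.get a e).value σ = σ a (e.value σ) := rfl
@[simp] theorem value_reg (x : ℕ) : (reg x).value σ = σ x 0 := rfl
@[simp] theorem value_lim (c : ℕ) : (lim c).value σ = σ 2 c := rfl

end Term

namespace Stmt

/-- Assignment to a register. -/
def set (x : ℕ) (e : Term) : Stmt := .put x 0 e

variable (σ : Memory)

@[simp] theorem run_skip : Stmt.skip.run σ = σ := rfl
@[simp] theorem run_put (a : ℕ) (e₁ e₂ : Term) :
    (Stmt.put a e₁ e₂).run σ = σ.store a (e₁.value σ) (e₂.value σ) := rfl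
@[simp] theorem run_set (x : ℕ) (e : Term) :
    (Stmt.set x e).run σ = σ.store x 0 (e.value σ) := rfl
@[simp] theorem run_seq (P Q : Stmt) : (Stmt.seq P Q).run σ = Q.run (P.run σ) := rfl

variable {σ}

theorem run_branch_pos {e : Term} {P Q : Stmt} (h : e.value σ ≠ 0) :
    (Stmt.branch e P Q).run σ = P.run σ := if_pos h

theorem run_branch_neg {e : Term} {P Q : Stmt} (h : e.value σ = 0) :
    (Stmt.branch e P Q).run σ = Q.run σ := if_neg (not_not.2 h)

end Stmt

end RAM

namespace MaxBuying

open RAM Finset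

local infixr:60 " ;; " => Stmt.seq

local notation "aOut" => 1
local notation "rMax" => 3
local notation "aPrice" => 10
local notation "rScale" => 11
local notation "aValue" => 12
local notation "aCut" => 13
local notation "aCost" => 14
local notation "aLevel" => 15
local notation "aSupply" => 16
local notation "aMate" => 17
local notation "aLabel" => 18
local notation "rToken" => 19
local notation "rBest" => 20
local notation "rFail" => 21
local notation "rVal" => 22
local notation "aNext" => 23
local notation "aCur" => 24
local notation "aChoice" => 25
local notation "rCode" => 26
local notation "rBlock" => 27
local notation "rOld" => 28
local notation "rRest" => 29
local notation "rPrev" => 30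
local notation "aFinal" => 31
local notation "rFirst" => 32
local notation "rS" => 40
local notation "rI" => 41
local notation "rB" => 42
local notation "rC" => 43
local notation "rU" => 44
local notation "rItem" => 45
local notation "rCopy" => 46
local notation "rRow" => 47
local notation "rJ" => 48

namespace Alg

open Term Stmt

/-- The next cut. -/
def decodeStep : Stmt :=
  put aCut (reg rS) (reg rRest - lim 6 * (reg rRest / lim 6)) ;;
  set rRest (reg rRest / lim 6) ;;
  -- With truncated subtraction, `a - b` tests `b < a` and `a + 1 - b` tests `b ≤ a`; all
  -- comparisons of the algorithm have one of these forms.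
  branch (reg rPrev - get aCut (reg rS)) (put aCut (reg rS) (reg rPrev)) skip ;;
  set rPrev (get aCut (reg rS))

/-- The cuts `code n c 0, …, code n c t` from the number `c`. -/
def decode : Stmt :=
  set rRest (reg rCode) ;; set rPrev 0 ;; rep rS 5 decodeStep

/-- Compares item `rI` with the next cut. -/
def levelStep : Stmt :=
  branch (reg rI + 1 - get aCut (reg rS + 1)) (set rOld (reg rOld + 1)) skip

/-- The level and the price of item `rI`. -/
def levelItem : Stmt :=
  set rOld (lim 4 * reg rBlock) ;;
  rep rS 4 levelStep ;;
  put aLevel (reg rI) (reg rOld) ;;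
  put aCost (reg rI) (get aPrice (reg rOld))

/-- The levels and prices of the items from the cuts. -/
def levels : Stmt := rep rI 0 levelItem

/-- Compares bidder `rB` with the best bidder so far. -/
def findStep : Stmt :=
  branch (get aValue (lim 1 * (reg rToken - 1) + reg rB) + 1 - get aCost (reg rToken - 1))
    (branch (get aLabel (reg rBest) - get aLabel (reg rB)) (set rBest (reg rB)) skip) skip

/-- A bidder of minimal label among those who can afford the current item. -/
def findBidder : Stmt := set rBest (lim 1) ;; rep rB 1 findStep

/-- The current item goes to the best bidder, and the previous item of this bidder takes its
place. -/
def exchange : Stmt :=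
  set rOld (get aMate (reg rBest)) ;;
  put aMate (reg rBest) (reg rToken) ;;
  put aLabel (reg rBest) (get aLabel (reg rBest) + 1) ;;
  set rToken (reg rOld)

/-- One step of the auction. -/
def offer : Stmt :=
  branch (reg rToken)
    (findBidder ;; branch (lim 1 - reg rBest) exchange (set rToken 0 ;; set rFail 1)) skip

/-- Brings copy `rCopy` of item `rItem` to the market. -/
def launch : Stmt :=
  branch (get aSupply (reg rItem) - reg rCopy)
    (set rToken (reg rItem + 1) ;; rep rU 7 offer) skip

/-- Initializes the labels and the assignment. -/
def clear : Stmt :=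
  set rFail 0 ;;
  rep rB 1 (put aMate (reg rB) 0 ;; put aLabel (reg rB) 0) ;;
  -- Cell `m` belongs to no bidder. It is a sentinel of label `m + 1` from which the search starts,
  -- so a bidder is chosen only with a label of at most `m`.
  put aLabel (lim 1) (lim 1 + 1) ;;
  set rToken 0

/-- Matches the supply `aSupply`, or fails. -/
def auction : Stmt := clear ;; rep rItem 0 (rep rCopy 1 launch)

/-- Adds copy `rC` of item `rI` to the supply if this is possible. -/
def greedyStep : Stmt :=
  branch (get 0 (2 + reg rI) - reg rC)
    (put aSupply (reg rI) (get aSupply (reg rI) + 1) ;;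
      auction ;;
      branch (reg rFail) (put aSupply (reg rI) (get aSupply (reg rI) - 1)) skip) skip

/-- Adds as many copies of item `rI` as possible to the supply if the item is in the block. -/
def greedyItem : Stmt :=
  branch (reg rI + 1 - get aCut 0)
    (branch (get aCut (lim 4) - reg rI) (rep rC 1 greedyStep) skip) skip

/-- An assignment of the items of the current block of maximal value. -/
def greedy : Stmt :=
  -- The last trial may have failed and spoiled the assignment, hence the final auction for the
  -- accepted supply.
  rep rI 0 (put aSupply (reg rI) 0) ;; rep rI 0 greedyItem ;; auction

/-- The value of the assignment. -/
def evaluate : Stmt :=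
  set rVal 0 ;;
  rep rB 1 (
    branch (get aMate (reg rB)) (set rVal (reg rVal + get aCost (get aMate (reg rB) - 1))) skip)

/-- An optimal assignment and its value for the block `rBlock` with the cuts of code `rCode`. -/
def block : Stmt := decode ;; levels ;; greedy ;; evaluate

/-- Compares the value of the cuts of code `rCode` with the best value so far. -/
def tableStep : Stmt :=
  block ;;
  set rVal (reg rVal + get aNext (get aCut (lim 4))) ;;
  -- Ties replace the entry as well, so a choice is recorded even if the best value is `0`.
  branch (reg rVal + 1 - get aCur (get aCut 0))
    (put aCur (get aCut 0) (reg rVal) ;;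
      put aChoice (lim 6 * reg rRow + get aCut 0) (reg rCode)) skip

/-- One row of the table. -/
def tableRow : Stmt :=
  rep rJ 6 (put aCur (reg rJ) 0) ;;
  set rBlock (lim 9 - 1 - reg rRow) ;;
  rep rCode 8 tableStep ;;
  rep rJ 6 (put aNext (reg rJ) (get aCur (reg rJ)))

/-- The dynamic program over the blocks. -/
def table : Stmt := rep rJ 6 (put aNext (reg rJ) 0) ;; rep rRow 9 tableRow

/-- Stores the levels of the items of a block. -/
def storeLevels : Stmt :=
  rep rJ 0 (
    branch (reg rJ + 1 - get aCut 0)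
      (branch (get aCut (lim 4) - reg rJ) (put aFinal (reg rJ) (get aLevel (reg rJ))) skip) skip)

/-- Writes the assignment of a block. -/
def storeMates : Stmt :=
  rep rJ 1 (
    branch (get aMate (reg rJ))
      (put aOut (lim 0 + lim 0 + (lim 1 * (get aMate (reg rJ) - 1) + reg rJ)) 1) skip)

/-- Adds the next block to the solution. -/
def reconstructStep : Stmt :=
  set rBlock (reg rRow) ;;
  set rCode (get aChoice (lim 6 * (lim 9 - 1 - reg rRow) + reg rFirst)) ;;
  block ;; storeLevels ;; storeMates ;;
  set rFirst (get aCut (lim 4))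

/-- Levels and allocation of an optimal solution, from the table. -/
def reconstruct : Stmt :=
  rep rJ 0 (put aFinal (reg rJ) (lim 10)) ;; set rFirst 0 ;; rep rRow 9 reconstructStep

/-- The prices as fractions. -/
def prices : Stmt :=
  rep rJ 0 (
    put aOut (reg rJ + reg rJ) (get aPrice (get aFinal (reg rJ))) ;;
    put aOut (reg rJ + reg rJ + 1) (reg rScale))

/-- The scaled prices and values. -/
def scale : Stmt :=
  put aPrice 0 (reg rMax) ;;
  set rScale 1 ;;
  rep rI 10 (
    put aPrice 0 (lim 2 * get aPrice 0) ;;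
    set rScale (lim 2 * reg rScale)) ;;
  -- Each price is `q / p` times the preceding one. The division is exact, since the first price
  -- carries the factor `p ^ K` and there are only `K` steps.
  rep rI 10 (put aPrice (reg rI + 1) (lim 3 * get aPrice (reg rI) / lim 2)) ;;
  rep rItem 0 (rep rB 1 (
    put aValue (lim 1 * reg rItem + reg rB)
      (get 0 (2 + lim 0 + (lim 1 * reg rItem + reg rB))) ;;
    rep rI 10 (
      put aValue (lim 1 * reg rItem + reg rB) (lim 2 * get aValue (lim 1 * reg rItem + reg rB)))))

/-- The main part of the algorithm. -/
def solve : Stmt :=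
  branch (reg rMax) (scale ;; table ;; reconstruct ;; prices)
    (rep rJ 0 (put aOut (reg rJ + reg rJ + 1) 1))

/-- The largest value. -/
def maximum : Stmt :=
  rep rItem 0 (rep rB 1 (
    branch (get 0 (2 + lim 0 + (lim 1 * reg rItem + reg rB)) - reg rMax)
      (set rMax (get 0 (2 + lim 0 + (lim 1 * reg rItem + reg rB)))) skip))

end Alg

theorem solve_tame : Alg.solve.tame = true := by rfl

theorem maximum_tame : Alg.maximum.tame = true := by rfl

/-! ### Correctness of decoding and pricing a block -/

open Term Stmt

/-- The memory holds the limits and the data of the market `G`. -/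
structure Env (G : Market) (σ : Memory) : Prop where
  t_pos : 0 < G.t
  antitone : Antitone G.D
  n : σ 2 0 = G.n
  m : σ 2 1 = G.m
  t : σ 2 4 = G.t
  t_succ : σ 2 5 = G.t + 1
  n_succ : σ 2 6 = G.n + 1
  steps : σ 2 7 = G.m * (G.m + 1) + 1
  codes : σ 2 8 = (G.n + 1) ^ (G.t + 1)
  blocks : σ 2 9 = G.R
  levels : σ 2 10 = G.R * G.t
  supply : ∀ i < G.n, σ 0 (2 + i) = G.C i
  price : ∀ l ≤ G.R * G.t, σ aPrice l = G.D l
  value : ∀ i < G.n, ∀ b < G.m, σ aValue (G.m * i + b) = G.W i b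

theorem Env.congr {G : Market} {σ τ : Memory} (h : Env G σ) (h2 : τ 2 = σ 2) (h0 : τ 0 = σ 0)
    (hp : τ aPrice = σ aPrice) (hv : τ aValue = σ aValue) : Env G τ := by
  obtain ⟨g1, g2, g3, g4, g5, g6, g7, g8, g9, g10, g11, g12, g13, g14⟩ := h
  exact ⟨g1, g2, by rwa [h2], by rwa [h2], by rwa [h2], by rwa [h2], by rwa [h2], by rwa [h2],
    by rwa [h2], by rwa [h2], by rwa [h2], by rwa [h0], by rwa [hp], by rwa [hv]⟩

theorem Env.run {G : Market} {σ : Memory} (h : Env G σ) (P : Stmt) (h2 : P.writes 2 = false)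
    (h0 : P.writes 0 = false) (hp : P.writes aPrice = false) (hv : P.writes aValue = false) :
    Env G (P.run σ) :=
  h.congr (run_of_not_writes h2 σ) (run_of_not_writes h0 σ) (run_of_not_writes hp σ)
    (run_of_not_writes hv σ)

theorem run_decode {G : Market} {σ : Memory} (h : Env G σ) :
    ∀ s ≤ G.t, Alg.decode.run σ aCut s = code G.n (σ rCode 0) s := by
  simp only [Alg.decode, run_seq]
  set σ' := (set rPrev 0).run ((set rRest (reg rCode)).run σ) with hσ'
  have e2 : σ' 2 = σ 2 := by simp [hσ', Memory.store_apply]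
  have key := Stmt.run_rep (x := rS) (c := 5) (P := Alg.decodeStep) (σ := σ')
    (fun k τ => τ rRest 0 = σ rCode 0 / (G.n + 1) ^ k ∧
      (∀ s < k, τ aCut s = code G.n (σ rCode 0) s) ∧
      τ rPrev 0 = if k = 0 then 0 else code G.n (σ rCode 0) (k - 1)) ?_ ?_
  · rw [e2, h.t_succ] at key
    exact fun s hs => key.2.1 s (by omega)
  · simp [hσ', Memory.store_apply]
  · rintro k τ hk hx hfr ⟨h1, h2, h3⟩
    have e6 : τ 2 6 = G.n + 1 := by rw [hfr 2 (by rfl), e2, h.n_succ]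
    have hmod : τ rRest 0 - (G.n + 1) * (τ rRest 0 / (G.n + 1)) = τ rRest 0 % (G.n + 1) := by
      have := Nat.mod_add_div (τ rRest 0) (G.n + 1)
      omega
    have hcode : max (τ rPrev 0) (τ rRest 0 % (G.n + 1)) = code G.n (σ rCode 0) k := by
      rw [h1, h3]
      cases k with
      | zero => simp [code]
      | succ k => simp [code]
    have hall : ∀ s ≤ k, (if s = k then code G.n (σ rCode 0) k else τ aCut s) =
        code G.n (σ rCode 0) s := by
      intro s hs
      split_ifs with hsk
      · rw [hsk]
      · exact h2 s (by omega)
    have hdiv : τ rRest 0 / (G.n + 1) = σ rCode 0 / (G.n + 1) ^ (k + 1) := by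
      rw [h1, Nat.div_div_eq_div_mul, pow_succ]
    simp only [Alg.decodeStep, run_seq, run_put, run_set]
    by_cases hb : τ rPrev 0 ≤ τ rRest 0 % (G.n + 1)
    · rw [max_eq_right hb] at hcode
      rw [run_branch_neg]
      · simp [Memory.store_apply, e6, hx, hmod, Function.update_apply, hcode]
        exact ⟨hdiv, hall⟩
      · simp [Memory.store_apply, e6, hx, hmod]
        omega
    · rw [max_eq_left (by omega)] at hcode
      rw [run_branch_pos]
      · simp [Memory.store_apply, e6, hx, Function.update_apply, hcode]
        refine ⟨hdiv, fun s hs => ?_⟩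
        have := hall s hs
        split_ifs at this ⊢ <;> exact this
      · simp [Memory.store_apply, e6, hx, hmod]
        omega

theorem run_levelItem {G : Market} {σ : Memory} (h : Env G σ) {k : ℕ} (hk : σ rI 0 = k)
    (hr : σ rBlock 0 < G.R) :
    Alg.levelItem.run σ aLevel = Function.update (σ aLevel) k (G.level (σ rBlock 0) (σ aCut) k) ∧
    Alg.levelItem.run σ aCost =
      Function.update (σ aCost) k (G.D (G.level (σ rBlock 0) (σ aCut) k)) := by
  set σ' := (set rOld (lim 4 * reg rBlock)).run σ with hσ'
  have key := Stmt.run_rep (x := rS) (c := 4) (P := Alg.levelStep) (σ := σ')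
    (fun l τ => τ rOld 0 = σ rBlock 0 * G.t + #{s ∈ range l | σ aCut (s + 1) ≤ k}) ?_ ?_
  · have e2 : σ' 2 4 = G.t := by simp [hσ', Memory.store_apply, h.t]
    rw [e2] at key
    set σ'' := (rep rS 4 Alg.levelStep).run σ' with hσ''
    have f1 : σ'' rI = σ rI := by
      rw [hσ'', run_of_not_writes (by rfl)]; simp [hσ', Memory.store_apply]
    have f2 : σ'' aPrice = σ aPrice := by
      rw [hσ'', run_of_not_writes (by rfl)]; simp [hσ', Memory.store_apply]
    have f3 : σ'' aLevel = σ aLevel := by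
      rw [hσ'', run_of_not_writes (by rfl)]; simp [hσ', Memory.store_apply]
    have f4 : σ'' aCost = σ aCost := by
      rw [hσ'', run_of_not_writes (by rfl)]; simp [hσ', Memory.store_apply]
    have hrun : Alg.levelItem.run σ = (put aCost (reg rI) (get aPrice (reg rOld))).run
        ((put aLevel (reg rI) (reg rOld)).run σ'') := rfl
    have hlev : σ'' rOld 0 = G.level (σ rBlock 0) (σ aCut) k := key
    have hD : σ aPrice (G.level (σ rBlock 0) (σ aCut) k) = G.D (G.level (σ rBlock 0) (σ aCut) k) :=
      h.price _ ((G.level_le _ _ _).trans (Nat.mul_le_mul_right _ hr))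
    rw [hrun]
    simp [Memory.store_apply, f1, f2, f3, f4, hk, hlev, hD]
  · simp [hσ', Memory.store_apply, h.t, mul_comm]
  · intro l τ hl hx hfr hI
    have f1 : τ aCut = σ aCut := by rw [hfr _ (by rfl)]; simp [hσ', Memory.store_apply]
    have f2 : τ rI 0 = k := by rw [hfr _ (by rfl)]; simp [hσ', Memory.store_apply, hk]
    rw [range_add_one, filter_insert]
    simp only [Alg.levelStep]
    by_cases hb : σ aCut (l + 1) ≤ k
    · rw [if_pos hb, card_insert_of_notMem (by simp), run_branch_pos]
      · simp [Memory.store_apply, hI]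
        ring
      · simp [hx, f1, f2]
        omega
    · rw [if_neg hb, run_branch_neg]
      · simp [Memory.store_apply, hI]
      · simp [hx, f1, f2]
        omega

theorem run_levels {G : Market} {σ : Memory} (h : Env G σ) (hr : σ rBlock 0 < G.R) :
    ∀ i < G.n, Alg.levels.run σ aLevel i = G.level (σ rBlock 0) (σ aCut) i ∧
      Alg.levels.run σ aCost i = G.D (G.level (σ rBlock 0) (σ aCut) i) := by
  have key := Stmt.run_rep (x := rI) (c := 0) (P := Alg.levelItem) (σ := σ)
    (fun k τ => ∀ i < k, τ aLevel i = G.level (σ rBlock 0) (σ aCut) i ∧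
      τ aCost i = G.D (G.level (σ rBlock 0) (σ aCut) i)) (by simp) ?_
  · rwa [h.n] at key
  · intro k τ hk hx hfr hI
    have hτ : Env G τ := h.congr (hfr _ (by rfl)) (hfr _ (by rfl)) (hfr _ (by rfl)) (hfr _ (by rfl))
    have f1 : τ aCut = σ aCut := hfr _ (by rfl)
    have f2 : τ rBlock = σ rBlock := hfr _ (by rfl)
    obtain ⟨g1, g2⟩ := run_levelItem hτ hx (by rw [f2]; exact hr)
    rw [f1, f2] at g1 g2
    intro i hi
    simp only [Memory.store_apply, g1, g2]
    by_cases hik : i = k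
    · subst hik; simp
    · simpa [hik] using hI i (by omega)

/-! ### Correctness of the auction on the machine -/

/-- The bidders who can afford an item at its current cost. -/
def adj (m : ℕ) (σ : Memory) (i b : ℕ) : Prop := σ aCost i ≤ σ aValue (m * i + b)

/-- The answer `G.m` is the sentinel; by the last clause it means that every bidder who can afford
the item has a label above `G.m`. -/
theorem run_findBidder {G : Market} {σ : Memory} (h : Env G σ) (htop : σ aLabel G.m = G.m + 1)
    (hle : ∀ b < G.m, σ aLabel b ≤ G.m + 1) :
    ∃ best, Alg.findBidder.run σ rBest 0 = best ∧ best ≤ G.m ∧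
      (best < G.m → adj G.m σ (σ rToken 0 - 1) best ∧ σ aLabel best ≤ G.m) ∧
      ∀ b < G.m, adj G.m σ (σ rToken 0 - 1) b → σ aLabel best ≤ σ aLabel b := by
  set σ' := (set rBest (lim 1)).run σ with hσ'
  have e2 : σ' 2 = σ 2 := by simp [hσ', Memory.store_apply]
  have key := Stmt.run_rep (x := rB) (c := 1) (P := Alg.findStep) (σ := σ')
    (fun k τ => τ rBest 0 ≤ G.m ∧
      (τ rBest 0 < G.m → adj G.m σ (σ rToken 0 - 1) (τ rBest 0) ∧ σ aLabel (τ rBest 0) ≤ G.m) ∧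
      ∀ b < k, adj G.m σ (σ rToken 0 - 1) b → σ aLabel (τ rBest 0) ≤ σ aLabel b) ?_ ?_
  · rw [e2, h.m] at key
    exact ⟨_, rfl, key⟩
  · simp [hσ', Memory.store_apply, h.m]
  · rintro k τ hk hx hfr ⟨h1, h2, h3⟩
    rw [e2, h.m] at hk
    have f1 : τ aValue = σ aValue := by rw [hfr _ (by rfl)]; simp [hσ', Memory.store_apply]
    have f2 : τ aCost = σ aCost := by rw [hfr _ (by rfl)]; simp [hσ', Memory.store_apply]
    have f3 : τ aLabel = σ aLabel := by rw [hfr _ (by rfl)]; simp [hσ', Memory.store_apply]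
    have f4 : τ rToken = σ rToken := by rw [hfr _ (by rfl)]; simp [hσ', Memory.store_apply]
    have f5 : τ 2 1 = G.m := by rw [hfr _ (by rfl)]; simp [hσ', Memory.store_apply, h.m]
    have hkm := hle k hk
    have hb1 : (σ aValue (G.m * (σ rToken 0 - 1) + k) + 1 - σ aCost (σ rToken 0 - 1) ≠ 0) ↔
        adj G.m σ (σ rToken 0 - 1) k := by
      unfold adj; omega
    have hbest : σ aLabel (τ rBest 0) ≤ G.m + 1 := by
      rcases h1.lt_or_eq with hlt | heq
      · exact (h2 hlt).2.trans (Nat.le_succ _)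
      · rw [heq, htop]
    have stay : (∀ b ≤ k, adj G.m σ (σ rToken 0 - 1) b → σ aLabel (τ rBest 0) ≤ σ aLabel b) →
        τ rBest 0 ≤ G.m ∧ (τ rBest 0 < G.m →
          adj G.m σ (σ rToken 0 - 1) (τ rBest 0) ∧ σ aLabel (τ rBest 0) ≤ G.m) ∧
        ∀ b < k + 1, adj G.m σ (σ rToken 0 - 1) b → σ aLabel (τ rBest 0) ≤ σ aLabel b :=
      fun h => ⟨h1, h2, fun b hb => h b (Nat.lt_succ_iff.1 hb)⟩
    simp only [Alg.findStep]
    by_cases ha : adj G.m σ (σ rToken 0 - 1) k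
    · rw [run_branch_pos]
      · by_cases hb : σ aLabel (τ rBest 0) ≤ σ aLabel k
        · rw [run_branch_neg]
          · simp only [run_skip, Memory.store_apply]
            refine stay fun b hbk hab => ?_
            rcases hbk.lt_or_eq with hlt | rfl
            · exact h3 b hlt hab
            · exact hb
          · simp [f3, hx]
            omega
        · rw [run_branch_pos]
          · have : k ≤ G.m ∧ (k < G.m → adj G.m σ (σ rToken 0 - 1) k ∧ σ aLabel k ≤ G.m) ∧
                ∀ b < k + 1, adj G.m σ (σ rToken 0 - 1) b → σ aLabel k ≤ σ aLabel b := by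
              refine ⟨hk.le, fun _ => ⟨ha, by omega⟩, fun b hbk hab => ?_⟩
              rcases Nat.lt_succ_iff_lt_or_eq.1 hbk with hlt | rfl
              · have := h3 b hlt hab
                omega
              · exact le_rfl
            simpa [Memory.store_apply, hx] using this
          · simp [f3, hx]
            omega
      · simpa [f1, f2, f4, f5, hx] using hb1.2 ha
    · rw [run_branch_neg]
      · simp only [run_skip, Memory.store_apply]
        refine stay fun b hbk hab => ?_
        rcases hbk.lt_or_eq with hlt | rfl
        · exact h3 b hlt hab
        · exact absurd hab ha
      · simpa [f1, f2, f4, f5, hx] using not_not.1 (mt hb1.1 ha)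

theorem adj_congr {σ τ : Memory} (hc : τ aCost = σ aCost) (hv : τ aValue = σ aValue) (m : ℕ) :
    adj m τ = adj m σ := by
  unfold adj
  rw [hc, hv]

/-- Hall's condition fails for the supply `κ`. -/
def Violated (m : ℕ) (A : ℕ → ℕ → Prop) (κ : ℕ → ℕ) : Prop :=
  ∃ R : Finset ℕ, (∀ i ∈ R, κ i ≠ 0) ∧ #(nbhd m A R) < ∑ i ∈ R, κ i

theorem Violated.mono {m : ℕ} {A : ℕ → ℕ → Prop} {L κ : ℕ → ℕ} (h : Violated m A L)
    (hL : ∀ i, L i ≤ κ i) : Violated m A κ := by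
  obtain ⟨R, h1, h2⟩ := h
  refine ⟨R, fun i hi => ?_, h2.trans_le (sum_le_sum fun i _ => hL i)⟩
  have := h1 i hi
  have := hL i
  omega

/-- The loop has a fixed number of rounds and continues after a failure, so the flag must survive
the remaining ones. -/
theorem offer_fail {σ : Memory} (h : σ rFail 0 ≠ 0) : Alg.offer.run σ rFail 0 ≠ 0 := by
  unfold Alg.offer
  by_cases ht : σ rToken 0 = 0
  · rw [run_branch_neg (by simpa using ht)]
    exact h
  · rw [run_branch_pos (by simpa using ht), run_seq]
    have hf : Alg.findBidder.run σ rFail = σ rFail := run_of_not_writes (by rfl) σ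
    generalize Alg.findBidder.run σ = τ at hf
    by_cases hb : τ 2 1 - τ rBest 0 = 0
    · rw [run_branch_neg (by simpa using hb)]
      simp [Memory.store_apply]
    · rw [run_branch_pos (by simpa using hb), run_of_not_writes (by rfl), hf]
      exact h

theorem run_offer {G : Market} {σ : Memory} (h : Env G σ) (htop : σ aLabel G.m = G.m + 1)
    {L : ℕ → ℕ} (hA : Auction G.m (adj G.m σ) L (σ aMate) (σ aLabel) (σ rToken 0)) :
    (Alg.offer.run σ rFail 0 = σ rFail 0 ∧ Alg.offer.run σ aLabel G.m = G.m + 1 ∧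
      Auction G.m (adj G.m σ) L (Alg.offer.run σ aMate) (Alg.offer.run σ aLabel)
        (Alg.offer.run σ rToken 0) ∧
      (Alg.offer.run σ rToken 0 = 0 ∨
        ∑ b ∈ range G.m, Alg.offer.run σ aLabel b = (∑ b ∈ range G.m, σ aLabel b) + 1)) ∨
    (Alg.offer.run σ rFail 0 ≠ 0 ∧ Violated G.m (adj G.m σ) L) := by
  unfold Alg.offer
  by_cases ht : σ rToken 0 = 0
  · rw [run_branch_neg (by simpa using ht)]
    exact Or.inl ⟨rfl, htop, hA, Or.inl ht⟩
  · rw [run_branch_pos (by simpa using ht), run_seq]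
    obtain ⟨best, hb, hbm, hlt, hmin⟩ := run_findBidder h htop hA.label_le
    have f1 : Alg.findBidder.run σ rFail = σ rFail := run_of_not_writes (by rfl) σ
    have f2 : Alg.findBidder.run σ aMate = σ aMate := run_of_not_writes (by rfl) σ
    have f3 : Alg.findBidder.run σ aLabel = σ aLabel := run_of_not_writes (by rfl) σ
    have f4 : Alg.findBidder.run σ rToken = σ rToken := run_of_not_writes (by rfl) σ
    have f5 : Alg.findBidder.run σ 2 = σ 2 := run_of_not_writes (by rfl) σ
    generalize Alg.findBidder.run σ = τ at hb f1 f2 f3 f4 f5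
    by_cases hbest : best < G.m
    · left
      rw [run_branch_pos (by simp [f5, h.m, hb]; omega)]
      obtain ⟨h1, h2⟩ := hlt hbest
      have hA' := hA.push ht hbest h1 h2 hmin
      have hsum := Auction.sum_push (y := σ aLabel) hbest
      have hne : ¬ G.m = best := by omega
      simp only [Alg.exchange, run_seq, run_put, run_set]
      simp only [value_reg, value_get, value_add, value_ofNat, Memory.store_apply,
        Nat.reduceEqDiff, if_true, if_false, hb, f1, f2, f3, f4, Function.update_self]
      exact ⟨trivial, by rw [Function.update_of_ne hne]; exact htop, hA', Or.inr hsum⟩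
    · right
      have hbe : best = G.m := by omega
      rw [run_branch_neg (by simp [f5, h.m, hb]; omega)]
      refine ⟨by simp [Memory.store_apply], hA.violator ht fun b hbm' hab => ?_⟩
      have := hmin b hbm' hab
      rw [hbe, htop] at this
      omega

/-- The state of the auction between two items. -/
def Cleared (m : ℕ) (A : ℕ → ℕ → Prop) (κ L : ℕ → ℕ) (σ : Memory) : Prop :=
  (σ rFail 0 = 0 ∧ σ aLabel m = m + 1 ∧ σ rToken 0 = 0 ∧
    Auction m A L (σ aMate) (σ aLabel) 0) ∨ (σ rFail 0 ≠ 0 ∧ Violated m A κ)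

theorem run_launch {G : Market} {σ : Memory} (h : Env G σ) {κ L : ℕ → ℕ} {i c : ℕ}
    (hi : σ rItem 0 = i) (hc : σ rCopy 0 = c)
    (hL : c < σ aSupply i → ∀ j, Function.update L i (L i + 1) j ≤ κ j)
    (hS : Cleared G.m (adj G.m σ) κ L σ) :
    Cleared G.m (adj G.m σ) κ (if c < σ aSupply i then Function.update L i (L i + 1) else L)
      (Alg.launch.run σ) := by
  unfold Alg.launch
  by_cases hci : c < σ aSupply i
  · rw [run_branch_pos (by simp [hi, hc]; omega), if_pos hci, run_seq]
    have hL' := hL hci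
    set σ' := (set rToken (reg rItem + 1)).run σ with hσ'
    set L' := Function.update L i (L i + 1)
    have fr : ∀ a, a ≠ rToken → σ' a = σ a := fun a ha => by simp [hσ', Memory.store_apply, ha]
    have hE : Env G σ' := h.congr (fr _ (by decide)) (fr _ (by decide)) (fr _ (by decide))
      (fr _ (by decide))
    have key := Stmt.run_rep (x := rU) (c := 7) (P := Alg.offer) (σ := σ')
      (fun k τ => (τ rFail 0 = 0 ∧ τ aLabel G.m = G.m + 1 ∧
        Auction G.m (adj G.m σ) L' (τ aMate) (τ aLabel) (τ rToken 0) ∧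
        (τ rToken 0 = 0 ∨ k ≤ ∑ b ∈ range G.m, τ aLabel b)) ∨
        (τ rFail 0 ≠ 0 ∧ Violated G.m (adj G.m σ) κ)) ?_ ?_
    · rw [hE.steps] at key
      rcases key with ⟨h1, h2, h3, h4⟩ | h1
      -- Every round that leaves a token has raised the label sum, and `m * (m + 1) + 1` rounds
      -- exceed its bound; so no token is left.
      · have := h3.sum_le
        have h5 := h4.resolve_right (by omega)
        rw [h5] at h3
        exact Or.inl ⟨h1, h2, h5, h3⟩
      · exact Or.inr h1
    · rcases hS with ⟨h1, h2, h3, h4⟩ | h1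
      · left
        have h5 := h4.launch i
        simpa [Memory.store_apply, hσ', h1, h2, hi] using h5
      · right
        simpa [Memory.store_apply, hσ'] using h1
    · intro k τ hk hx hfr hI
      have g1 : adj G.m τ = adj G.m σ :=
        adj_congr ((hfr _ (by rfl)).trans (fr _ (by decide)))
          ((hfr _ (by rfl)).trans (fr _ (by decide))) _
      have hEτ : Env G τ := hE.congr (hfr _ (by rfl)) (hfr _ (by rfl)) (hfr _ (by rfl))
        (hfr _ (by rfl))
      simp only [Memory.store_apply, Nat.reduceEqDiff, if_false]
      rcases hI with ⟨h1, h2, h3, h4⟩ | ⟨h1, h2⟩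
      · rw [← g1] at h3
        rcases run_offer hEτ h2 h3 with ⟨k1, k2, k3, k4⟩ | ⟨k1, k2⟩
        · left
          rw [g1] at k3
          refine ⟨by rw [k1, h1], k2, k3, ?_⟩
          rcases k4 with k4 | k4
          · exact Or.inl k4
          · rcases h4 with h4 | h4
            · left
              have : Alg.offer.run τ = τ := run_branch_neg (by simpa using h4)
              rw [this]
              exact h4
            · exact Or.inr (by omega)
        · right
          rw [g1] at k2
          exact ⟨k1, k2.mono hL'⟩
      · exact Or.inr ⟨offer_fail h1, h2⟩
  · rw [run_branch_neg (by simp [hi, hc]; omega), if_neg hci]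
    exact hS

theorem run_clear {G : Market} {σ : Memory} (h : Env G σ) (A : ℕ → ℕ → Prop) (κ : ℕ → ℕ) :
    Cleared G.m A κ (fun _ => 0) (Alg.clear.run σ) := by
  have key := Stmt.run_rep (x := rB) (c := 1) (P := put aMate (reg rB) 0 ;; put aLabel (reg rB) 0)
    (σ := (set rFail 0).run σ) (fun k τ => ∀ b < k, τ aMate b = 0 ∧ τ aLabel b = 0) (by simp) ?_
  · have e2 : (set rFail 0).run σ 2 = σ 2 := by simp [Memory.store_apply]
    rw [e2, h.m] at key
    unfold Alg.clear
    rw [run_seq, run_seq]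
    set τ := (rep rB 1 (put aMate (reg rB) 0 ;; put aLabel (reg rB) 0)).run ((set rFail 0).run σ)
      with hτ
    have f1 : τ rFail 0 = 0 := by
      rw [hτ, run_of_not_writes (by rfl)]; simp [Memory.store_apply]
    have f2 : τ 2 = σ 2 := by rw [hτ, run_of_not_writes (by rfl), e2]
    left
    refine ⟨?_, ?_, ?_, Auction.start ?_ ?_⟩
    · simp [Memory.store_apply, f1]
    · simp [Memory.store_apply, f2, h.m]
    · simp [Memory.store_apply]
    · intro b hb
      simpa [Memory.store_apply] using (key b hb).1
    · intro b hb
      have : b ≠ G.m := by omega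
      simpa [Memory.store_apply, f2, h.m, this] using (key b hb).2
  · intro k τ hk hx hfr hI b hb
    by_cases hbk : b = k
    · simp [Memory.store_apply, hx, hbk]
    · simpa [Memory.store_apply, hx, hbk] using hI b (by omega)

/-- The numbers of copies in the supply. -/
def supply (n : ℕ) (σ : Memory) (i : ℕ) : ℕ := if i < n then σ aSupply i else 0

/-- Copies are launched one by one, so a failure concerns only a part of the supply; by
`Violated.mono` it refutes the whole supply. The bound `hm` is needed because the loop tries only
`m` copies of each item. -/
theorem run_auction {G : Market} {σ : Memory} (h : Env G σ)
    (hm : ∀ i < G.n, σ aSupply i ≤ G.m) :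
    (Alg.auction.run σ rFail 0 = 0 ∧
      Matches G.m (adj G.m σ) (supply G.n σ) (Alg.auction.run σ aMate)) ∨
    (Alg.auction.run σ rFail 0 ≠ 0 ∧ Violated G.m (adj G.m σ) (supply G.n σ)) := by
  set κ := supply G.n σ with hκ
  set A := adj G.m σ with hAdef
  unfold Alg.auction
  rw [run_seq]
  have hE : Env G (Alg.clear.run σ) := h.run _ (by rfl) (by rfl) (by rfl) (by rfl)
  have c1 : Alg.clear.run σ aCost = σ aCost := run_of_not_writes (by rfl) σ
  have c2 : Alg.clear.run σ aValue = σ aValue := run_of_not_writes (by rfl) σ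
  have c3 : Alg.clear.run σ aSupply = σ aSupply := run_of_not_writes (by rfl) σ
  have hc := run_clear h A κ
  generalize Alg.clear.run σ = σ' at *
  have key := Stmt.run_rep (x := rItem) (c := 0) (P := rep rCopy 1 Alg.launch) (σ := σ')
    (fun k τ => Cleared G.m A κ (fun j => if j < k then κ j else 0) τ) ?_ ?_
  · rw [hE.n] at key
    rcases key with ⟨h1, -, -, h2⟩ | h1
    · left
      have : (fun j => if j < G.n then κ j else 0) = κ := by
        funext j
        simp only [hκ, supply]
        split_ifs <;> rfl
      rw [this] at h2
      exact ⟨h1, h2.matches⟩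
    · exact Or.inr h1
  · simpa [Cleared, Memory.store_apply] using hc
  · intro k τ hk hx hfr hI
    rw [hE.n] at hk
    have d2 : τ 2 = σ' 2 := hfr _ (by rfl)
    have hκk : κ k = σ aSupply k := if_pos hk
    have key2 := Stmt.run_rep (x := rCopy) (c := 1) (P := Alg.launch) (σ := τ)
      (fun c τ => Cleared G.m A κ
        (fun j => if j < k then κ j else if j = k then min c (κ k) else 0) τ) ?_ ?_
    · rw [d2, hE.m] at key2
      have : (fun j => if j < k then κ j else if j = k then min G.m (κ k) else 0) =
          fun j => if j < k + 1 then κ j else 0 := by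
        funext j
        rcases lt_trichotomy j k with hj | hj | hj
        · rw [if_pos hj, if_pos (by omega)]
        · rw [if_neg (by omega), if_pos hj, if_pos (by omega), hj]
          exact min_eq_right (by rw [hκk]; exact hm k hk)
        · rw [if_neg (by omega), if_neg (by omega), if_neg (by omega)]
      rw [this] at key2
      simpa [Cleared, Memory.store_apply] using key2
    · have : (fun j => if j < k then κ j else if j = k then min 0 (κ k) else 0) =
          fun j => if j < k then κ j else 0 := by
        funext j
        simp
      rw [this]
      simpa [Cleared, Memory.store_apply] using hI
    · intro c τ' hc' hx' hfr' hI'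
      have hEτ : Env G τ' := hE.congr ((hfr' _ (by rfl)).trans (hfr _ (by rfl)))
        ((hfr' _ (by rfl)).trans (hfr _ (by rfl))) ((hfr' _ (by rfl)).trans (hfr _ (by rfl)))
        ((hfr' _ (by rfl)).trans (hfr _ (by rfl)))
      have hA' : adj G.m τ' = A := adj_congr
        ((hfr' _ (by rfl)).trans ((hfr _ (by rfl)).trans c1))
        ((hfr' _ (by rfl)).trans ((hfr _ (by rfl)).trans c2)) _
      have hs : τ' aSupply = σ aSupply := (hfr' _ (by rfl)).trans ((hfr _ (by rfl)).trans c3)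
      have hi : τ' rItem 0 = k := by rw [hfr' _ (by rfl)]; exact hx
      rw [← hA'] at hI'
      have hupd : (if c < κ k then Function.update
            (fun j => if j < k then κ j else if j = k then min c (κ k) else 0) k
            ((fun j => if j < k then κ j else if j = k then min c (κ k) else 0) k + 1)
          else fun j => if j < k then κ j else if j = k then min c (κ k) else 0) =
          fun j => if j < k then κ j else if j = k then min (c + 1) (κ k) else 0 := by
        by_cases h1 : c < κ k
        · rw [if_pos h1]
          funext j
          rcases eq_or_ne j k with rfl | hj
          · simp
            omega
          · simp [hj]
        · rw [if_neg h1]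
          have : min c (κ k) = min (c + 1) (κ k) := by omega
          simp only [this]
      have hle : ∀ j, (if j < k then κ j else if j = k then min (c + 1) (κ k) else 0) ≤ κ j := by
        intro j
        split_ifs with h1 h2
        · exact le_rfl
        · rw [h2]; exact min_le_right _ _
        · exact Nat.zero_le _
      have := run_launch hEτ hi hx' (κ := κ) (by
        intro hlt j
        rw [hs, ← hκk] at hlt
        rw [if_pos hlt] at hupd
        rw [hupd]
        exact hle j) hI'
      rw [hs, ← hκk, hupd, hA'] at this
      simpa [Cleared, Memory.store_apply] using this

/-! ### Correctness of the greedy algorithm -/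

/-- The state of the greedy algorithm after `c` copies of item `i` have been considered. -/
structure Greedy (m : ℕ) (A : ℕ → ℕ → Prop) (C : ℕ → ℕ) (lo hi i c : ℕ) (κ : ℕ → ℕ) : Prop where
  matched : ∃ f, Matches m A κ f
  le : ∀ j, κ j ≤ m ∧ κ j ≤ C j
  current_le : κ i ≤ c
  -- Keeps Hall violators found at item `i` free of later items, as required in `Matches.tight`.
  later : ∀ j, i < j → κ j = 0
  active : ∀ j, κ j ≠ 0 → lo ≤ j ∧ j < hi
  tight : ∀ j < i, lo ≤ j → j < hi → κ j = min m (C j) ∨ Tight m A κ j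
  current : κ i = min c (C i) ∨ Tight m A κ i

theorem Greedy.start (m : ℕ) (A : ℕ → ℕ → Prop) (C : ℕ → ℕ) (lo hi : ℕ) :
    Greedy m A C lo hi 0 0 fun _ => 0 where
  matched := ⟨fun _ => 0, by simp, by simp [count]⟩
  le := by simp
  current_le := by simp
  later := by simp
  active := by simp
  tight := by simp
  current := by simp

theorem Greedy.next {m : ℕ} {A : ℕ → ℕ → Prop} {C : ℕ → ℕ} {lo hi i : ℕ} {κ : ℕ → ℕ}
    (h : Greedy m A C lo hi i m κ) : Greedy m A C lo hi (i + 1) 0 κ where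
  matched := h.matched
  le := h.le
  current_le := (h.later _ (by omega)).le
  later j hj := h.later j (by omega)
  active := h.active
  tight j hj h1 h2 := by
    rcases Nat.lt_succ_iff_lt_or_eq.1 hj with hlt | rfl
    · exact h.tight j hlt h1 h2
    · exact h.current
  current := by simp [h.later (i + 1) (by omega)]

theorem Greedy.pass {m : ℕ} {A : ℕ → ℕ → Prop} {C : ℕ → ℕ} {lo hi i : ℕ} {κ : ℕ → ℕ}
    (h : Greedy m A C lo hi i 0 κ) (hout : ¬ (lo ≤ i ∧ i < hi)) :
    Greedy m A C lo hi (i + 1) 0 κ where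
  matched := h.matched
  le := h.le
  current_le := (h.later _ (by omega)).le
  later j hj := h.later j (by omega)
  active := h.active
  tight j hj h1 h2 := by
    rcases Nat.lt_succ_iff_lt_or_eq.1 hj with hlt | rfl
    · exact h.tight j hlt h1 h2
    · exact absurd ⟨h1, h2⟩ hout
  current := by simp [h.later (i + 1) (by omega)]

theorem Greedy.exhausted {m : ℕ} {A : ℕ → ℕ → Prop} {C : ℕ → ℕ} {lo hi i c : ℕ} {κ : ℕ → ℕ}
    (h : Greedy m A C lo hi i c κ) (hc : C i ≤ c) : Greedy m A C lo hi i (c + 1) κ :=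
  { h with
    current_le := h.current_le.trans (by omega)
    current := by
      rcases h.current with h1 | h1
      · left; omega
      · exact Or.inr h1 }

theorem Greedy.accept {m : ℕ} {A : ℕ → ℕ → Prop} {C : ℕ → ℕ} {lo hi i c : ℕ} {κ f : ℕ → ℕ}
    (h : Greedy m A C lo hi i c κ) (hm : c < m) (hc : c < C i) (h1 : lo ≤ i) (h2 : i < hi)
    (hf : Matches m A (Function.update κ i (κ i + 1)) f) :
    Greedy m A C lo hi i (c + 1) (Function.update κ i (κ i + 1)) := by
  have hcur := h.current_le
  have hmono : ∀ j, κ j ≤ Function.update κ i (κ i + 1) j := by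
    intro j
    rcases eq_or_ne j i with rfl | hj
    · simp
    · simp [hj]
  refine ⟨⟨f, hf⟩, fun j => ?_, by simpa using hcur, fun j hj => ?_, fun j hj => ?_,
    fun j hj h3 h4 => ?_, ?_⟩
  · rcases eq_or_ne j i with rfl | hj
    · simp; omega
    · simpa [hj] using h.le j
  · simpa [hj.ne'] using h.later j hj
  · rcases eq_or_ne j i with rfl | hji
    · exact ⟨h1, h2⟩
    · exact h.active j (by simpa [hji] using hj)
  · rcases h.tight j hj h3 h4 with h5 | h5
    · left; simpa [hj.ne] using h5
    · exact Or.inr (h5.mono hmono)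
  · rcases h.current with h5 | h5
    · left; simp; omega
    · exact Or.inr (h5.mono hmono)

theorem Greedy.reject {m : ℕ} {A : ℕ → ℕ → Prop} {C : ℕ → ℕ} {lo hi i c : ℕ} {κ : ℕ → ℕ}
    (h : Greedy m A C lo hi i c κ) (hv : Violated m A (Function.update κ i (κ i + 1))) :
    Greedy m A C lo hi i (c + 1) κ := by
  obtain ⟨R, h1, h2⟩ := hv
  obtain ⟨f, hf⟩ := h.matched
  exact { h with
    current_le := h.current_le.trans (by omega)
    current := Or.inr (hf.tight h.later h1 h2) }

theorem run_greedyStep {G : Market} {σ : Memory} (h : Env G σ) {i c lo up : ℕ}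
    (hi : σ rI 0 = i) (hc : σ rC 0 = c) (hin : i < G.n) (hcm : c < G.m) (h1 : lo ≤ i)
    (h2 : i < up) (hG : Greedy G.m (adj G.m σ) G.C lo up i c (supply G.n σ)) :
    Greedy G.m (adj G.m σ) G.C lo up i (c + 1) (supply G.n (Alg.greedyStep.run σ)) := by
  have hC := h.supply i hin
  unfold Alg.greedyStep
  by_cases hci : c < G.C i
  · rw [run_branch_pos (by simp [hi, hc, hC]; omega), run_seq, run_seq]
    set τ := (put aSupply (reg rI) (get aSupply (reg rI) + 1)).run σ with hτ
    have fr : ∀ a, a ≠ aSupply → τ a = σ a := fun a ha => by simp [hτ, Memory.store_apply, ha]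
    have hE : Env G τ := h.congr (fr _ (by decide)) (fr _ (by decide)) (fr _ (by decide))
      (fr _ (by decide))
    have hA : adj G.m τ = adj G.m σ := adj_congr (fr _ (by decide)) (fr _ (by decide)) _
    have hsi : τ aSupply = Function.update (σ aSupply) i (σ aSupply i + 1) := by
      simp [hτ, Memory.store_apply, hi]
    have hs : supply G.n τ = Function.update (supply G.n σ) i (supply G.n σ i + 1) := by
      funext j
      rcases eq_or_ne j i with rfl | hj
      · simp [supply, hsi, hin]
      · simp [supply, hsi, hj]
    have hle : ∀ j < G.n, τ aSupply j ≤ G.m := by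
      intro j hj
      rw [hsi]
      rcases eq_or_ne j i with rfl | hji
      · have := hG.current_le
        simp only [supply, if_pos hj] at this
        simp
        omega
      · have := (hG.le j).1
        simp only [supply, if_pos hj] at this
        simpa [hji] using this
    have g1 : Alg.auction.run τ aSupply = τ aSupply := run_of_not_writes (by rfl) τ
    have g2 : Alg.auction.run τ rI 0 = i := by
      rw [run_of_not_writes (by rfl), fr _ (by decide), hi]
    rcases run_auction hE hle with ⟨k1, k2⟩ | ⟨k1, k2⟩
    · rw [run_branch_neg (by simpa using k1), run_skip]
      rw [hA, hs] at k2
      have : supply G.n (Alg.auction.run τ) = supply G.n τ := by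
        funext j
        simp only [supply, g1]
      rw [this, hs]
      exact hG.accept hcm hci h1 h2 k2
    · rw [run_branch_pos (by simpa using k1)]
      rw [hA, hs] at k2
      have : supply G.n ((put aSupply (reg rI) (get aSupply (reg rI) - 1)).run
          (Alg.auction.run τ)) = supply G.n σ := by
        funext j
        rcases eq_or_ne j i with rfl | hj
        · simp [supply, Memory.store_apply, g1, g2, hsi]
        · simp [supply, Memory.store_apply, g1, g2, hsi, hj]
      rw [this]
      exact hG.reject k2
  · rw [run_branch_neg (by simp [hi, hc, hC]; omega), run_skip]
    exact hG.exhausted (by omega)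

theorem run_greedyItem {G : Market} {σ : Memory} (h : Env G σ) {i : ℕ} (hi : σ rI 0 = i)
    (hin : i < G.n)
    (hG : Greedy G.m (adj G.m σ) G.C (σ aCut 0) (σ aCut G.t) i 0 (supply G.n σ)) :
    Greedy G.m (adj G.m σ) G.C (σ aCut 0) (σ aCut G.t) (i + 1) 0
      (supply G.n (Alg.greedyItem.run σ)) := by
  unfold Alg.greedyItem
  by_cases h1 : σ aCut 0 ≤ i
  · rw [run_branch_pos (by simp [hi]; omega)]
    by_cases h2 : i < σ aCut G.t
    · rw [run_branch_pos (by simp [hi, h.t]; omega)]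
      have key := Stmt.run_rep (x := rC) (c := 1) (P := Alg.greedyStep) (σ := σ)
        (fun c τ => Greedy G.m (adj G.m σ) G.C (σ aCut 0) (σ aCut G.t) i c (supply G.n τ)) ?_ ?_
      · rw [h.m] at key
        exact key.next
      · have : supply G.n (σ.store rC 0 0) = supply G.n σ := by
          funext j; simp [supply, Memory.store_apply]
        rwa [this]
      · intro c τ hc hx hfr hI
        rw [h.m] at hc
        have hE : Env G τ := h.congr (hfr _ (by rfl)) (hfr _ (by rfl)) (hfr _ (by rfl))
          (hfr _ (by rfl))
        have hA : adj G.m τ = adj G.m σ := adj_congr (hfr _ (by rfl)) (hfr _ (by rfl)) _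
        rw [← hA] at hI ⊢
        have := run_greedyStep hE (by rw [hfr _ (by rfl), hi]) hx hin hc h1 h2 hI
        have hs : supply G.n ((Alg.greedyStep.run τ).store rC 0 (c + 1)) =
            supply G.n (Alg.greedyStep.run τ) := by
          funext j; simp [supply, Memory.store_apply]
        rwa [hs]
    · rw [run_branch_neg (by simp [hi, h.t]; omega)]
      exact hG.pass (by omega)
  · rw [run_branch_neg (by simp [hi]; omega)]
    exact hG.pass (by omega)

theorem run_greedy {G : Market} {σ : Memory} (h : Env G σ) :
    ∃ κ, Greedy G.m (adj G.m σ) G.C (σ aCut 0) (σ aCut G.t) G.n 0 κ ∧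
      Matches G.m (adj G.m σ) κ (Alg.greedy.run σ aMate) := by
  have key0 := Stmt.run_rep (x := rI) (c := 0) (P := put aSupply (reg rI) 0) (σ := σ)
    (fun k τ => ∀ i < k, τ aSupply i = 0) (by simp) (by
      intro k τ hk hx hfr hI i hi
      by_cases hik : i = k
      · simp [Memory.store_apply, hx, hik]
      · simpa [Memory.store_apply, hx, hik] using hI i (by omega))
  unfold Alg.greedy
  rw [run_seq, run_seq]
  set σ' := (rep rI 0 (put aSupply (reg rI) 0)).run σ with hσ'
  have fr : ∀ a, a ≠ aSupply → a ≠ rI → σ' a = σ a := fun a h1 h2 => by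
    rw [hσ']; exact run_of_not_writes (by simp [writes, h1, h2]) σ
  have hE : Env G σ' := h.congr (fr _ (by decide) (by decide)) (fr _ (by decide) (by decide))
    (fr _ (by decide) (by decide)) (fr _ (by decide) (by decide))
  have hA : adj G.m σ' = adj G.m σ :=
    adj_congr (fr _ (by decide) (by decide)) (fr _ (by decide) (by decide)) _
  have hcut : σ' aCut = σ aCut := fr _ (by decide) (by decide)
  rw [← hA, ← hcut]
  rw [h.n] at key0
  have key := Stmt.run_rep (x := rI) (c := 0) (P := Alg.greedyItem) (σ := σ')
    (fun i τ => Greedy G.m (adj G.m σ') G.C (σ' aCut 0) (σ' aCut G.t) i 0 (supply G.n τ)) ?_ ?_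
  · rw [hE.n] at key
    set τ := (rep rI 0 Alg.greedyItem).run σ' with hτ
    have hA' : adj G.m τ = adj G.m σ' :=
      adj_congr (run_of_not_writes (by rfl) _) (run_of_not_writes (by rfl) _) _
    refine ⟨supply G.n τ, key, ?_⟩
    have hEτ : Env G τ := hE.run _ (by rfl) (by rfl) (by rfl) (by rfl)
    rcases run_auction hEτ (fun j hj => by
      have := (key.le j).1
      rwa [supply, if_pos hj] at this) with ⟨-, k⟩ | ⟨-, k⟩
    · rwa [hA'] at k
    -- The final auction cannot fail: the accepted supply is matchable, so Hall's condition holds.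
    · obtain ⟨R, -, hR⟩ := k
      obtain ⟨f, hf⟩ := key.matched
      have := hf.sum_le_card_nbhd R
      rw [hA'] at hR
      omega
  · have : supply G.n (σ'.store rI 0 0) = fun _ => 0 := by
      funext j
      simp only [supply, Memory.store_apply, Nat.reduceEqDiff, if_false]
      split_ifs with hj
      · exact key0 j hj
      · rfl
    rw [this]
    exact Greedy.start _ _ _ _ _
  · intro k τ hk hx hfr hI
    rw [hE.n] at hk
    have hEτ : Env G τ := hE.congr (hfr _ (by rfl)) (hfr _ (by rfl)) (hfr _ (by rfl))
      (hfr _ (by rfl))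
    have hA' : adj G.m τ = adj G.m σ' := adj_congr (hfr _ (by rfl)) (hfr _ (by rfl)) _
    have hcut' : τ aCut = σ' aCut := hfr _ (by rfl)
    rw [← hA', ← hcut'] at hI ⊢
    have := run_greedyItem hEτ hx hk hI
    have hs : supply G.n ((Alg.greedyItem.run τ).store rI 0 (k + 1)) =
        supply G.n (Alg.greedyItem.run τ) := by
      funext j; simp [supply, Memory.store_apply]
    rwa [hs]

theorem run_evaluate {G : Market} {σ : Memory} (h : Env G σ) :
    Alg.evaluate.run σ rVal 0 = weight G.m (σ aCost) (σ aMate) := by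
  have key := Stmt.run_rep (x := rB) (c := 1) (P := branch (get aMate (reg rB))
      (set rVal (reg rVal + get aCost (get aMate (reg rB) - 1))) skip) (σ := (set rVal 0).run σ)
    (fun k τ => τ rVal 0 = weight k (σ aCost) (σ aMate)) (by simp [weight, Memory.store_apply]) (by
      intro k τ hk hx hfr hI
      have f1 : τ aCost = σ aCost := by rw [hfr _ (by rfl)]; simp [Memory.store_apply]
      have f2 : τ aMate = σ aMate := by rw [hfr _ (by rfl)]; simp [Memory.store_apply]
      have hw : weight (k + 1) (σ aCost) (σ aMate) = weight k (σ aCost) (σ aMate) +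
          if σ aMate k = 0 then 0 else σ aCost (σ aMate k - 1) := sum_range_succ _ _
      rw [hw]
      by_cases hb : σ aMate k = 0
      · rw [run_branch_neg (by simpa [f2, hx] using hb)]
        simp [Memory.store_apply, hI, hb]
      · rw [run_branch_pos (by simpa [f2, hx] using hb)]
        simp [Memory.store_apply, hI, hb, f1, f2, hx])
  have e2 : (set rVal 0).run σ 2 1 = G.m := by simp [Memory.store_apply, h.m]
  rw [e2] at key
  exact key

theorem run_block {G : Market} {σ : Memory} (h : Env G σ) {r c : ℕ} (hr : σ rBlock 0 = r)
    (hrR : r < G.R) (hc : σ rCode 0 = c) :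
    (∀ s ≤ G.t, Alg.block.run σ aCut s = code G.n c s) ∧
    (∀ i < G.n, Alg.block.run σ aLevel i = G.level r (code G.n c) i) ∧
    G.Valid r (code G.n c) (Alg.block.run σ aMate) ∧
    G.best r (code G.n c) = G.blockWeight r (code G.n c) (Alg.block.run σ aMate) ∧
    Alg.block.run σ rVal 0 = G.best r (code G.n c) := by
  unfold Alg.block
  rw [run_seq, run_seq, run_seq]
  have hcut := run_decode h
  have h1 : Env G (Alg.decode.run σ) := h.run _ (by rfl) (by rfl) (by rfl) (by rfl)
  have f1 : Alg.decode.run σ rBlock = σ rBlock := run_of_not_writes (by rfl) σ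
  generalize Alg.decode.run σ = σ₁ at hcut h1 f1
  rw [hc] at hcut
  have hlev := run_levels h1 (by rw [f1, hr]; exact hrR)
  rw [f1, hr, G.level_congr hcut] at hlev
  have h2 : Env G (Alg.levels.run σ₁) := h1.run _ (by rfl) (by rfl) (by rfl) (by rfl)
  have f2 : Alg.levels.run σ₁ aCut = σ₁ aCut := run_of_not_writes (by rfl) σ₁
  generalize Alg.levels.run σ₁ = σ₂ at hlev h2 f2
  obtain ⟨κ, hκ, hmate⟩ := run_greedy h2
  have h3 : Env G (Alg.greedy.run σ₂) := h2.run _ (by rfl) (by rfl) (by rfl) (by rfl)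
  have g1 : Alg.greedy.run σ₂ aCut = σ₂ aCut := run_of_not_writes (by rfl) σ₂
  have g2 : Alg.greedy.run σ₂ aLevel = σ₂ aLevel := run_of_not_writes (by rfl) σ₂
  have g3 : Alg.greedy.run σ₂ aCost = σ₂ aCost := run_of_not_writes (by rfl) σ₂
  generalize Alg.greedy.run σ₂ = σ₃ at h3 g1 g2 g3 hmate
  have hval := run_evaluate h3
  have k1 : Alg.evaluate.run σ₃ aCut = σ₃ aCut := run_of_not_writes (by rfl) σ₃
  have k2 : Alg.evaluate.run σ₃ aLevel = σ₃ aLevel := run_of_not_writes (by rfl) σ₃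
  have k3 : Alg.evaluate.run σ₃ aMate = σ₃ aMate := run_of_not_writes (by rfl) σ₃
  rw [k1, k2, k3, g1, g2, f2, hval, g3]
  rw [f2, hcut 0 (Nat.zero_le _), hcut _ le_rfl] at hκ
  set a := code G.n c with ha
  set f := σ₃ aMate with hf
  have han : a G.t ≤ G.n := code_le _ _ _
  have hact : ∀ b < G.m, f b ≠ 0 → a 0 ≤ f b - 1 ∧ f b - 1 < a G.t := by
    intro b hb hfb
    refine hκ.active _ ?_
    rw [← hmate.counts]
    exact (card_pos.2 ⟨b, mem_filter.2 ⟨mem_range.2 hb, by omega⟩⟩).ne'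
  have hadj : ∀ i < G.n, ∀ b < G.m, adj G.m σ₂ i b ↔ G.D (G.level r a i) ≤ G.W i b := by
    intro i hi b hb
    rw [adj, (hlev i hi).2, h2.value i hi b hb]
  have hvalid : G.Valid r a f := by
    refine ⟨fun b hb hfb => (hact b hb hfb).1, fun b hb hfb => (hact b hb hfb).2,
      fun b hb hfb => ?_, fun i => ?_⟩
    · have := (hact b hb hfb).2
      exact (hadj _ (by omega) b hb).1 (hmate.valid b hb hfb)
    · rw [hmate.counts]
      exact (hκ.le i).2
  -- Inside the block the prices decrease along the items, so domination on all prefixes implies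
  -- maximal weight.
  have hbest : G.best r a = G.blockWeight r a f := by
    refine G.best_eq hvalid fun f' hf' => ?_
    have hact' : ∀ b < G.m, f' b ≠ 0 → a 0 ≤ f' b - 1 ∧ f' b - 1 < a G.t := fun b hb hfb =>
      ⟨hf'.first b hb hfb, hf'.last b hb hfb⟩
    refine weight_le_of_dominates (lo := a 0) (hi := a G.t)
      (fun i j _ hij _ => h.antitone (G.level_mono r a hij)) hact hact' ?_
    refine hmate.dominates (C := G.C) (lo := a 0) (hi := a G.t)
      (fun i h4 h5 => hκ.tight i (by omega) h4 h5) (fun b hb hfb => ?_) hact' hf'.supply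
    have := (hact' b hb hfb).2
    exact (hadj _ (by omega) b hb).2 (hf'.affordable b hb hfb)
  refine ⟨hcut, fun i hi => (hlev i hi).1, hvalid, hbest, ?_⟩
  rw [hbest]
  refine sum_congr rfl fun b hb => ?_
  split_ifs with hfb
  · rfl
  · have := (hact b (mem_range.1 hb) hfb).2
    exact (hlev _ (by omega)).2

/-! ### The table of the dynamic program -/

/-- The best value of the first `c` codes whose first cut is `j`. -/
def supBelow (n : ℕ) (val : ℕ → ℕ) (c j : ℕ) : ℕ := {x ∈ range c | code n x 0 = j}.sup val

theorem supBelow_succ (n : ℕ) (val : ℕ → ℕ) (c j : ℕ) : supBelow n val (c + 1) j =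
    if code n c 0 = j then max (val c) (supBelow n val c j) else supBelow n val c j := by
  unfold supBelow
  rw [range_add_one, filter_insert]
  split_ifs with h
  · rw [sup_insert]
  · rfl

/-- The state of the table after the first `c` codes in a row. -/
structure RowState (n : ℕ) (val : ℕ → ℕ) (c : ℕ) (cur choice : ℕ → ℕ) : Prop where
  cur : ∀ j ≤ n, cur j = supBelow n val c j
  choice : ∀ j ≤ n, (∃ x < c, code n x 0 = j) →
    choice j < c ∧ code n (choice j) 0 = j ∧ val (choice j) = supBelow n val c j

theorem RowState.start (n : ℕ) (val cur choice : ℕ → ℕ) (h : ∀ j ≤ n, cur j = 0) :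
    RowState n val 0 cur choice where
  cur j hj := by simp [supBelow, h j hj]
  choice j hj := by simp

theorem RowState.improve {n : ℕ} {val : ℕ → ℕ} {c : ℕ} {cur choice : ℕ → ℕ}
    (h : RowState n val c cur choice) (hle : cur (code n c 0) ≤ val c) :
    RowState n val (c + 1) (Function.update cur (code n c 0) (val c))
      (Function.update choice (code n c 0) c) where
  cur j hj := by
    rw [supBelow_succ]
    by_cases hc : code n c 0 = j
    · rw [h.cur _ (hc ▸ hj), hc] at hle
      simp [hc, hle]
    · simp [hc, Ne.symm hc, h.cur j hj]
  choice j hj hex := by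
    rw [supBelow_succ]
    by_cases hc : code n c 0 = j
    · rw [h.cur _ (hc ▸ hj), hc] at hle
      simp [hc, hle]
    · obtain ⟨x, hx, hxj⟩ := hex
      have hne : x ≠ c := by rintro rfl; exact hc hxj
      obtain ⟨h1, h2, h3⟩ := h.choice j hj ⟨x, by omega, hxj⟩
      simp only [Function.update_of_ne (Ne.symm hc), if_neg hc]
      exact ⟨by omega, h2, h3⟩

theorem RowState.keep {n : ℕ} {val : ℕ → ℕ} {c : ℕ} {cur choice : ℕ → ℕ}
    (h : RowState n val c cur choice) (hlt : val c < cur (code n c 0)) :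
    RowState n val (c + 1) cur choice where
  cur j hj := by
    rw [supBelow_succ]
    by_cases hc : code n c 0 = j
    · rw [h.cur _ (hc ▸ hj), hc] at hlt
      rw [if_pos hc, h.cur j hj, max_eq_right hlt.le]
    · rw [if_neg hc, h.cur j hj]
  choice j hj hex := by
    rw [supBelow_succ]
    by_cases hc : code n c 0 = j
    · rw [h.cur _ (hc ▸ hj), hc] at hlt
      -- Without an earlier code of this first cut the entry would be the empty supremum `0`, and no
      -- value is smaller.
      have hex' : ∃ x < c, code n x 0 = j := by
        by_contra! hcon
        have : supBelow n val c j = 0 := by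
          unfold supBelow
          rw [filter_false_of_mem fun x hx => hcon x (mem_range.1 hx)]
          rfl
        omega
      obtain ⟨h1, h2, h3⟩ := h.choice j hj hex'
      rw [if_pos hc, max_eq_right hlt.le]
      exact ⟨by omega, h2, h3⟩
    · obtain ⟨x, hx, hxj⟩ := hex
      have hne : x ≠ c := by rintro rfl; exact hc hxj
      obtain ⟨h1, h2, h3⟩ := h.choice j hj ⟨x, by omega, hxj⟩
      rw [if_neg hc]
      exact ⟨by omega, h2, h3⟩

theorem RowState.isChoice {G : Market} {ρ : ℕ} {cur choice : ℕ → ℕ}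
    (h : RowState G.n (fun c => G.best (G.R - 1 - ρ) (code G.n c) + G.value ρ (code G.n c G.t))
      ((G.n + 1) ^ (G.t + 1)) cur choice) {j : ℕ} (hj : j ≤ G.n) :
    cur j = G.value (ρ + 1) j ∧ G.IsChoice ρ j (choice j) := by
  -- The constant cut vector `j`, which prices no item in the block, shows that some code has first
  -- cut `j`.
  obtain ⟨c, hc, hcode⟩ := exists_code G.n G.t (fun _ => j) (fun _ => hj) fun _ _ _ => le_rfl
  exact ⟨h.cur j hj, h.choice j hj ⟨c, hc, hcode 0 (Nat.zero_le _)⟩⟩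

theorem run_tableStep {G : Market} {σ : Memory} (h : Env G σ) {ρ c : ℕ} (hρ : σ rRow 0 = ρ)
    (hc : σ rCode 0 = c) (hr : σ rBlock 0 = G.R - 1 - ρ) (hρR : ρ < G.R)
    (hnext : ∀ j ≤ G.n, σ aNext j = G.value ρ j)
    (hS : RowState G.n (fun c => G.best (G.R - 1 - ρ) (code G.n c) + G.value ρ (code G.n c G.t)) c
      (σ aCur) fun j => σ aChoice ((G.n + 1) * ρ + j)) :
    RowState G.n (fun c => G.best (G.R - 1 - ρ) (code G.n c) + G.value ρ (code G.n c G.t)) (c + 1)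
      (Alg.tableStep.run σ aCur) (fun j => Alg.tableStep.run σ aChoice ((G.n + 1) * ρ + j)) ∧
    ∀ x < (G.n + 1) * ρ, Alg.tableStep.run σ aChoice x = σ aChoice x := by
  unfold Alg.tableStep
  rw [run_seq, run_seq]
  obtain ⟨h1, -, -, -, h5⟩ := run_block h hr (by omega) hc
  have f0 : Env G (Alg.block.run σ) := h.run _ (by rfl) (by rfl) (by rfl) (by rfl)
  have f1 : Alg.block.run σ aNext = σ aNext := run_of_not_writes (by rfl) σ
  have f2 : Alg.block.run σ aCur = σ aCur := run_of_not_writes (by rfl) σ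
  have f3 : Alg.block.run σ aChoice = σ aChoice := run_of_not_writes (by rfl) σ
  have f4 : Alg.block.run σ rRow = σ rRow := run_of_not_writes (by rfl) σ
  have f5 : Alg.block.run σ rCode = σ rCode := run_of_not_writes (by rfl) σ
  generalize Alg.block.run σ = τ at h1 h5 f0 f1 f2 f3 f4 f5
  set val := fun c => G.best (G.R - 1 - ρ) (code G.n c) + G.value ρ (code G.n c G.t) with hval
  have ha0 := h1 0 (Nat.zero_le _)
  have hat := h1 G.t le_rfl
  have hv : τ rVal 0 + τ aNext (τ aCut (τ 2 4)) = val c := by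
    rw [h5, f0.t, hat, f1, hnext _ (code_le _ _ _)]
  by_cases hle : σ aCur (code G.n c 0) ≤ val c
  · rw [run_branch_pos (by
      simp [Memory.store_apply, hv, ha0, f2, Nat.sub_eq_zero_iff_le]; omega)]
    have himp := hS.improve hle
    have hidx : ∀ j, (G.n + 1) * ρ + j = (G.n + 1) * ρ + code G.n c 0 ↔ j = code G.n c 0 := by
      intro j; omega
    constructor
    · convert himp using 1
      · simp [Memory.store_apply, hv, ha0, f2]
      · funext j
        simp [Memory.store_apply, ha0, f3, f4, f5, f0.n_succ, hρ, hc, Function.update_apply]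
    · intro x hx
      have : x ≠ (G.n + 1) * ρ + code G.n c 0 := by omega
      simp [Memory.store_apply, ha0, f3, f4, f0.n_succ, hρ, this]
  · rw [run_branch_neg (by
      simp [Memory.store_apply, hv, ha0, f2]; omega)]
    constructor
    · simpa [Memory.store_apply, f2, f3] using hS.keep (not_le.1 hle)
    · simp [Memory.store_apply, f3]

theorem run_tableRow {G : Market} {σ : Memory} (h : Env G σ) {ρ : ℕ} (hρ : σ rRow 0 = ρ)
    (hρR : ρ < G.R) (hnext : ∀ j ≤ G.n, σ aNext j = G.value ρ j) :
    (∀ j ≤ G.n, Alg.tableRow.run σ aNext j = G.value (ρ + 1) j) ∧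
    (∀ j ≤ G.n, G.IsChoice ρ j (Alg.tableRow.run σ aChoice ((G.n + 1) * ρ + j))) ∧
    ∀ x < (G.n + 1) * ρ, Alg.tableRow.run σ aChoice x = σ aChoice x := by
  unfold Alg.tableRow
  rw [run_seq, run_seq, run_seq]
  have key0 := Stmt.run_rep (x := rJ) (c := 6) (P := put aCur (reg rJ) 0) (σ := σ)
    (fun k τ => ∀ j < k, τ aCur j = 0) (by simp) (by
      intro k τ hk hx hfr hI i hi
      by_cases hik : i = k
      · simp [Memory.store_apply, hx, hik]
      · simpa [Memory.store_apply, hx, hik] using hI i (by omega))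
  rw [h.n_succ] at key0
  have f : ∀ a, a ≠ aCur → a ≠ rJ → (rep rJ 6 (put aCur (reg rJ) 0)).run σ a = σ a :=
    fun a h1 h2 => run_of_not_writes (by simp [writes, h1, h2]) σ
  generalize (rep rJ 6 (put aCur (reg rJ) 0)).run σ = σ₁ at key0 f
  set σ₂ := (set rBlock (lim 9 - 1 - reg rRow)).run σ₁ with hσ₂
  have g : ∀ a, a ≠ rBlock → a ≠ aCur → a ≠ rJ → σ₂ a = σ a := fun a h1 h2 h3 => by
    simp [hσ₂, Memory.store_apply, h1, f a h2 h3]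
  have hE : Env G σ₂ := h.congr (g _ (by decide) (by decide) (by decide))
    (g _ (by decide) (by decide) (by decide)) (g _ (by decide) (by decide) (by decide))
    (g _ (by decide) (by decide) (by decide))
  have hblock : σ₂ rBlock 0 = G.R - 1 - ρ := by
    have e1 := f 2 (by decide) (by decide)
    have e2 := f rRow (by decide) (by decide)
    simp [hσ₂, Memory.store_apply, e1, e2, hρ, h.blocks]
  have hcur : ∀ j ≤ G.n, σ₂ aCur j = 0 := by
    intro j hj
    simpa [hσ₂, Memory.store_apply] using key0 j (by omega)
  have hn2 : σ₂ aNext = σ aNext := g _ (by decide) (by decide) (by decide)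
  have hc2 : σ₂ aChoice = σ aChoice := g _ (by decide) (by decide) (by decide)
  have hr2 : σ₂ rRow 0 = ρ := by rw [g _ (by decide) (by decide) (by decide), hρ]
  have key := Stmt.run_rep (x := rCode) (c := 8) (P := Alg.tableStep) (σ := σ₂)
    (fun c τ => RowState G.n
      (fun c => G.best (G.R - 1 - ρ) (code G.n c) + G.value ρ (code G.n c G.t)) c
      (τ aCur) (fun j => τ aChoice ((G.n + 1) * ρ + j)) ∧
      ∀ x < (G.n + 1) * ρ, τ aChoice x = σ aChoice x) ?_ ?_
  · rw [hE.codes] at key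
    obtain ⟨k1, k2⟩ := key
    have hn3 : (rep rCode 8 Alg.tableStep).run σ₂ 2 6 = G.n + 1 := by
      rw [run_of_not_writes (by rfl)]; exact hE.n_succ
    generalize (rep rCode 8 Alg.tableStep).run σ₂ = σ₃ at k1 k2 hn3
    have key3 := Stmt.run_rep (x := rJ) (c := 6) (P := put aNext (reg rJ) (get aCur (reg rJ)))
      (σ := σ₃) (fun k τ => ∀ j < k, τ aNext j = σ₃ aCur j) (by simp) (by
        intro k τ hk hx hfr hI i hi
        have e : τ aCur = σ₃ aCur := hfr _ (by rfl)
        by_cases hik : i = k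
        · simp [Memory.store_apply, hx, hik, e]
        · simpa [Memory.store_apply, hx, hik] using hI i (by omega))
    rw [hn3] at key3
    have e : (rep rJ 6 (put aNext (reg rJ) (get aCur (reg rJ)))).run σ₃ aChoice = σ₃ aChoice :=
      run_of_not_writes (by rfl) σ₃
    rw [e]
    refine ⟨fun j hj => ?_, fun j hj => (k1.isChoice hj).2, k2⟩
    rw [key3 j (by omega)]
    exact (k1.isChoice hj).1
  · constructor
    · refine RowState.start _ _ _ _ fun j hj => ?_
      simpa [Memory.store_apply] using hcur j hj
    · intro x _
      simp [Memory.store_apply, hc2]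
  · rintro c τ hc hx hfr ⟨hI1, hI2⟩
    have hEτ : Env G τ := hE.congr (hfr _ (by rfl)) (hfr _ (by rfl)) (hfr _ (by rfl))
      (hfr _ (by rfl))
    obtain ⟨k1, k2⟩ := run_tableStep hEτ (by rw [hfr _ (by rfl)]; exact hr2) hx
      (by rw [hfr _ (by rfl)]; exact hblock) hρR
      (by rw [hfr _ (by rfl), hn2]; exact hnext) hI1
    constructor
    · simpa [Memory.store_apply] using k1
    · intro x hx'
      simpa [Memory.store_apply, hI2 x hx'] using k2 x hx'

/-- Rows occupy disjoint stretches of `n + 1` cells of `aChoice`, so later rows leave the recorded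
choices intact for the reconstruction. -/
theorem run_table {G : Market} {σ : Memory} (h : Env G σ) :
    ∀ ρ < G.R, ∀ j ≤ G.n, G.IsChoice ρ j (Alg.table.run σ aChoice ((G.n + 1) * ρ + j)) := by
  unfold Alg.table
  rw [run_seq]
  have key0 := Stmt.run_rep (x := rJ) (c := 6) (P := put aNext (reg rJ) 0) (σ := σ)
    (fun k τ => ∀ j < k, τ aNext j = 0) (by simp) (by
      intro k τ hk hx hfr hI i hi
      by_cases hik : i = k
      · simp [Memory.store_apply, hx, hik]
      · simpa [Memory.store_apply, hx, hik] using hI i (by omega))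
  rw [h.n_succ] at key0
  have hE : Env G ((rep rJ 6 (put aNext (reg rJ) 0)).run σ) :=
    h.run _ (by rfl) (by rfl) (by rfl) (by rfl)
  generalize (rep rJ 6 (put aNext (reg rJ) 0)).run σ = σ₁ at key0 hE
  have key := Stmt.run_rep (x := rRow) (c := 9) (P := Alg.tableRow) (σ := σ₁)
    (fun k τ => (∀ j ≤ G.n, τ aNext j = G.value k j) ∧
      ∀ ρ < k, ∀ j ≤ G.n, G.IsChoice ρ j (τ aChoice ((G.n + 1) * ρ + j))) ?_ ?_
  · rw [hE.blocks] at key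
    exact key.2
  · refine ⟨fun j hj => ?_, by simp⟩
    simpa [Memory.store_apply, Market.value] using key0 j (by omega)
  · rintro k τ hk hx hfr ⟨hI1, hI2⟩
    rw [hE.blocks] at hk
    have hEτ : Env G τ := hE.congr (hfr _ (by rfl)) (hfr _ (by rfl)) (hfr _ (by rfl))
      (hfr _ (by rfl))
    obtain ⟨k1, k2, k3⟩ := run_tableRow hEτ hx hk hI1
    refine ⟨fun j hj => by simpa [Memory.store_apply] using k1 j hj, fun ρ hρ j hj => ?_⟩
    simp only [Memory.store_apply, Nat.reduceEqDiff, if_false]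
    rcases Nat.lt_succ_iff_lt_or_eq.1 hρ with hlt | rfl
    · rw [k3]
      · exact hI2 ρ hlt j hj
      · have : (G.n + 1) * (ρ + 1) ≤ (G.n + 1) * k := Nat.mul_le_mul_left _ hlt
        rw [Nat.mul_add] at this
        omega
    · exact k2 j hj

/-! ### Reconstruction of an optimal plan -/

theorem index_inj {m i i' b b' : ℕ} (hb : b < m) (hb' : b' < m) :
    m * i + b = m * i' + b' ↔ i = i' ∧ b = b' := by
  constructor
  · intro h
    have hm : 0 < m := by omega
    have h1 : (m * i + b) / m = i := by rw [Nat.mul_add_div hm, Nat.div_eq_of_lt hb, add_zero]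
    have h2 : (m * i' + b') / m = i' := by rw [Nat.mul_add_div hm, Nat.div_eq_of_lt hb', add_zero]
    have : i = i' := by rw [← h1, ← h2, h]
    subst this
    exact ⟨rfl, by omega⟩
  · rintro ⟨rfl, rfl⟩
    rfl

theorem run_storeLevels {G : Market} {σ : Memory} (h : Env G σ) :
    ∀ i < G.n, Alg.storeLevels.run σ aFinal i =
      if σ aCut 0 ≤ i ∧ i < σ aCut G.t then σ aLevel i else σ aFinal i := by
  have key := Stmt.run_rep (x := rJ) (c := 0) (P := branch (reg rJ + 1 - get aCut 0)
      (branch (get aCut (lim 4) - reg rJ) (put aFinal (reg rJ) (get aLevel (reg rJ))) skip) skip)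
    (σ := σ) (fun k τ => ∀ i, τ aFinal i =
      if i < k ∧ σ aCut 0 ≤ i ∧ i < σ aCut G.t then σ aLevel i else σ aFinal i)
    (by simp [Memory.store_apply]) (by
      intro k τ hk hx hfr hI i
      have f1 : τ aCut = σ aCut := hfr _ (by rfl)
      have f2 : τ aLevel = σ aLevel := hfr _ (by rfl)
      have f3 : τ 2 4 = G.t := by rw [hfr _ (by rfl), h.t]
      have hne : ∀ {p : Prop}, i ≠ k → ((i < k + 1 ∧ p) ↔ (i < k ∧ p)) := by
        intro p hik
        constructor
        · rintro ⟨h1, h2⟩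
          exact ⟨by omega, h2⟩
        · rintro ⟨h1, h2⟩
          exact ⟨by omega, h2⟩
      have stay : ¬ (σ aCut 0 ≤ k ∧ k < σ aCut G.t) → τ aFinal i =
          if i < k + 1 ∧ σ aCut 0 ≤ i ∧ i < σ aCut G.t then σ aLevel i else σ aFinal i := by
        intro hout
        rw [hI i]
        rcases eq_or_ne i k with rfl | hik
        · rw [if_neg (by omega), if_neg (by tauto)]
        · simp only [hne hik]
      by_cases h1 : σ aCut 0 ≤ k
      · rw [run_branch_pos (by simp [hx, f1]; omega)]
        by_cases h2 : k < σ aCut G.t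
        · rw [run_branch_pos (by simp [hx, f1, f3]; omega)]
          rcases eq_or_ne i k with rfl | hik
          · simp [Memory.store_apply, hx, f2, h1, h2]
          · simp only [hne hik, ← hI i]
            simp [Memory.store_apply, hx, hik]
        · rw [run_branch_neg (by simp [hx, f1, f3]; omega)]
          simpa [Memory.store_apply] using stay (by tauto)
      · rw [run_branch_neg (by simp [hx, f1]; omega)]
        simpa [Memory.store_apply] using stay (by tauto))
  rw [h.n] at key
  intro i hi
  simpa [hi, Alg.storeLevels] using key i

theorem run_storeMates {G : Market} {σ : Memory} (h : Env G σ) :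
    ∀ i, ∀ b < G.m, Alg.storeMates.run σ aOut (2 * G.n + (G.m * i + b)) =
      if σ aMate b = i + 1 then 1 else σ aOut (2 * G.n + (G.m * i + b)) := by
  have key := Stmt.run_rep (x := rJ) (c := 1) (P := branch (get aMate (reg rJ))
      (put aOut (lim 0 + lim 0 + (lim 1 * (get aMate (reg rJ) - 1) + reg rJ)) 1) skip)
    (σ := σ) (fun k τ => ∀ i, ∀ b < G.m, τ aOut (2 * G.n + (G.m * i + b)) =
      if b < k ∧ σ aMate b = i + 1 then 1 else σ aOut (2 * G.n + (G.m * i + b)))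
    (by simp [Memory.store_apply]) (by
      intro k τ hk hx hfr hI i b hb
      rw [h.m] at hk
      have f1 : τ aMate = σ aMate := hfr _ (by rfl)
      have f2 : τ 2 0 = G.n := by rw [hfr _ (by rfl), h.n]
      have f3 : τ 2 1 = G.m := by rw [hfr _ (by rfl), h.m]
      by_cases h1 : σ aMate k = 0
      · rw [run_branch_neg (by simp [hx, f1, h1])]
        simp only [run_skip, Memory.store_apply, Nat.reduceEqDiff, if_false]
        rw [hI i b hb]
        rcases eq_or_ne b k with rfl | hbk
        · rw [if_neg (by omega), if_neg (by omega)]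
        · congr 1
          simp only [eq_iff_iff]
          constructor
          · rintro ⟨h2, h3⟩; exact ⟨by omega, h3⟩
          · rintro ⟨h2, h3⟩; exact ⟨by omega, h3⟩
      · rw [run_branch_pos (by simp [hx, f1, h1])]
        have hidx : 2 * G.n + (G.m * i + b) = G.n + G.n + (G.m * (σ aMate k - 1) + k) ↔
            σ aMate k = i + 1 ∧ b = k := by
          rw [two_mul, Nat.add_left_cancel_iff, index_inj hb hk]
          omega
        simp only [run_put, value_add, value_mul, value_sub, value_get, value_reg, value_lim,
          value_ofNat, Memory.store_apply, Nat.reduceEqDiff, if_false, if_true, f1, f2, f3, hx,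
          Function.update_apply, hidx]
        rcases eq_or_ne b k with rfl | hbk
        · by_cases h2 : σ aMate b = i + 1
          · simp [h2]
          · rw [if_neg (by tauto), if_neg (by tauto), hI i b hb, if_neg (by tauto)]
        · rw [if_neg (by tauto), hI i b hb]
          congr 1
          simp only [eq_iff_iff]
          constructor
          · rintro ⟨h2, h3⟩; exact ⟨by omega, h3⟩
          · rintro ⟨h2, h3⟩; exact ⟨by omega, h3⟩)
  rw [h.m] at key
  intro i b hb
  simpa [hb, Alg.storeMates] using key i b hb

/-- The part of the output that describes the allocation. -/
def allocated (G : Market) (σ : Memory) (i b : ℕ) : ℕ := σ aOut (2 * G.n + (G.m * i + b))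

theorem run_reconstructStep {G : Market} {σ : Memory} (h : Env G σ) {r : ℕ} (hr : σ rRow 0 = r)
    (hrR : r < G.R)
    (hch : ∀ ρ < G.R, ∀ j ≤ G.n, G.IsChoice ρ j (σ aChoice ((G.n + 1) * ρ + j)))
    (hP : G.IsPartial r (σ rFirst 0) (σ aFinal) (allocated G σ)) :
    G.IsPartial (r + 1) (Alg.reconstructStep.run σ rFirst 0) (Alg.reconstructStep.run σ aFinal)
      (allocated G (Alg.reconstructStep.run σ)) ∧
    ∀ i, ∀ b < G.m, allocated G (Alg.reconstructStep.run σ) i b = 1 ∨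
      allocated G (Alg.reconstructStep.run σ) i b = allocated G σ i b := by
  unfold Alg.reconstructStep
  simp only [run_seq]
  set σ₁ := (set rCode (get aChoice (lim 6 * (lim 9 - 1 - reg rRow) + reg rFirst))).run
    ((set rBlock (reg rRow)).run σ) with hσ₁
  have g : ∀ a, a ≠ rBlock → a ≠ rCode → σ₁ a = σ a := fun a h1 h2 => by
    simp [hσ₁, Memory.store_apply, h1, h2]
  have hE₁ : Env G σ₁ := h.congr (g _ (by decide) (by decide)) (g _ (by decide) (by decide))
    (g _ (by decide) (by decide)) (g _ (by decide) (by decide))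
  have hblock : σ₁ rBlock 0 = r := by simp [hσ₁, Memory.store_apply, hr]
  set c := σ aChoice ((G.n + 1) * (G.R - 1 - r) + σ rFirst 0) with hc
  have hcode : σ₁ rCode 0 = c := by
    simp [hσ₁, Memory.store_apply, hr, h.n_succ, h.blocks, hc]
  have hfinal : σ₁ aFinal = σ aFinal := g _ (by decide) (by decide)
  have hout : σ₁ aOut = σ aOut := g _ (by decide) (by decide)
  obtain ⟨b1, b2, b3, b4, -⟩ := run_block hE₁ hblock hrR hcode
  have hE₂ : Env G (Alg.block.run σ₁) := hE₁.run _ (by rfl) (by rfl) (by rfl) (by rfl)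
  have f1 : Alg.block.run σ₁ aFinal = σ₁ aFinal := run_of_not_writes (by rfl) σ₁
  have f2 : Alg.block.run σ₁ aOut = σ₁ aOut := run_of_not_writes (by rfl) σ₁
  generalize Alg.block.run σ₁ = σ₂ at b1 b2 b3 b4 hE₂ f1 f2
  have hl := run_storeLevels hE₂
  have hE₃ : Env G (Alg.storeLevels.run σ₂) := hE₂.run _ (by rfl) (by rfl) (by rfl) (by rfl)
  have k1 : Alg.storeLevels.run σ₂ aMate = σ₂ aMate := run_of_not_writes (by rfl) σ₂
  have k2 : Alg.storeLevels.run σ₂ aOut = σ₂ aOut := run_of_not_writes (by rfl) σ₂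
  have k3 : Alg.storeLevels.run σ₂ aCut = σ₂ aCut := run_of_not_writes (by rfl) σ₂
  generalize Alg.storeLevels.run σ₂ = σ₃ at hl hE₃ k1 k2 k3
  have hm := run_storeMates hE₃
  have l1 : Alg.storeMates.run σ₃ aFinal = σ₃ aFinal := run_of_not_writes (by rfl) σ₃
  have l2 : Alg.storeMates.run σ₃ aCut = σ₃ aCut := run_of_not_writes (by rfl) σ₃
  have l3 : Alg.storeMates.run σ₃ 2 = σ₃ 2 := run_of_not_writes (by rfl) σ₃
  generalize Alg.storeMates.run σ₃ = σ₄ at hm l1 l2 l3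
  rw [k1, k2, f2, hout] at hm
  set σ₅ := (set rFirst (get aCut (lim 4))).run σ₄ with hσ₅
  have m1 : σ₅ aFinal = σ₃ aFinal := by simp [hσ₅, Memory.store_apply, l1]
  have m2 : σ₅ aOut = σ₄ aOut := by simp [hσ₅, Memory.store_apply]
  have m3 : σ₅ rFirst 0 = code G.n c G.t := by
    simp [hσ₅, Memory.store_apply, l2, l3, hE₃.t, k3, b1 _ le_rfl]
  -- The table was filled from the last block backwards, so block `r` belongs to row `G.R - 1 - r`.
  have hchoice := hch (G.R - 1 - r) (by omega) (σ rFirst 0) hP.le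
  have hA : ∀ i, ∀ b < G.m, allocated G σ₅ i b =
      if σ₂ aMate b = i + 1 then 1 else allocated G σ i b := by
    intro i b hb
    unfold allocated
    rw [m2]
    exact hm i b hb
  constructor
  · rw [m3, m1]
    refine hP.step h.t_pos hrR hchoice b3 b4 (fun i hi => ?_) fun i hi b hb => hA i b hb
    rw [hl i hi, b1 0 (Nat.zero_le _), b1 _ le_rfl, b2 i hi, f1, hfinal, hchoice.2.1]
  · intro i b hb
    rw [hA i b hb]
    split_ifs
    · exact Or.inl rfl
    · exact Or.inr rfl

theorem run_reconstruct {G : Market} {σ : Memory} (h : Env G σ)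
    (hch : ∀ ρ < G.R, ∀ j ≤ G.n, G.IsChoice ρ j (σ aChoice ((G.n + 1) * ρ + j)))
    (hout : ∀ i < G.n, ∀ b < G.m, allocated G σ i b = 0) :
    G.IsPlan (Alg.reconstruct.run σ aFinal) (allocated G (Alg.reconstruct.run σ)) ∧
    G.profit (Alg.reconstruct.run σ aFinal) (allocated G (Alg.reconstruct.run σ)) =
      G.value G.R 0 ∧
    (∀ i < G.n, Alg.reconstruct.run σ aFinal i ≤ G.R * G.t) ∧
    ∀ i < G.n, ∀ b < G.m, allocated G (Alg.reconstruct.run σ) i b = 0 ∨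
      allocated G (Alg.reconstruct.run σ) i b = 1 := by
  unfold Alg.reconstruct
  simp only [run_seq]
  have key0 := Stmt.run_rep (x := rJ) (c := 0) (P := put aFinal (reg rJ) (lim 10)) (σ := σ)
    (fun k τ => ∀ j < k, τ aFinal j = G.R * G.t) (by simp) (by
      intro k τ hk hx hfr hI i hi
      have e : τ 2 10 = G.R * G.t := by rw [hfr _ (by rfl), h.levels]
      by_cases hik : i = k
      · simp [Memory.store_apply, hx, hik, e]
      · simpa [Memory.store_apply, hx, hik] using hI i (by omega))
  rw [h.n] at key0
  have f : ∀ a, a ≠ aFinal → a ≠ rJ → (rep rJ 0 (put aFinal (reg rJ) (lim 10))).run σ a = σ a :=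
    fun a h1 h2 => run_of_not_writes (by simp [writes, h1, h2]) σ
  generalize (rep rJ 0 (put aFinal (reg rJ) (lim 10))).run σ = σ₁ at key0 f
  set σ₂ := (set rFirst 0).run σ₁ with hσ₂
  have g : ∀ a, a ≠ aFinal → a ≠ rJ → a ≠ rFirst → σ₂ a = σ a := fun a h1 h2 h3 => by
    simp [hσ₂, Memory.store_apply, h3, f a h1 h2]
  have hE : Env G σ₂ := h.congr (g _ (by decide) (by decide) (by decide))
    (g _ (by decide) (by decide) (by decide)) (g _ (by decide) (by decide) (by decide))
    (g _ (by decide) (by decide) (by decide))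
  have hfin : σ₂ aFinal = σ₁ aFinal := by simp [hσ₂, Memory.store_apply]
  have hfirst : σ₂ rFirst 0 = 0 := by simp [hσ₂, Memory.store_apply]
  have hout2 : σ₂ aOut = σ aOut := g _ (by decide) (by decide) (by decide)
  have hch2 : σ₂ aChoice = σ aChoice := g _ (by decide) (by decide) (by decide)
  have key := Stmt.run_rep (x := rRow) (c := 9) (P := Alg.reconstructStep) (σ := σ₂)
    (fun r τ => G.IsPartial r (τ rFirst 0) (τ aFinal) (allocated G τ) ∧
      ∀ i < G.n, ∀ b < G.m, allocated G τ i b = 0 ∨ allocated G τ i b = 1) ?_ ?_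
  · rw [hE.blocks] at key
    obtain ⟨k1, k2⟩ := key
    obtain ⟨h1, h2⟩ := k1.isPlan
    refine ⟨h1, h2, fun i hi => ?_, k2⟩
    by_cases hij : i < (rep rRow 9 Alg.reconstructStep).run σ₂ rFirst 0
    · exact (k1.lt i hij).le
    · exact (k1.rest i (not_lt.1 hij) hi).le
  · have hz : ∀ i < G.n, ∀ b < G.m, allocated G (σ₂.store rRow 0 0) i b = 0 := by
      intro i hi b hb
      simpa [allocated, Memory.store_apply, hout2] using hout i hi b hb
    refine ⟨?_, fun i hi b hb => Or.inl (hz i hi b hb)⟩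
    have : (σ₂.store rRow 0 0) rFirst 0 = 0 := by simp [Memory.store_apply, hfirst]
    rw [this]
    refine Market.IsPartial.start (fun i hi => ?_) hz
    simpa [Memory.store_apply, hfin] using key0 i hi
  · rintro r τ hr hx hfr ⟨hI1, hI2⟩
    rw [hE.blocks] at hr
    have hEτ : Env G τ := hE.congr (hfr _ (by rfl)) (hfr _ (by rfl)) (hfr _ (by rfl))
      (hfr _ (by rfl))
    obtain ⟨k1, k2⟩ := run_reconstructStep hEτ hx hr
      (by rw [hfr _ (by rfl), hch2]; exact hch) hI1
    have e : allocated G ((Alg.reconstructStep.run τ).store rRow 0 (r + 1)) =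
        allocated G (Alg.reconstructStep.run τ) := by
      funext i b
      simp [allocated, Memory.store_apply]
    constructor
    · simpa [Memory.store_apply, e] using k1
    · intro i hi b hb
      rw [e]
      rcases k2 i b hb with h3 | h3
      · exact Or.inr h3
      · rw [h3]; exact hI2 i hi b hb

/-! ### Output of prices, scaling, and the largest value -/

theorem run_prices {G : Market} {σ : Memory} (h : Env G σ) :
    (∀ i < G.n, Alg.prices.run σ aOut (2 * i) = σ aPrice (σ aFinal i) ∧
      Alg.prices.run σ aOut (2 * i + 1) = σ rScale 0) ∧
    ∀ x, 2 * G.n ≤ x → Alg.prices.run σ aOut x = σ aOut x := by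
  have key := Stmt.run_rep (x := rJ) (c := 0)
    (P := put aOut (reg rJ + reg rJ) (get aPrice (get aFinal (reg rJ))) ;;
      put aOut (reg rJ + reg rJ + 1) (reg rScale)) (σ := σ)
    (fun k τ => (∀ i < k, τ aOut (2 * i) = σ aPrice (σ aFinal i) ∧
      τ aOut (2 * i + 1) = σ rScale 0) ∧ ∀ x, 2 * G.n ≤ x → τ aOut x = σ aOut x)
    (by simp [Memory.store_apply]) (by
      rintro k τ hk hx hfr ⟨hI1, hI2⟩
      rw [h.n] at hk
      have f1 : τ aPrice = σ aPrice := hfr _ (by rfl)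
      have f2 : τ aFinal = σ aFinal := hfr _ (by rfl)
      have f3 : τ rScale = σ rScale := hfr _ (by rfl)
      constructor
      · intro i hi
        by_cases hik : i = k
        · subst hik
          have h1 : 2 * i ≠ i + i + 1 := by omega
          have h2 : 2 * i = i + i := by omega
          simp [Memory.store_apply, hx, f1, f2, f3, h2]
        · have h1 : 2 * i ≠ k + k + 1 := by omega
          have h2 : 2 * i ≠ k + k := by omega
          have h3 : 2 * i + 1 ≠ k + k + 1 := by omega
          have h4 : 2 * i + 1 ≠ k + k := by omega
          simpa [Memory.store_apply, hx, Function.update_apply, h1, h2, h3, h4] using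
            hI1 i (by omega)
      · intro x hx'
        have h1 : x ≠ k + k + 1 := by omega
        have h2 : x ≠ k + k := by omega
        simpa [Memory.store_apply, hx, Function.update_apply, h1, h2] using hI2 x hx')
  rw [h.n] at key
  exact key

theorem run_scale {σ : Memory} {n m p q K : ℕ} (hn : σ 2 0 = n) (hm : σ 2 1 = m) (hp : σ 2 2 = p)
    (hq : σ 2 3 = q) (hK : σ 2 10 = K) (hp0 : 0 < p) :
    (∀ l ≤ K, Alg.scale.run σ aPrice l = σ rMax 0 * q ^ l * p ^ (K - l)) ∧
    Alg.scale.run σ rScale 0 = p ^ K ∧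
    ∀ i < n, ∀ b < m, Alg.scale.run σ aValue (m * i + b) =
      σ 0 (2 + n + (m * i + b)) * p ^ K := by
  simp only [Alg.scale, run_seq]
  set σ₁ := (set rScale 1).run ((put aPrice 0 (reg rMax)).run σ) with hσ₁
  have f1 : ∀ a, a ≠ aPrice → a ≠ rScale → σ₁ a = σ a := fun a h1 h2 => by
    simp [hσ₁, Memory.store_apply, h1, h2]
  have key1 := Stmt.run_rep (x := rI) (c := 10) (P := put aPrice 0 (lim 2 * get aPrice 0) ;;
      set rScale (lim 2 * reg rScale)) (σ := σ₁)
    (fun k τ => τ aPrice 0 = p ^ k * σ rMax 0 ∧ τ rScale 0 = p ^ k)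
    (by simp [hσ₁, Memory.store_apply]) (by
      rintro k τ hk hx hfr ⟨hI1, hI2⟩
      have e : τ 2 2 = p := by rw [hfr _ (by rfl), f1 _ (by decide) (by decide), hp]
      simp [Memory.store_apply, e, hI1, hI2, pow_succ']
      ring)
  rw [f1 2 (by decide) (by decide), hK] at key1
  have f2 : ∀ a, a ≠ aPrice → a ≠ rScale → a ≠ rI → (rep rI 10 (put aPrice 0
      (lim 2 * get aPrice 0) ;; set rScale (lim 2 * reg rScale))).run σ₁ a = σ a :=
    fun a h1 h2 h3 =>
      (run_of_not_writes (by simp [writes, Stmt.set, h1, h2, h3]) σ₁).trans (f1 a h1 h2)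
  generalize (rep rI 10 (put aPrice 0 (lim 2 * get aPrice 0) ;;
    set rScale (lim 2 * reg rScale))).run σ₁ = σ₂ at key1 f2
  have key2 := Stmt.run_rep (x := rI) (c := 10)
    (P := put aPrice (reg rI + 1) (lim 3 * get aPrice (reg rI) / lim 2)) (σ := σ₂)
    (fun k τ => ∀ l ≤ k, τ aPrice l = σ rMax 0 * q ^ l * p ^ (K - l))
    (by
      intro l hl
      obtain rfl : l = 0 := by omega
      simp [Memory.store_apply, key1.1, mul_comm]) (by
      intro k τ hk hx hfr hI l hl
      have e2 : τ 2 = σ 2 := by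
        rw [hfr _ (by rfl), f2 _ (by decide) (by decide) (by decide)]
      rw [f2 2 (by decide) (by decide) (by decide), hK] at hk
      by_cases hlk : l = k + 1
      · subst hlk
        have h1 := hI k le_rfl
        have h2 : K - k = K - (k + 1) + 1 := by omega
        have h3 : q * (σ rMax 0 * q ^ k * p ^ (K - k)) =
            p * (σ rMax 0 * q ^ (k + 1) * p ^ (K - (k + 1))) := by
          rw [h2]; ring
        simp [Memory.store_apply, hx, e2, hp, hq, h1, h3, Nat.mul_div_cancel_left _ hp0]
      · simpa [Memory.store_apply, hx, hlk] using hI l (by omega))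
  rw [f2 2 (by decide) (by decide) (by decide), hK] at key2
  have f3 : ∀ a, a ≠ aPrice → a ≠ rScale → a ≠ rI → (rep rI 10 (put aPrice (reg rI + 1)
      (lim 3 * get aPrice (reg rI) / lim 2))).run σ₂ a = σ a :=
    fun a h1 h2 h3 => (run_of_not_writes (by simp [writes, h1, h3]) σ₂).trans (f2 a h1 h2 h3)
  have f3' : (rep rI 10 (put aPrice (reg rI + 1)
      (lim 3 * get aPrice (reg rI) / lim 2))).run σ₂ rScale = σ₂ rScale :=
    run_of_not_writes (by rfl) σ₂
  generalize (rep rI 10 (put aPrice (reg rI + 1)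
      (lim 3 * get aPrice (reg rI) / lim 2))).run σ₂ = σ₃ at key2 f3 f3'
  have e32 : σ₃ 2 = σ 2 := f3 _ (by decide) (by decide) (by decide)
  have e30 : σ₃ 0 = σ 0 := f3 _ (by decide) (by decide) (by decide)
  have key3 := Stmt.run_rep (x := rItem) (c := 0) (P := rep rB 1 (
    put aValue (lim 1 * reg rItem + reg rB)
      (get 0 (2 + lim 0 + (lim 1 * reg rItem + reg rB))) ;;
    rep rI 10 (
      put aValue (lim 1 * reg rItem + reg rB) (lim 2 * get aValue (lim 1 * reg rItem + reg rB)))))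
    (σ := σ₃) (fun k τ => ∀ i < k, ∀ b < m, τ aValue (m * i + b) =
      σ 0 (2 + n + (m * i + b)) * p ^ K) (by simp) (by
      intro i τ hi hx hfr hI
      have g2 : τ 2 = σ 2 := (hfr _ (by rfl)).trans e32
      have g0 : τ 0 = σ 0 := (hfr _ (by rfl)).trans e30
      have key4 := Stmt.run_rep (x := rB) (c := 1) (P :=
          put aValue (lim 1 * reg rItem + reg rB)
            (get 0 (2 + lim 0 + (lim 1 * reg rItem + reg rB))) ;;
          rep rI 10 (put aValue (lim 1 * reg rItem + reg rB)
            (lim 2 * get aValue (lim 1 * reg rItem + reg rB))))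
        (σ := τ) (fun k τ' => (∀ b < k, τ' aValue (m * i + b) =
          σ 0 (2 + n + (m * i + b)) * p ^ K) ∧
          ∀ i' < i, ∀ b < m, τ' aValue (m * i' + b) = τ aValue (m * i' + b))
        (by simp [Memory.store_apply]) (by
          rintro b τ' hb hx' hfr' ⟨hI1, hI2⟩
          rw [g2, hm] at hb
          have k2 : τ' 2 = σ 2 := (hfr' _ (by rfl)).trans g2
          have k0 : τ' 0 = σ 0 := (hfr' _ (by rfl)).trans g0
          have ki : τ' rItem 0 = i := by rw [hfr' _ (by rfl), hx]
          rw [run_seq]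
          set τ₁ := (put aValue (lim 1 * reg rItem + reg rB)
            (get 0 (2 + lim 0 + (lim 1 * reg rItem + reg rB)))).run τ' with hτ₁
          have t1 : ∀ a, a ≠ aValue → τ₁ a = τ' a := fun a ha => by
            simp [hτ₁, Memory.store_apply, ha]
          have t2 : τ₁ aValue = Function.update (τ' aValue) (m * i + b)
              (σ 0 (2 + n + (m * i + b))) := by
            simp [hτ₁, Memory.store_apply, k2, k0, ki, hx', hm, hn]
          have key5 := Stmt.run_rep (x := rI) (c := 10)
            (P := put aValue (lim 1 * reg rItem + reg rB)
              (lim 2 * get aValue (lim 1 * reg rItem + reg rB)))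
            (σ := τ₁) (fun k τ'' => τ'' aValue = Function.update (τ' aValue) (m * i + b)
              (σ 0 (2 + n + (m * i + b)) * p ^ k))
            (by simp [Memory.store_apply, t2]) (by
              intro k τ'' hk hx'' hfr'' hI''
              have u2 : τ'' 2 = σ 2 := by rw [hfr'' _ (by rfl), t1 _ (by decide), k2]
              have ui : τ'' rItem 0 = i := by rw [hfr'' _ (by rfl), t1 _ (by decide), ki]
              have ub : τ'' rB 0 = b := by rw [hfr'' _ (by rfl), t1 _ (by decide), hx']
              simp [Memory.store_apply, u2, ui, ub, hm, hp, hI'']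
              congr 1
              rw [pow_succ]
              ring)
          rw [t1 _ (by decide), k2, hK] at key5
          simp only [Memory.store_apply, Nat.reduceEqDiff, if_false, key5]
          constructor
          · intro b' hb'
            rcases Nat.lt_succ_iff_lt_or_eq.1 hb' with hlt | rfl
            · rw [Function.update_of_ne (by omega)]
              exact hI1 b' hlt
            · simp
          · intro i' hi' b' hb'
            rw [Function.update_of_ne (fun hcon => by
              have := (index_inj hb' hb).1 hcon
              omega)]
            exact hI2 i' hi' b' hb')
      rw [g2, hm] at key4
      intro i' hi' b hb
      simp only [Memory.store_apply, Nat.reduceEqDiff, if_false]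
      rcases Nat.lt_succ_iff_lt_or_eq.1 hi' with hlt | rfl
      · rw [key4.2 i' hlt b hb]
        exact hI i' hlt b hb
      · exact key4.1 b hb)
  rw [e32, hn] at key3
  refine ⟨?_, ?_, key3⟩
  · intro l hl
    rw [run_of_not_writes (by rfl)]
    exact key2 l hl
  · rw [run_of_not_writes (by rfl), f3', key1.2]

theorem run_maximum {σ : Memory} {n m : ℕ} (hn : σ 2 0 = n) (hm : σ 2 1 = m)
    (h0 : σ rMax 0 = 0) :
    (∀ i < n, ∀ b < m, σ 0 (2 + n + (m * i + b)) ≤ Alg.maximum.run σ rMax 0) ∧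
    (Alg.maximum.run σ rMax 0 = 0 ∨
      ∃ i < n, ∃ b < m, Alg.maximum.run σ rMax 0 = σ 0 (2 + n + (m * i + b))) := by
  have key := Stmt.run_rep (x := rItem) (c := 0) (P := rep rB 1 (
    branch (get 0 (2 + lim 0 + (lim 1 * reg rItem + reg rB)) - reg rMax)
      (set rMax (get 0 (2 + lim 0 + (lim 1 * reg rItem + reg rB)))) skip)) (σ := σ)
    (fun k τ => (∀ i < k, ∀ b < m, σ 0 (2 + n + (m * i + b)) ≤ τ rMax 0) ∧
      (τ rMax 0 = 0 ∨ ∃ i < n, ∃ b < m, τ rMax 0 = σ 0 (2 + n + (m * i + b))))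
    (by simp [Memory.store_apply, h0]) (by
      rintro i τ hi hx hfr ⟨hI1, hI2⟩
      rw [hn] at hi
      have g2 : τ 2 = σ 2 := hfr _ (by rfl)
      have g0 : τ 0 = σ 0 := hfr _ (by rfl)
      have key2 := Stmt.run_rep (x := rB) (c := 1) (P :=
          branch (get 0 (2 + lim 0 + (lim 1 * reg rItem + reg rB)) - reg rMax)
            (set rMax (get 0 (2 + lim 0 + (lim 1 * reg rItem + reg rB)))) skip) (σ := τ)
        (fun k τ' => τ rMax 0 ≤ τ' rMax 0 ∧ (∀ b < k, σ 0 (2 + n + (m * i + b)) ≤ τ' rMax 0) ∧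
          (τ' rMax 0 = 0 ∨ ∃ i < n, ∃ b < m, τ' rMax 0 = σ 0 (2 + n + (m * i + b))))
        (by simpa [Memory.store_apply] using hI2) (by
          rintro b τ' hb hx' hfr' ⟨hJ1, hJ2, hJ3⟩
          rw [g2, hm] at hb
          have k2 : τ' 2 = σ 2 := (hfr' _ (by rfl)).trans g2
          have k0 : τ' 0 = σ 0 := (hfr' _ (by rfl)).trans g0
          have ki : τ' rItem 0 = i := by rw [hfr' _ (by rfl), hx]
          by_cases hlt : σ 0 (2 + n + (m * i + b)) ≤ τ' rMax 0
          · rw [run_branch_neg (by simp [k2, k0, ki, hx', hn, hm]; omega)]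
            simp only [run_skip, Memory.store_apply, Nat.reduceEqDiff, if_false]
            refine ⟨hJ1, fun b' hb' => ?_, hJ3⟩
            rcases Nat.lt_succ_iff_lt_or_eq.1 hb' with h1 | rfl
            · exact hJ2 b' h1
            · exact hlt
          · rw [run_branch_pos (by simp [k2, k0, ki, hx', hn, hm]; omega)]
            have e : ((set rMax (get 0 (2 + lim 0 + (lim 1 * reg rItem + reg rB)))).run τ').store
                rB 0 (b + 1) rMax 0 = σ 0 (2 + n + (m * i + b)) := by
              simp [Memory.store_apply, k2, k0, ki, hx', hn, hm]
            rw [e]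
            refine ⟨by omega, fun b' hb' => ?_, Or.inr ⟨i, hi, b, hb, rfl⟩⟩
            rcases Nat.lt_succ_iff_lt_or_eq.1 hb' with h1 | rfl
            · have := hJ2 b' h1
              omega
            · exact le_rfl)
      rw [g2, hm] at key2
      obtain ⟨h1, h2, h3⟩ := key2
      simp only [Memory.store_apply, Nat.reduceEqDiff, if_false]
      refine ⟨fun i' hi' b hb => ?_, h3⟩
      rcases Nat.lt_succ_iff_lt_or_eq.1 hi' with hlt | rfl
      · exact (hI1 i' hlt b hb).trans h1
      · exact h2 b hb)
  rw [hn] at key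
  exact key

/-! ### Composition of polynomial stages -/

/-- Arbitrary products are allowed here, since multiplication at most adds lengths. A bound by a
multiple of `B + 1` is good enough for code without loops, such as the computation of the limits. -/
theorem value_lt {σ : Memory} {B : ℕ} (hB : ∀ a i, σ a i < 2 ^ B) (e : Term) :
    e.value σ < 2 ^ (e.weight * (B + 1)) := by
  have mono : ∀ {x u v : ℕ}, x < 2 ^ u → u ≤ v → x < 2 ^ v := fun h1 h2 =>
    h1.trans_le (Nat.pow_le_pow_right (by norm_num) h2)
  induction e with
  | const c =>
    refine mono Nat.lt_two_pow_self ?_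
    simp only [Term.weight, Term.value]
    nlinarith
  | get a e ih =>
    refine mono (hB _ _) ?_
    simp only [Term.weight]
    nlinarith
  | add e₁ e₂ h₁ h₂ =>
    have h : ∀ {x u : ℕ}, x < 2 ^ (u * (B + 1)) → u + 1 ≤ e₁.weight + e₂.weight + 1 →
        2 * x < 2 ^ ((e₁.weight + e₂.weight + 1) * (B + 1)) := by
      intro x u hx hu
      have h2 : 2 * x < 2 ^ (u * (B + 1) + 1) := by rw [pow_succ]; omega
      exact mono h2 (by nlinarith [Nat.mul_le_mul_right (B + 1) hu])
    have a1 := h h₁ (by omega)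
    have a2 := h h₂ (by omega)
    simp only [Term.value, Term.weight]
    omega
  | sub e₁ e₂ h₁ h₂ =>
    exact (Nat.sub_le _ _).trans_lt (mono h₁ (by simp only [Term.weight]; nlinarith))
  | div e₁ e₂ h₁ h₂ =>
    exact (Nat.div_le_self _ _).trans_lt (mono h₁ (by simp only [Term.weight]; nlinarith))
  | mul e₁ e₂ h₁ h₂ =>
    have a2 := Nat.mul_lt_mul'' h₁ h₂
    rw [← pow_add] at a2
    refine mono a2 ?_
    simp only [Term.weight]
    nlinarith

theorem cost_le {σ : Memory} {B : ℕ} (hB : ∀ a i, σ a i < 2 ^ B) (e : Term) :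
    e.cost σ ≤ e.weight * (e.weight * (B + 1) + 1) := by
  have key : ∀ e : Term, Nat.size (e.value σ) ≤ e.weight * (B + 1) := fun e =>
    Nat.size_le.2 (value_lt hB e)
  have comb : ∀ {u v w s x y : ℕ}, x ≤ u * (u * (B + 1) + 1) → y ≤ v * (v * (B + 1) + 1) →
      w = u + v + 1 → s ≤ w * (B + 1) → x + y + (1 + s) ≤ w * (w * (B + 1) + 1) := by
    intro u v w s x y hx hy hw hs
    have h1 : u * (u * (B + 1) + 1) ≤ u * (w * (B + 1) + 1) := by gcongr; omega
    have h2 : v * (v * (B + 1) + 1) ≤ v * (w * (B + 1) + 1) := by gcongr; omega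
    calc _ ≤ u * (w * (B + 1) + 1) + v * (w * (B + 1) + 1) + (w * (B + 1) + 1) := by omega
      _ = (u + v + 1) * (w * (B + 1) + 1) := by ring
      _ = w * (w * (B + 1) + 1) := by rw [← hw]
  induction e with
  | const c =>
    have := comb (u := c) (v := 0) (x := 0) (y := 0) (by simp) (by simp) rfl (key (.const c))
    simpa [Term.cost, Term.value, Term.weight] using this
  | get a e ih =>
    have := comb (v := 0) (y := 0) ih (by simp) (by simp [Term.weight]) (key (.get a e))
    simpa [Term.cost, Term.value] using this
  | add e₁ e₂ h₁ h₂ => exact comb h₁ h₂ rfl (key (.add e₁ e₂))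
  | sub e₁ e₂ h₁ h₂ => exact comb h₁ h₂ rfl (key (.sub e₁ e₂))
  | mul e₁ e₂ h₁ h₂ => exact comb h₁ h₂ rfl (key (.mul e₁ e₂))
  | div e₁ e₂ h₁ h₂ => exact comb h₁ h₂ rfl (key (.div e₁ e₂))

/-- From memories that satisfy `I x` and contain numbers of length polynomial in `ℓ x`, the program
reaches a memory that satisfies `J x` at polynomial cost, again with numbers of polynomial
length. -/
def PolyTriple {X : Type} (ℓ : X → ℕ) (I : X → Memory → Prop) (P : Program)
    (J : X → Memory → Prop) : Prop :=
  ∀ b : Polynomial ℕ, ∃ q : Polynomial ℕ, ∀ x σ, I x σ → (∀ a i, σ a i < 2 ^ b.eval (ℓ x)) →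
    ∃ σ' T, Exec P σ σ' T ∧ T ≤ q.eval (ℓ x) ∧ (∀ a i, σ' a i < 2 ^ q.eval (ℓ x)) ∧ J x σ'

section PolyTriple

variable {X : Type} {ℓ : X → ℕ} {I J K : X → Memory → Prop}

/-- A triple accepts any polynomial bound on the initial lengths, so the bound delivered by `P` can
be fed into `Q`. -/
theorem PolyTriple.seq {P Q : Program} (hP : PolyTriple ℓ I P J) (hQ : PolyTriple ℓ J Q K) :
    PolyTriple ℓ I (.seq P Q) K := by
  intro b
  obtain ⟨q₁, h₁⟩ := hP b
  obtain ⟨q₂, h₂⟩ := hQ q₁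
  refine ⟨q₁ + q₂, fun x σ hI hσ => ?_⟩
  obtain ⟨σ₁, T₁, e₁, t₁, b₁, j₁⟩ := h₁ x σ hI hσ
  obtain ⟨σ₂, T₂, e₂, t₂, b₂, j₂⟩ := h₂ x σ₁ j₁ b₁
  refine ⟨σ₂, _, Exec.seq e₁ e₂, ?_, fun a i => (b₂ a i).trans_le ?_, j₂⟩
  · rw [Polynomial.eval_add]
    omega
  · rw [Polynomial.eval_add]
    exact Nat.pow_le_pow_right (by norm_num) (by omega)

theorem PolyTriple.weaken {P : Program} (hP : PolyTriple ℓ I P J)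
    (h : ∀ x σ, J x σ → K x σ) : PolyTriple ℓ I P K := by
  intro b
  obtain ⟨q, hq⟩ := hP b
  refine ⟨q, fun x σ hI hσ => ?_⟩
  obtain ⟨σ', T, e, t, hb, j⟩ := hq x σ hI hσ
  exact ⟨σ', T, e, t, hb, h x σ' j⟩

/-- Statements that are sequences of assignments. -/
def straight : Stmt → Bool
  | .skip => true
  | .put _ _ _ => true
  | .seq P Q => straight P && straight Q
  | .branch _ _ _ => false
  | .rep _ _ _ => false

/-- Covers the code that writes the limits, which tame statements may not do. -/
theorem PolyTriple.of_straight (P : Stmt) (hP : straight P = true) (I : X → Memory → Prop) :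
    PolyTriple ℓ I P.toProgram fun x τ => ∃ σ, I x σ ∧ τ = P.run σ := by
  induction P generalizing I with
  | skip =>
    intro b
    refine ⟨b + 1, fun x σ hI hσ => ⟨σ, 1, Exec.skip σ, by simp, fun a i => (hσ a i).trans_le ?_,
      σ, hI, rfl⟩⟩
    rw [Polynomial.eval_add]
    exact Nat.pow_le_pow_right (by norm_num) (by omega)
  | put a e₁ e₂ =>
    intro b
    refine ⟨.C e₁.weight * (.C e₁.weight * (b + 1) + 1) +
      .C e₂.weight * (.C e₂.weight * (b + 1) + 1) + 1 + b, fun x σ hI hσ =>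
      ⟨_, _, Exec.put σ a e₁ e₂, ?_, ?_, σ, hI, rfl⟩⟩
    · have h1 := cost_le hσ e₁
      have h2 := cost_le hσ e₂
      simp only [Polynomial.eval_add, Polynomial.eval_mul, Polynomial.eval_C, Polynomial.eval_one]
      omega
    · have hle : e₂.weight * (b.eval (ℓ x) + 1) ≤
          e₂.weight * (e₂.weight * (b.eval (ℓ x) + 1) + 1) := by
        have := e₂.weight_pos
        exact Nat.mul_le_mul_left _ ((Nat.le_mul_of_pos_left _ this).trans (Nat.le_succ _))
      refine Memory.store_lt (fun a i => (hσ a i).trans_le ?_) ((value_lt hσ e₂).trans_le ?_) <;>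
      · simp only [Polynomial.eval_add, Polynomial.eval_mul, Polynomial.eval_C,
          Polynomial.eval_one]
        exact Nat.pow_le_pow_right (by norm_num) (by omega)
  | seq P Q ihP ihQ =>
    simp only [straight, Bool.and_eq_true] at hP
    refine ((ihP hP.1 I).seq (ihQ hP.2 _)).weaken ?_
    rintro x _ ⟨_, ⟨σ, hI, rfl⟩, rfl⟩
    exact ⟨σ, hI, rfl⟩
  | branch e P Q => simp [straight] at hP
  | rep x c P => simp [straight] at hP

theorem PolyTriple.of_tame (P : Stmt) (hP : P.tame = true) (N : Polynomial ℕ)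
    (hN : ∀ x σ, I x σ → ∀ c, σ 2 c ≤ N.eval (ℓ x)) :
    PolyTriple ℓ I P.toProgram fun x τ => ∃ σ, I x σ ∧ τ = P.run σ := by
  intro b
  obtain ⟨p, hp⟩ := P.load_polynomial
  refine ⟨p.comp N * (2 + b + p.comp N * (N + 1)) + (b + p.comp N * (N + 1)), fun x σ hI hσ => ?_⟩
  obtain ⟨⟨T, hT, hE⟩, hb⟩ := P.exec_toProgram hP σ _ hσ (hN x σ hI)
  refine ⟨_, T, hE, ?_, fun a i => (hb a i).trans_le ?_, σ, hI, rfl⟩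
  · rw [hp] at hT
    simp only [Polynomial.eval_add, Polynomial.eval_mul, Polynomial.eval_comp,
      Polynomial.eval_ofNat, Polynomial.eval_one]
    omega
  · rw [hp]
    simp only [Polynomial.eval_add, Polynomial.eval_mul, Polynomial.eval_comp,
      Polynomial.eval_ofNat, Polynomial.eval_one]
    exact Nat.pow_le_pow_right (by norm_num) (by omega)

theorem size_eq_size_half {x : ℕ} (hx : x ≠ 0) : Nat.size x = Nat.size (x / 2) + 1 := by
  have hpos : 0 < Nat.size x := Nat.size_pos.2 (Nat.pos_of_ne_zero hx)
  refine le_antisymm (Nat.size_le.2 ?_) ?_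
  · have := Nat.lt_size_self (x / 2)
    rw [pow_succ]
    omega
  · have h1 : Nat.size (x / 2) ≤ Nat.size x - 1 := by
      refine Nat.size_le.2 ?_
      have h2 := Nat.lt_size_self x
      obtain ⟨s, hs⟩ : ∃ s, Nat.size x = s + 1 := ⟨_, (Nat.succ_pred_eq_of_pos hpos).symm⟩
      rw [hs, pow_succ] at h2
      rw [hs, Nat.add_sub_cancel]
      omega
    omega

theorem store_cell (σ : Memory) (a i x b j : ℕ) :
    σ.store a i x b j = if b = a ∧ j = i then x else σ b j := by
  rw [Memory.store_apply]
  by_cases hb : b = a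
  · subst hb
    simp [Function.update_apply]
  · simp [hb]

/-- Adds the binary length of the number in register `50` to register `51`. -/
def sizeLoop : Program :=
  .loop (reg 50) (.seq (.put 51 0 (reg 51 + 1)) (.put 50 0 (reg 50 / 2)))

/-- Halving removes one binary digit per round. In `65 = 4 + 25 + 36` the summands are the squared
weights of the test and of the two assigned terms in `cost_le`; `20` covers their linear parts and
the unit costs. -/
theorem exec_sizeLoop {B : ℕ} (x : ℕ) : ∀ σ : Memory, σ 50 0 = x → (∀ a i, σ a i < 2 ^ B) →
    σ 51 0 + Nat.size x < 2 ^ B → ∃ T ≤ (Nat.size x + 1) * (65 * (B + 1) + 20),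
      Exec sizeLoop σ ((σ.store 51 0 (σ 51 0 + Nat.size x)).store 50 0 0) T := by
  induction x using Nat.strong_induction_on with
  | _ x ih =>
    intro σ hx hB hs
    have h50 := cost_le hB (reg 50)
    have w50 : (reg 50).weight = 2 := rfl
    rw [w50] at h50
    by_cases hx0 : x = 0
    · subst hx0
      have hcast : (σ.store 51 0 (σ 51 0 + Nat.size 0)).store 50 0 0 = σ := by
        funext a i
        simp only [store_cell, Nat.size_zero, add_zero]
        split_ifs with h1 h2
        · rw [h1.1, h1.2, hx]
        · rw [h2.1, h2.2]
        · rfl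
      refine ⟨_, ?_, (Exec.loop_stop (by simpa using hx)).cast hcast.symm rfl⟩
      simp only [Nat.size_zero]
      omega
    · have hsz := size_eq_size_half hx0
      set σ₁ := σ.store 51 0 (σ 51 0 + 1) with hσ₁
      set σ₂ := σ₁.store 50 0 (x / 2) with hσ₂
      have hB₁ : ∀ a i, σ₁ a i < 2 ^ B := Memory.store_lt hB (by omega)
      have hx₁ : σ₁ 50 0 = x := by simp [hσ₁, Memory.store_apply, hx]
      have hB₂ : ∀ a i, σ₂ a i < 2 ^ B := by
        refine Memory.store_lt hB₁ ?_
        have := hB 50 0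
        rw [hx] at this
        omega
      have hy₂ : σ₂ 51 0 = σ 51 0 + 1 := by simp [hσ₂, hσ₁, Memory.store_apply]
      obtain ⟨T, hT, hE⟩ := ih (x / 2) (by omega) σ₂ (by simp [hσ₂, Memory.store_apply]) hB₂
        (by rw [hy₂]; omega)
      have c1 := cost_le hB (reg 51 + 1)
      have c2 := cost_le hB₁ (reg 50 / 2)
      have w1 : (reg 51 + 1 : Term).weight = 5 := rfl
      have w2 : (reg 50 / 2 : Term).weight = 6 := rfl
      have c0 : ∀ τ : Memory, (0 : Term).cost τ = 1 := fun τ => by rfl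
      rw [w1] at c1
      rw [w2] at c2
      have e1 := Exec.put σ 51 0 (reg 51 + 1)
      have e2 := (Exec.put σ₁ 50 0 (reg 50 / 2)).cast (τ := σ₂) (by simp [hσ₂, hx₁]) rfl
      have e3 := Exec.loop_step (e := reg 50) (by simpa [hx] using hx0) (Exec.seq e1 e2) hE
      refine ⟨_, ?_, e3.cast ?_ rfl⟩
      · rw [c0, c0, hsz]
        have : (Nat.size (x / 2) + 1 + 1) * (65 * (B + 1) + 20) =
            (Nat.size (x / 2) + 1) * (65 * (B + 1) + 20) + (65 * (B + 1) + 20) := by ring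
        omega
      · funext a i
        simp only [hy₂, store_cell, hsz]
        split_ifs with h1 h2
        · rfl
        · omega
        · simp only [hσ₂, hσ₁, store_cell, if_neg h1, if_neg h2]

theorem PolyTriple.sizeLoop (I : X → Memory → Prop) : PolyTriple ℓ I sizeLoop fun x τ =>
    ∃ σ, I x σ ∧ τ = (σ.store 51 0 (σ 51 0 + Nat.size (σ 50 0))).store 50 0 0 := by
  intro b
  refine ⟨(b + 1) * (65 * (b + 2) + 20) + (b + 1), fun x σ hI hσ => ?_⟩
  have hs : Nat.size (σ 50 0) ≤ b.eval (ℓ x) := Nat.size_le.2 (hσ 50 0)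
  have hlt : b.eval (ℓ x) < 2 ^ b.eval (ℓ x) := Nat.lt_two_pow_self
  have h51 := hσ 51 0
  -- One extra bit makes room for the sum in register `51`.
  have hB : ∀ a i, σ a i < 2 ^ (b.eval (ℓ x) + 1) := fun a i => by
    have := hσ a i
    rw [pow_succ]
    omega
  have hsum : σ 51 0 + Nat.size (σ 50 0) < 2 ^ (b.eval (ℓ x) + 1) := by
    rw [pow_succ]
    omega
  obtain ⟨T, hT, hE⟩ := exec_sizeLoop (σ 50 0) σ rfl hB hsum
  refine ⟨_, T, hE, ?_, fun a i => lt_of_lt_of_le (Memory.store_lt (Memory.store_lt hB hsum)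
    (by positivity) a i) (Nat.pow_le_pow_right (by norm_num) ?_), σ, hI, rfl⟩
  · refine hT.trans ?_
    simp only [Polynomial.eval_add, Polynomial.eval_mul, Polynomial.eval_ofNat,
      Polynomial.eval_one]
    have : (Nat.size (σ 50 0) + 1) * (65 * (b.eval (ℓ x) + 1 + 1) + 20) ≤
        (b.eval (ℓ x) + 1) * (65 * (b.eval (ℓ x) + 2) + 20) := by
      gcongr
    omega
  · simp only [Polynomial.eval_add, Polynomial.eval_mul, Polynomial.eval_ofNat,
      Polynomial.eval_one]
    omega

end PolyTriple

/-! ### The encoding of instances -/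

section Input

variable (X : Instance)

theorem length_encode : X.encode.length = 2 + X.n + X.n * X.m := by
  simp [Instance.encode]
  omega

theorem encode_copies (i : Fin X.n) : X.encode.getD (2 + i) 0 = X.C i := by
  rw [List.getD_eq_getElem _ _ (by rw [length_encode]; omega)]
  simp only [Instance.encode, add_comm 2, List.getElem_cons_succ]
  rw [List.getElem_append_left (by simp)]
  simp

theorem index_lt {m i b n : ℕ} (hi : i < n) (hb : b < m) : m * i + b < n * m := by
  calc m * i + b < m * i + m := by omega
    _ = (i + 1) * m := by ring
    _ ≤ n * m := Nat.mul_le_mul_right _ hi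

theorem encode_value (i : Fin X.n) (b : Fin X.m) :
    X.encode.getD (2 + X.n + (X.m * i + b)) 0 = X.v i b := by
  have hlt : X.m * i + b < X.n * X.m := index_lt i.2 b.2
  rw [List.getD_eq_getElem _ _ (by rw [length_encode]; omega)]
  have e : 2 + X.n + (X.m * i + b) = X.n + (X.m * i + b) + 1 + 1 := by omega
  simp only [Instance.encode, e, List.getElem_cons_succ]
  rw [List.getElem_append_right (by simp)]
  simp only [List.length_ofFn, Nat.add_sub_cancel_left, List.getElem_ofFn]
  have hm : 0 < X.m := b.pos
  congr 1
  · ext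
    simp [Fin.divNat, Nat.mul_add_div hm, Nat.div_eq_of_lt b.2]
  · ext
    simp [Fin.modNat, Nat.mod_eq_of_lt b.2]

theorem length_le_bitLength (w : List ℕ) : w.length ≤ bitLength w := by
  unfold bitLength
  induction w with
  | nil => simp
  | cons x w ih =>
    simp only [List.length_cons, List.map_cons, List.sum_cons]
    omega

theorem initial_lt (w : List ℕ) (a i : ℕ) : initial w a i < 2 ^ bitLength w := by
  unfold initial
  split_ifs
  · by_cases hi : i < w.length
    · rw [List.getD_eq_getElem _ _ hi, ← Nat.size_le]
      have h := List.single_le_sum (l := w.map fun x => Nat.size x + 1) (by simp)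
        (Nat.size w[i] + 1) (List.mem_map.2 ⟨_, List.getElem_mem hi, rfl⟩)
      unfold bitLength
      omega
    · rw [List.getD_eq_default _ _ (by omega)]
      positivity
  · positivity

end Input

/-! ### Computation of the loop limits -/

/-- The number of bidders, or `0` if there are no items. -/
def bidders (X : Instance) : ℕ := X.m - (1 - X.n) * X.m

theorem bidders_eq {X : Instance} (h : X.n ≠ 0) : bidders X = X.m := by
  have h1 : 1 - X.n = 0 := by omega
  simp [bidders, h1]

/-- The word lists all `n * m` values, so this is a polynomial bound. Without items, `m` occurs only
in binary and a loop over all bidders could take exponential time; hence `bidders` in place of `m`.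
-/
theorem bidders_le (X : Instance) : bidders X ≤ X.n * X.m := by
  unfold bidders
  rcases Nat.eq_zero_or_pos X.n with h | h
  · simp [h]
  · exact (Nat.sub_le _ _).trans (Nat.le_mul_of_pos_left _ h)

/-- The limits that can be read off the input. -/
def inputLimits (p q t : ℕ) (X : Instance) : List ℕ :=
  [X.n, bidders X, p, q, t, t + 1, X.n + 1]

/-- The number of blocks of prices. -/
def numBlocks (κ : ℕ) (X : Instance) : ℕ := κ * Nat.size X.maxValue + X.n

/-- All limits. -/
def limits (p q t κ : ℕ) (X : Instance) : List ℕ :=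
  [X.n, bidders X, p, q, t, t + 1, X.n + 1, bidders X * (bidders X + 1) + 1,
    (X.n + 1) ^ (t + 1), numBlocks κ X, numBlocks κ X * t]

/-- The memory holds the input, the limits `L`, and an empty output. -/
structure Loaded (X : Instance) (L : List ℕ) (σ : Memory) : Prop where
  input : σ 0 = fun i => X.encode.getD i 0
  output : σ aOut = fun _ => 0
  limits : σ 2 = fun c => L.getD c 0

theorem Loaded.congr {X : Instance} {L : List ℕ} {σ τ : Memory} (h : Loaded X L σ)
    (h0 : τ 0 = σ 0) (h1 : τ aOut = σ aOut) (h2 : τ 2 = σ 2) : Loaded X L τ :=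
  ⟨h0.trans h.input, h1.trans h.output, h2.trans h.limits⟩

namespace Alg

/-- Stores the limits that can be read off the input. -/
def storeInputLimits (p q t : ℕ) : Stmt :=
  put 2 0 (get 0 0) ;;
  put 2 1 (get 0 1 - (1 - get 0 0) * get 0 1) ;;
  put 2 2 (const p) ;;
  put 2 3 (const q) ;;
  put 2 4 (const t) ;;
  put 2 5 (const (t + 1)) ;;
  put 2 6 (get 0 0 + 1)

/-- The power of a term. -/
def powTerm (e : Term) : ℕ → Term
  | 0 => 1
  | k + 1 => powTerm e k * e

/-- Stores the other limits, where register `51` holds the length of the largest value. -/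
def storeLimits (t κ : ℕ) : Stmt :=
  put 2 7 (lim 1 * (lim 1 + 1) + 1) ;;
  -- Since `t` is a constant of the program, the power unrolls into a single term.
  put 2 8 (powTerm (lim 6) (t + 1)) ;;
  put 2 9 (const κ * reg 51 + lim 0) ;;
  put 2 10 (lim 9 * lim 4)

/-- The whole algorithm. -/
def program (p q t κ : ℕ) : Program :=
  .seq (storeInputLimits p q t).toProgram (.seq maximum.toProgram
    (.seq (set 50 (reg rMax)).toProgram (.seq sizeLoop
      (.seq (storeLimits t κ).toProgram solve.toProgram))))

end Alg

theorem value_powTerm (σ : Memory) (e : Term) (k : ℕ) :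
    (Alg.powTerm e k).value σ = e.value σ ^ k := by
  induction k with
  | zero => rfl
  | succ k ih => rw [Alg.powTerm, value_mul, ih, pow_succ]

theorem run_storeInputLimits (p q t : ℕ) (X : Instance) :
    Loaded X (inputLimits p q t X) ((Alg.storeInputLimits p q t).run (initial X.encode)) ∧
    ∀ a, a ≠ 0 → a ≠ 2 → (Alg.storeInputLimits p q t).run (initial X.encode) a = fun _ => 0 := by
  have hw : ∀ a, a ≠ 2 → (Alg.storeInputLimits p q t).run (initial X.encode) a =
      initial X.encode a := fun a ha => by
    simp [Alg.storeInputLimits, Memory.store_apply, ha]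
  refine ⟨⟨?_, ?_, ?_⟩, ?_⟩
  · rw [hw _ (by decide)]
    rfl
  · rw [hw _ (by decide)]
    rfl
  · funext c
    have h0 : initial X.encode 0 0 = X.n := rfl
    have h1 : initial X.encode 0 1 = X.m := rfl
    have h2 : initial X.encode 2 = fun _ => 0 := rfl
    simp only [Alg.storeInputLimits, run_seq, run_put, value_sub, store_cell, inputLimits,
      bidders, Term.value, h0, h1, h2]
    rcases c with _ | _ | _ | _ | _ | _ | _ | c <;> simp
  · intro a h0 h2
    rw [hw a h2]
    funext i
    simp [initial, h0]

theorem run_maximum_eq {p q t : ℕ} {X : Instance} {σ : Memory}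
    (h : Loaded X (inputLimits p q t X) σ) (h0 : σ rMax 0 = 0) :
    Alg.maximum.run σ rMax 0 = X.maxValue := by
  obtain ⟨h1, h2⟩ := run_maximum (n := X.n) (m := bidders X) (by rw [h.limits]; rfl)
    (by rw [h.limits]; rfl) h0
  refine le_antisymm ?_ ?_
  · rcases h2 with h2 | ⟨i, hi, b, hb, h2⟩
    · omega
    · rw [bidders_eq (by omega)] at hb h2
      have h3 := encode_value X ⟨i, hi⟩ ⟨b, hb⟩
      rw [h2, h.input]
      exact h3.trans_le (X.le_maxValue _ _)
  · refine Finset.sup_le fun ib _ => ?_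
    rw [bidders_eq (Nat.pos_iff_ne_zero.1 ib.1.pos), h.input] at h1
    exact (encode_value X ib.1 ib.2).symm.trans_le (h1 ib.1 ib.1.2 ib.2 ib.2.2)

theorem run_storeLimits {p q t κ : ℕ} {X : Instance} {σ : Memory}
    (h : Loaded X (inputLimits p q t X) σ) (hs : σ 51 0 = Nat.size X.maxValue) :
    Loaded X (limits p q t κ X) ((Alg.storeLimits t κ).run σ) := by
  have hw : ∀ a, a ≠ 2 → (Alg.storeLimits t κ).run σ a = σ a := fun a ha => by
    simp [Alg.storeLimits, Memory.store_apply, ha]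
  refine ⟨(hw _ (by decide)).trans h.input, (hw _ (by decide)).trans h.output, ?_⟩
  funext c
  simp only [Alg.storeLimits, run_seq, run_put, value_lim, value_reg,
    store_cell, value_powTerm, h.limits, hs, Term.value]
  rcases c with _ | _ | _ | _ | _ | _ | _ | _ | _ | _ | _ | c <;>
    simp [inputLimits, limits, numBlocks]

theorem env_of_loaded {p q t κ : ℕ} (hqp : q < p) (ht : 0 < t) {X : Instance}
    (hX : X.n ≠ 0) {σ : Memory} (h : Loaded X (limits p q t κ X) σ)
    (hmax : σ rMax 0 = X.maxValue) :
    Env (X.market p q t (numBlocks κ X)) (Alg.scale.run σ) ∧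
      Alg.scale.run σ rScale 0 = p ^ (numBlocks κ X * t) := by
  obtain ⟨h1, h2, h3⟩ := run_scale (σ := σ) (n := X.n) (m := X.m) (p := p) (q := q)
    (K := numBlocks κ X * t) (by rw [h.limits]; rfl)
    (by rw [h.limits]; exact bidders_eq hX) (by rw [h.limits]; rfl) (by rw [h.limits]; rfl)
    (by rw [h.limits]; rfl) (by omega)
  have e2 : Alg.scale.run σ 2 = fun c => (limits p q t κ X).getD c 0 :=
    (run_of_not_writes (by rfl) σ).trans h.limits
  have e0 : Alg.scale.run σ 0 = fun i => X.encode.getD i 0 :=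
    (run_of_not_writes (by rfl) σ).trans h.input
  refine ⟨⟨ht, X.market_D_antitone hqp.le, ?_, ?_, ?_, ?_, ?_, ?_, ?_, ?_, ?_, ?_, ?_, ?_⟩, h2⟩
  · rw [e2]; rfl
  · rw [e2]; exact bidders_eq hX
  · rw [e2]; rfl
  · rw [e2]; rfl
  · rw [e2]; rfl
  · rw [e2]
    change bidders X * (bidders X + 1) + 1 = _
    rw [bidders_eq hX]; rfl
  · rw [e2]; rfl
  · rw [e2]; rfl
  · rw [e2]; rfl
  · intro i hi
    have hi' : i < X.n := hi
    rw [e0]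
    simp only [Instance.market, dif_pos hi']
    exact encode_copies X ⟨i, hi'⟩
  · intro l hl
    have hl' : l ≤ numBlocks κ X * t := hl
    rw [h1 l hl', hmax]
    simp only [Instance.market, min_eq_left hl']
  · intro i hi b hb
    have hi' : i < X.n := hi
    have hb' : b < X.m := hb
    have h4 := h3 i hi' b hb'
    rw [h.input] at h4
    have h5 := encode_value X ⟨i, hi'⟩ ⟨b, hb'⟩
    simp only at h4 h5
    rw [h5] at h4
    simp only [Instance.market, dif_pos (And.intro hi' hb')]
    exact h4

/-! ### Correctness and running time of the whole algorithm -/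

/-- All grid prices are `0`, so every feasible profit vanishes and the empty allocation with prices
`0 / 1` is optimal. -/
theorem run_solve_of_maxValue_eq_zero {p q t κ : ℕ} {X : Instance} {σ : Memory}
    (h : Loaded X (limits p q t κ X) σ) (hmax : σ rMax 0 = X.maxValue) (hM : X.maxValue = 0)
    (α : ℚ) : ∃ s : Outcome X, Represents X (Alg.solve.run σ aOut) s ∧ s.IsOptimal α t := by
  have key := Stmt.run_rep (x := rJ) (c := 0) (P := put aOut (reg rJ + reg rJ + 1) 1) (σ := σ)
    (fun k τ => (∀ i < k, τ aOut (2 * i + 1) = 1 ∧ τ aOut (2 * i) = 0) ∧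
      (∀ i, k ≤ i → τ aOut (2 * i) = 0) ∧ ∀ x, 2 * X.n ≤ x → τ aOut x = 0)
    (by simp [Memory.store_apply, h.output]) (by
      rintro k τ hk hx hfr ⟨hI1, hI2, hI3⟩
      have hk' : k < X.n := by rw [h.limits] at hk; exact hk
      simp only [run_put, value_add, value_reg, value_ofNat, store_cell, hx]
      refine ⟨fun i hi => ⟨?_, ?_⟩, fun i hi => ?_, fun x hx => ?_⟩
      · rw [if_neg (by omega)]
        split_ifs with hc
        · rfl
        · exact (hI1 i (by_contra fun hlt => hc ⟨trivial, by omega⟩)).1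
      · rw [if_neg (by omega), if_neg (by omega)]
        rcases Nat.lt_succ_iff_lt_or_eq.1 hi with h1 | rfl
        · exact (hI1 i h1).2
        · exact hI2 i le_rfl
      · rw [if_neg (by omega), if_neg (by omega)]
        exact hI2 i (by omega)
      · rw [if_neg (by omega), if_neg (by omega)]
        exact hI3 x hx)
  have hn : σ 2 0 = X.n := by rw [h.limits]; rfl
  have hrun : Alg.solve.run σ = (rep rJ 0 (put aOut (reg rJ + reg rJ + 1) 1)).run σ :=
    run_branch_neg (by rw [value_reg, hmax, hM])
  rw [hn, ← hrun] at key
  have hgrid : ∀ k, X.gridPrice α k = 0 := fun k => by simp [Instance.gridPrice, hM]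
  refine ⟨⟨fun _ => 0, fun _ => ∅⟩, ⟨fun i => ⟨?_, ?_⟩, fun i b => ?_⟩, ⟨?_, ?_, ?_, ?_, ?_, ?_⟩,
    ?_⟩
  · rw [(key.1 i i.2).1]
    decide
  · simp [(key.1 i i.2).2]
  · simp [key.2.2 _ (Nat.le_add_right _ _)]
  · exact fun _ => le_rfl
  · exact fun _ _ _ => le_rfl
  · exact fun _ => ⟨0, (hgrid 0).symm⟩
  · simp
  · simp
  · simp
  · intro s hs
    have hprice : ∀ i, s.price i = 0 := fun i => by
      obtain ⟨k, hk⟩ := hs.price_grid i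
      rw [hk, hgrid]
    simp [Outcome.profit, hprice]

theorem run_solve {p q t κ : ℕ} (hq : q ≠ 0) (hqp : q < p) (ht : 0 < t)
    (hκ : 2 ≤ ((p : ℚ) / q) ^ κ) {X : Instance} {σ : Memory}
    (h : Loaded X (limits p q t κ X) σ) (hmax : σ rMax 0 = X.maxValue) :
    ∃ s : Outcome X, Represents X (Alg.solve.run σ aOut) s ∧ s.IsOptimal ((p : ℚ) / q) t := by
  classical
  by_cases hM : X.maxValue = 0
  · exact run_solve_of_maxValue_eq_zero h hmax hM _
  have hn : X.n ≠ 0 := by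
    intro hn
    apply hM
    have : IsEmpty (Fin X.n) := by rw [hn]; infer_instance
    simp [Instance.maxValue]
  have hrun : Alg.solve.run σ = (Alg.scale ;; Alg.table ;; Alg.reconstruct ;; Alg.prices).run σ :=
    run_branch_pos (by rw [value_reg, hmax]; exact hM)
  rw [hrun]
  simp only [run_seq]
  obtain ⟨hE, hscale⟩ := env_of_loaded hqp ht hn h hmax
  have hout : Alg.scale.run σ aOut = fun _ => 0 := (run_of_not_writes (by rfl) σ).trans h.output
  set R := numBlocks κ X with hR
  generalize Alg.scale.run σ = σ₁ at hE hscale hout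
  have htab := run_table hE
  have hE₂ : Env (X.market p q t R) (Alg.table.run σ₁) :=
    hE.run _ (by rfl) (by rfl) (by rfl) (by rfl)
  have hout₂ : Alg.table.run σ₁ aOut = fun _ => 0 := (run_of_not_writes (by rfl) σ₁).trans hout
  have hscale₂ : Alg.table.run σ₁ rScale 0 = p ^ (R * t) := by
    rw [run_of_not_writes (by rfl)]
    exact hscale
  generalize Alg.table.run σ₁ = σ₂ at htab hE₂ hout₂ hscale₂
  obtain ⟨hplan, hprofit, hle, h01⟩ := run_reconstruct hE₂ htab
    (fun i _ b _ => by simp [allocated, hout₂])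
  have hE₃ : Env (X.market p q t R) (Alg.reconstruct.run σ₂) :=
    hE₂.run _ (by rfl) (by rfl) (by rfl) (by rfl)
  have hscale₃ : Alg.reconstruct.run σ₂ rScale 0 = p ^ (R * t) := by
    rw [run_of_not_writes (by rfl)]
    exact hscale₂
  generalize Alg.reconstruct.run σ₂ = σ₃ at hplan hprofit hle h01 hE₃ hscale₃
  obtain ⟨hpr, hkeep⟩ := run_prices hE₃
  have hp0 : 0 < p ^ (R * t) := by
    have : 0 < p := by omega
    positivity
  let s : Outcome X := ⟨fun i => ((X.market p q t R).D (σ₃ aFinal i) : ℚ) / (p : ℚ) ^ (R * t),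
    fun b => {i | allocated (X.market p q t R) σ₃ i b = 1}⟩
  have hA : ∀ (i : Fin X.n) (b : Fin X.m),
      allocated (X.market p q t R) σ₃ i b = 1 ↔ i ∈ s.alloc b := by
    intro i b
    simp [s]
  obtain ⟨hfeas, hval⟩ := X.isFeasible_of_isPlan hq hqp ht hM s hA hle hplan fun i => rfl
  refine ⟨s, ⟨fun i => ?_, fun i b => ?_⟩, hfeas, fun s' hs' => ?_⟩
  · obtain ⟨h1, h2⟩ := hpr i i.2
    rw [h1, h2, hscale₃, hE₃.price _ (hle i i.2)]
    refine ⟨hp0.ne', ?_⟩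
    push_cast
    rfl
  · have h1 := hkeep (2 * X.n + (i * X.m + b)) (Nat.le_add_right _ _)
    rw [h1]
    have h2 : σ₃ aOut (2 * X.n + (i * X.m + b)) = allocated (X.market p q t R) σ₃ i b := by
      rw [mul_comm (i : ℕ)]
      rfl
    rw [h2]
    rcases h01 i i.2 b b.2 with h3 | h3
    · rw [h3, if_neg]
      rw [← hA, h3]
      decide
    · rw [h3, if_pos ((hA i b).1 h3)]
  · have h1 := X.profit_le_value hq hqp ht hκ hM s' hs' (R := R) hR
    have h2 : s'.profit * (p : ℚ) ^ (R * t) ≤ s.profit * (p : ℚ) ^ (R * t) := by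
      exact h1.trans_eq ((congrArg (Nat.cast (R := ℚ)) hprofit).symm.trans hval.symm)
    have h3 : (0 : ℚ) < (p : ℚ) ^ (R * t) := by exact_mod_cast hp0
    exact le_of_mul_le_mul_right h2 h3

theorem getD_le_sum (L : List ℕ) (c : ℕ) : L.getD c 0 ≤ L.sum := by
  by_cases hc : c < L.length
  · rw [List.getD_eq_getElem _ _ hc]
    exact List.single_le_sum (by simp) _ (List.getElem_mem hc)
  · rw [List.getD_eq_default _ _ (by omega)]
    exact Nat.zero_le _

theorem items_le (X : Instance) : X.n ≤ bitLength X.encode := by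
  have h := length_le_bitLength X.encode
  rw [length_encode] at h
  omega

theorem bidders_le_bitLength (X : Instance) : bidders X ≤ bitLength X.encode := by
  have h := length_le_bitLength X.encode
  have h' := bidders_le X
  rw [length_encode] at h
  omega

theorem size_maxValue_le (X : Instance) : Nat.size X.maxValue ≤ bitLength X.encode := by
  refine Nat.size_le.2 ((Finset.sup_lt_iff (by positivity)).2 fun ib _ => ?_)
  rw [← encode_value X ib.1 ib.2]
  exact initial_lt X.encode 0 _

theorem exists_inputLimits_le (p q t : ℕ) : ∃ N : Polynomial ℕ, ∀ X : Instance, ∀ c,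
    (inputLimits p q t X).getD c 0 ≤ N.eval (bitLength X.encode) := by
  refine ⟨3 * .X + .C (p + q + t + (t + 1) + 1), fun X c => (getD_le_sum _ c).trans ?_⟩
  have h1 := items_le X
  have h2 := bidders_le_bitLength X
  simp only [inputLimits, List.sum_cons, List.sum_nil, Polynomial.eval_add, Polynomial.eval_mul,
    Polynomial.eval_ofNat, Polynomial.eval_X, Polynomial.eval_C]
  omega

theorem exists_limits_le (p q t κ : ℕ) : ∃ N : Polynomial ℕ, ∀ X : Instance, ∀ c,
    (limits p q t κ X).getD c 0 ≤ N.eval (bitLength X.encode) := by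
  refine ⟨3 * .X + .C (p + q + t + (t + 1) + 1) + (.X * (.X + 1) + 1) + (.X + 1) ^ (t + 1) +
    (.C κ * .X + .X) + (.C κ * .X + .X) * .C t, fun X c => (getD_le_sum _ c).trans ?_⟩
  have h1 := items_le X
  have h2 := bidders_le_bitLength X
  have h3 : numBlocks κ X ≤ κ * bitLength X.encode + bitLength X.encode :=
    Nat.add_le_add (Nat.mul_le_mul_left _ (size_maxValue_le X)) h1
  have h4 := Nat.mul_le_mul_right t h3
  have h5 := Nat.mul_le_mul h2 (Nat.add_le_add_right h2 1)
  have h6 : (X.n + 1) ^ (t + 1) ≤ (bitLength X.encode + 1) ^ (t + 1) := by gcongr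
  simp only [limits, List.sum_cons, List.sum_nil, Polynomial.eval_add, Polynomial.eval_mul,
    Polynomial.eval_ofNat, Polynomial.eval_X, Polynomial.eval_C, Polynomial.eval_one,
    Polynomial.eval_pow]
  omega

/-- The limits come in two instalments: the largest value is found with those read off the input,
and its bit length determines the number of blocks and thereby the remaining ones. -/
theorem polyTriple_program {p q t κ : ℕ} (hq : q ≠ 0) (hqp : q < p) (ht : 0 < t)
    (hκ : 2 ≤ ((p : ℚ) / q) ^ κ) :
    PolyTriple (fun X : Instance => bitLength X.encode) (fun X σ => σ = initial X.encode)
      (Alg.program p q t κ) fun X σ =>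
        ∃ s : Outcome X, Represents X (σ aOut) s ∧ s.IsOptimal ((p : ℚ) / q) t := by
  obtain ⟨N₁, hN₁⟩ := exists_inputLimits_le p q t
  obtain ⟨N₂, hN₂⟩ := exists_limits_le p q t κ
  refine (PolyTriple.of_straight (Alg.storeInputLimits p q t) (by rfl) _).weaken
    (K := fun X σ => Loaded X (inputLimits p q t X) σ ∧ σ rMax 0 = 0 ∧ σ 51 0 = 0) ?_ |>.seq ?_
  · rintro X _ ⟨_, rfl, rfl⟩
    obtain ⟨h1, h2⟩ := run_storeInputLimits p q t X
    exact ⟨h1, by rw [h2 _ (by decide) (by decide)], by rw [h2 _ (by decide) (by decide)]⟩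
  refine (PolyTriple.of_tame Alg.maximum maximum_tame N₁ ?_).weaken
    (K := fun X σ => Loaded X (inputLimits p q t X) σ ∧ σ rMax 0 = X.maxValue ∧ σ 51 0 = 0) ?_
    |>.seq ?_
  · rintro X σ ⟨h, -⟩ c
    rw [h.limits]
    exact hN₁ X c
  · rintro X _ ⟨σ, ⟨h1, h2, h3⟩, rfl⟩
    exact ⟨h1.congr (run_of_not_writes (by rfl) σ) (run_of_not_writes (by rfl) σ)
      (run_of_not_writes (by rfl) σ), run_maximum_eq h1 h2,
      by rw [run_of_not_writes (by rfl)]; exact h3⟩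
  refine (PolyTriple.of_straight (set 50 (reg rMax)) (by rfl) _).weaken
    (K := fun X σ => Loaded X (inputLimits p q t X) σ ∧ σ rMax 0 = X.maxValue ∧ σ 51 0 = 0 ∧
      σ 50 0 = X.maxValue) ?_ |>.seq ?_
  · rintro X _ ⟨σ, ⟨h1, h2, h3⟩, rfl⟩
    exact ⟨h1.congr (run_of_not_writes (by rfl) σ) (run_of_not_writes (by rfl) σ)
      (run_of_not_writes (by rfl) σ), by simpa [store_cell] using h2,
      by simpa [store_cell] using h3, by simpa [store_cell] using h2⟩
  refine (PolyTriple.sizeLoop _).weaken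
    (K := fun X σ => Loaded X (inputLimits p q t X) σ ∧ σ rMax 0 = X.maxValue ∧
      σ 51 0 = Nat.size X.maxValue) ?_ |>.seq ?_
  · rintro X _ ⟨σ, ⟨h1, h2, h3, h4⟩, rfl⟩
    refine ⟨h1.congr ?_ ?_ ?_, ?_, ?_⟩
    · simp [Memory.store_apply]
    · simp [Memory.store_apply]
    · simp [Memory.store_apply]
    · simpa [store_cell] using h2
    · simp [store_cell, h3, h4]
  refine (PolyTriple.of_straight (Alg.storeLimits t κ) (by rfl) _).weaken
    (K := fun X σ => Loaded X (limits p q t κ X) σ ∧ σ rMax 0 = X.maxValue) ?_ |>.seq ?_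
  · rintro X _ ⟨σ, ⟨h1, h2, h3⟩, rfl⟩
    exact ⟨run_storeLimits h1 h3, by rw [run_of_not_writes (by rfl)]; exact h2⟩
  refine (PolyTriple.of_tame Alg.solve solve_tame N₂ ?_).weaken ?_
  · rintro X σ ⟨h, -⟩ c
    rw [h.limits]
    exact hN₂ X c
  · rintro X _ ⟨σ, ⟨h1, h2⟩, rfl⟩
    exact run_solve hq hqp ht hκ h1 h2

theorem exists_pow_two_le {α : ℚ} (hα : 1 < α) : ∃ p q κ : ℕ, q ≠ 0 ∧ q < p ∧ α = (p : ℚ) / q ∧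
    2 ≤ ((p : ℚ) / q) ^ κ := by
  obtain ⟨κ, hκ⟩ := pow_unbounded_of_one_lt 2 hα
  have hnum : 0 ≤ α.num := Rat.num_nonneg.2 (by linarith)
  have hcast : ((α.num.toNat : ℕ) : ℚ) = α.num := by
    exact_mod_cast congrArg (Int.cast (R := ℚ)) (Int.toNat_of_nonneg hnum)
  have he : α = ((α.num.toNat : ℕ) : ℚ) / (α.den : ℕ) := by rw [hcast, Rat.num_div_den]
  have hden : (0 : ℚ) < α.den := by exact_mod_cast α.den_pos
  refine ⟨α.num.toNat, α.den, κ, α.den_nz, ?_, he, ?_⟩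
  · rw [he, one_lt_div hden] at hα
    exact_mod_cast hα
  · rw [← he]
    exact hκ.le

end MaxBuying

theorem mainTheorem4 (α : ℚ) (hα : 1 < α) (t : ℕ) (ht : 0 < t) :
    RAM.PolyTimeSolvable MaxBuying.Instance.encode MaxBuying.Represents
      (fun _ s => MaxBuying.Outcome.IsOptimal α t s) := by
  obtain ⟨p, q, κ, hq, hqp, rfl, hκ⟩ := MaxBuying.exists_pow_two_le hα
  -- The polynomial `X` bounds the initial lengths, as no number of the input is longer than the
  -- input.
  obtain ⟨b, hb⟩ := MaxBuying.polyTriple_program hq hqp ht hκ Polynomial.X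
  refine ⟨MaxBuying.Alg.program p q t κ, b, fun X => ?_⟩
  obtain ⟨σ, T, hE, hT, -, s, hs⟩ := hb X _ rfl fun a i => by
    rw [Polynomial.eval_X]
    exact MaxBuying.initial_lt _ a i
  exact ⟨σ, T, hE, hT, s, hs⟩
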